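/- Let $H$ be a probability measure on the Borel sets of $\mathbb{R}$. For $\gamma_1,\dots,\gamma_m>0$, the normalized inverse-Gaussian distribution with parameters $(\gamma_1,\dots,\gamma_m)$ is the law on the simplex $\mathbb{S}=\{z\in[0,1]^m:\sum_i z_i=1\}$ with density, with respect to Lebesgue measure in $(z_1,\dots,z_{m-1})$, $$f(z)=\frac{e^{\sum_{i=1}^m\gamma_i}\prod_{i=1}^m\gamma_i}{2^{m/2-1}\pi^{m/2}}\,K_{-m/2}\Bigl(\sqrt{\textstyle\sum_{i=1}^m\gamma_i^2/z_i}\Bigr)\Bigl(\textstyle\sum_{i=1}^m\gamma_i^2/z_i\Bigr)^{-m/4}\prod_{i=1}^m z_i^{-3/2},$$ where $K$ is the modified Bessel function of the third kind (for $m=1$ it is the unit mass at $1$). For $a>0$, a random probability measure $P_{H,a}$ on $\mathbb{R}$ is a normalized inverse-Gaussian process with parameters $a$ and $H$ if $P_{H,a}(A)=0$ almost surely for every Borel set $A$ with $H(A)=0$, and if for every finite Borel partition $A_1,\dots,A_m$ of $\mathbb{R}$ with all $H(A_i)>0$ the vector $(P_{H,a}(A_1),\dots,P_{H,a}(A_m))$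 has the normalized inverse-Gaussian distribution with parameters $(aH(A_1),\dots,aH(A_m))$. Let $D[-\infty,\infty]$ be the space of real functions on $[-\infty,\infty]$ that are right continuous with left limits, with the Skorokhod topology: the topology of the distance $d(x,y)$ that is the infimum, over all increasing bijections $\sigma$ of $[-\infty,\infty]$, of $\max\{\sup_t|\phi(\sigma(t))-\phi(t)|,\ \sup_t|x(\sigma(t))-y(t)|\}$, where $\phi(t)=e^t/(1+e^t)$ maps $[-\infty,\infty]$ onto $[0,1]$. For $t\in[-\infty,\infty]$ write $S_t=\{x\in\mathbb{R}:x\le t\}$. A random element $B_H$ of $D[-\infty,\infty]$ is called a Brownian bridge with parameter measure $H$ if $(B_H(t))_t$ is a Gaussian process with $E[B_H(t)]=0$ and $\operatorname{Cov}(B_H(s),B_H(t))=H(S_s\cap S_t)-H(S_s)H(S_t)$. **Theorem.** For each $a>0$ let $P_{H,a}$ be a normalized inverse-Gaussian process with parameters $a$ and $H$ (the processes may live on different probability spaces), and let $D_{H,a}(t)=\sqrt{a}\,\bigl(P_{H,a}(S_t)-H(S_t)\bigr)$ for $t\in[-\infty,\infty]$. Then a Brownian bridge $B_H$ with parameter measure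 $H$ exists as a random element of $D[-\infty,\infty]$, each $D_{H,a}$ is a random element of $D[-\infty,\infty]$, and for every such $B_H$, as $a\to\infty$, $D_{H,a}$ converges in distribution to $B_H$ on $D[-\infty,\infty]$ with respect to the Skorokhod topology. -/

import Mathlib

open MeasureTheory ProbabilityTheory Filter Topology

noncomputable section

namespace NIG

/-! ### The Skorokhod space `D[-∞,∞]` -/

/-- `D[-∞,∞]`: the real functions on the extended real line that are right continuous
and have left limits at every point. -/
structure Cadlag where
  /-- the underlying function -/
  toFun : EReal → ℝ
  right_continuous : ∀ t, ContinuousWithinAt toFun (Set.Ici t) t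
  left_limit : ∀ t, ∃ l, Tendsto toFun (𝓝[<] t) (𝓝 l)

instance : CoeFun Cadlag (fun _ => EReal → ℝ) := ⟨Cadlag.toFun⟩

/-- The increasing homeomorphism `t ↦ eᵗ / (1 + eᵗ)` of `[-∞,∞]` onto `[0,1]`, which serves to
measure distances on the time axis. -/
def compress : EReal ≃o Set.Icc (0 : ℝ) 1 :=
  EReal.expOrderIso.trans ENNReal.orderIsoUnitIntervalBirational

/-- The larger of the uniform distance of the time change `σ` from the identity and the uniform
distance of `x ∘ σ` from `y`. -/
def timeChangeCost (x y : EReal → ℝ) (σ : EReal ≃o EReal) : ENNReal :=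
  max (⨆ t, edist (compress (σ t)) (compress t)) (⨆ t, edist (x (σ t)) (y t))

/-- The Skorokhod distance: the infimum of the cost over all increasing bijections of `[-∞,∞]`
onto itself (these are automatically homeomorphisms). -/
def skorokhodEDist (x y : Cadlag) : ENNReal := ⨅ σ : EReal ≃o EReal, timeChangeCost x y σ

theorem timeChangeCost_symm (x y : EReal → ℝ) (σ : EReal ≃o EReal) :
    timeChangeCost y x σ.symm ≤ timeChangeCost x y σ := by
  refine max_le_max (iSup_le fun t => ?_) (iSup_le fun t => ?_)
  · refine le_trans (le_of_eq ?_) (le_iSup _ (σ.symm t))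
    rw [OrderIso.apply_symm_apply, edist_comm]
  · refine le_trans (le_of_eq ?_) (le_iSup _ (σ.symm t))
    rw [OrderIso.apply_symm_apply, edist_comm]

theorem timeChangeCost_trans (x y z : EReal → ℝ) (σ τ : EReal ≃o EReal) :
    timeChangeCost x z (τ.trans σ) ≤ timeChangeCost x y σ + timeChangeCost y z τ := by
  refine max_le (iSup_le fun t => ?_) (iSup_le fun t => ?_)
  · refine (edist_triangle _ (compress (τ t)) _).trans (add_le_add ?_ ?_)
    · exact le_trans (le_iSup (fun t => edist (compress (σ t)) (compress t)) (τ t))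
        (le_max_left _ _)
    · exact le_trans (le_iSup (fun t => edist (compress (τ t)) (compress t)) t)
        (le_max_left _ _)
  · refine (edist_triangle _ (y (τ t)) _).trans (add_le_add ?_ ?_)
    · exact le_trans (le_iSup (fun t => edist (x (σ t)) (y t)) (τ t)) (le_max_right _ _)
    · exact le_trans (le_iSup (fun t => edist (y (τ t)) (z t)) t) (le_max_right _ _)

theorem skorokhodEDist_comm_le (x y : Cadlag) : skorokhodEDist y x ≤ skorokhodEDist x y :=
  le_iInf fun σ => (iInf_le _ σ.symm).trans (timeChangeCost_symm x y σ)

/-- `D[-∞,∞]` with the Skorokhod distance; its topology is the Skorokhod topology. -/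
instance : PseudoEMetricSpace Cadlag where
  edist := skorokhodEDist
  edist_self x := by
    refine le_antisymm ((iInf_le _ (OrderIso.refl EReal)).trans ?_) bot_le
    simp [timeChangeCost]
  edist_comm x y := le_antisymm (skorokhodEDist_comm_le y x) (skorokhodEDist_comm_le x y)
  edist_triangle x y z := by
    change skorokhodEDist x z ≤ skorokhodEDist x y + skorokhodEDist y z
    unfold skorokhodEDist
    rw [ENNReal.iInf_add]
    refine le_iInf fun σ => ?_
    rw [ENNReal.add_iInf]
    exact le_iInf fun τ => (iInf_le _ (τ.trans σ)).trans (timeChangeCost_trans x y z σ τ)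

/-- The Borel σ-algebra of the Skorokhod topology. -/
instance : MeasurableSpace Cadlag := borel Cadlag

instance : BorelSpace Cadlag := ⟨rfl⟩

/-! ### The centred and scaled process -/

/-- The half-line `[-∞,t] ∩ ℝ`; it is empty for `t = -∞` and all of `ℝ` for `t = ∞`. -/
def lowerRay (t : EReal) : Set ℝ := {x : ℝ | (x : EReal) ≤ t}

theorem measurableSet_lowerRay (t : EReal) : MeasurableSet (lowerRay t) :=
  measurable_coe_real_ereal measurableSet_Iic

theorem lowerRay_mono {s t : EReal} (h : s ≤ t) : lowerRay s ⊆ lowerRay t :=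
  fun _ hx => le_trans hx h

theorem rayMeasure_right (ν : Measure ℝ) [IsFiniteMeasure ν] (t : EReal) :
    ContinuousWithinAt (fun t => ν.real (lowerRay t)) (Set.Ici t) t := by
  rw [← Set.Ioi_insert, continuousWithinAt_insert_self]
  have hI : (⋂ r > t, lowerRay r) = lowerRay t := by
    ext x
    simp only [Set.mem_iInter, lowerRay, Set.mem_ofPred_eq]
    exact ⟨fun h => le_of_forall_gt_imp_ge_of_dense h, fun h r hr => h.trans hr.le⟩
  by_cases ht : t = ⊤
  · subst ht
    simp [ContinuousWithinAt]
  have hlt : t < ⊤ := lt_top_iff_ne_top.2 ht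
  have := tendsto_measure_biInter_gt (μ := ν) (s := lowerRay) (a := t)
    (fun r _ => (measurableSet_lowerRay r).nullMeasurableSet)
    (fun i j _ hij => lowerRay_mono hij) ⟨⊤, hlt, measure_ne_top _ _⟩
  rw [hI] at this
  exact (ENNReal.tendsto_toReal (measure_ne_top _ _)).comp this

theorem rayMeasure_left (ν : Measure ℝ) [IsFiniteMeasure ν] (t : EReal) :
    ∃ l, Tendsto (fun t => ν.real (lowerRay t)) (𝓝[<] t) (𝓝 l) := by
  have hm : Monotone (fun t => ν.real (lowerRay t)) :=
    fun _ _ h => measureReal_mono (lowerRay_mono h)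
  exact ⟨_, hm.tendsto_leftLim t⟩

/-- The path `t ↦ √a (Q((-∞,t]) - H((-∞,t]))`, `t ∈ [-∞,∞]`. -/
def scaledPath (a : ℝ) (H Q : Measure ℝ) [IsFiniteMeasure H] [IsFiniteMeasure Q] : Cadlag where
  toFun t := √a * (Q.real (lowerRay t) - H.real (lowerRay t))
  right_continuous t :=
    continuousWithinAt_const.mul ((rayMeasure_right Q t).sub (rayMeasure_right H t))
  left_limit t := by
    obtain ⟨l, hl⟩ := rayMeasure_left Q t
    obtain ⟨l', hl'⟩ := rayMeasure_left H t
    exact ⟨_, (hl.sub hl').const_mul _⟩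

/-! ### The normalized inverse-Gaussian distribution and process -/

/-- The modified Bessel function of the third kind `K_ν(x)`, `x > 0`, in the integral form
`½ ∫₀^∞ u^{ν-1} exp(-(x/2)(u + 1/u)) du`
(which `u = eˢ` turns into `∫₀^∞ exp(-x cosh s) cosh(ν s) ds`). -/
def besselK (ν x : ℝ) : ℝ :=
  (1 / 2) * ∫ u in Set.Ioi (0 : ℝ), u ^ (ν - 1) * Real.exp (-(x / 2) * (u + u⁻¹))

/-- The density of the normalized inverse-Gaussian distribution with parameters `γ₁, …, γₙ`,
supported by the standard simplex. -/
def nigDensity {n : ℕ} (γ : Fin n → ℝ) (z : Fin n → ℝ) : ℝ :=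
  (stdSimplex ℝ (Fin n)).indicator (fun z =>
    Real.exp (∑ i, γ i) * (∏ i, γ i) / (2 ^ ((n : ℝ) / 2 - 1) * Real.pi ^ ((n : ℝ) / 2))
      * besselK (-(n : ℝ) / 2) (√(∑ i, γ i ^ 2 / z i))
      * (∑ i, γ i ^ 2 / z i) ^ (-(n : ℝ) / 4)
      * ∏ i, z i ^ (-(3 : ℝ) / 2)) z

/-- The point of the hyperplane `∑ zᵢ = 1` with the given first `m` coordinates. -/
def completeToOne {m : ℕ} (w : Fin m → ℝ) : Fin (m + 1) → ℝ :=
  Fin.snoc w (1 - ∑ i, w i)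

/-- The normalized inverse-Gaussian distribution with parameters `γ₁, …, γ_{m+1}`: a law on
`ℝ^{m+1}` carried by the simplex; the density refers to Lebesgue measure in the first `m`
coordinates, the last one being `1` minus their sum. For `m = 0` it is the unit mass at `1`. -/
def nigLaw {m : ℕ} (γ : Fin (m + 1) → ℝ) : Measure (Fin (m + 1) → ℝ) :=
  ((volume : Measure (Fin m → ℝ)).withDensity
    (fun w => ENNReal.ofReal (nigDensity γ (completeToOne w)))).map completeToOne

/-- `P` is, under `μ`, a normalized inverse-Gaussian process with parameters `a` and `H`.
A random probability measure is a Markov kernel from the sample space. Cells that are null for `H`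
have random mass `0` almost surely, and the masses of the cells of a finite measurable partition
with cells of positive `H`-measure have the normalized inverse-Gaussian distribution. -/
structure IsNIGProcess {𝔛 Ω : Type*} [MeasurableSpace 𝔛] [MeasurableSpace Ω]
    (a : ℝ) (H : Measure 𝔛) (P : Kernel Ω 𝔛) (μ : Measure Ω) : Prop where
  null : ∀ A, MeasurableSet A → H A = 0 → ∀ᵐ ω ∂μ, P ω A = 0
  partition : ∀ (m : ℕ) (A : Fin (m + 1) → Set 𝔛), (∀ i, MeasurableSet (A i)) →
    Pairwise (Function.onFun Disjoint A) → (⋃ i, A i) = Set.univ → (∀ i, 0 < H (A i)) →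
    HasLaw (fun ω i => (P ω).real (A i)) (nigLaw fun i => a * H.real (A i)) μ

/-- `B` is, under `μ`, a Brownian bridge with parameter measure `H` indexed by the sets `S i`:
a centred Gaussian process with covariance `H(S i ∩ S j) - H(S i) H(S j)`. -/
structure IsBrownianBridge {ι 𝔛 Ω : Type*} [MeasurableSpace 𝔛] [MeasurableSpace Ω]
    (H : Measure 𝔛) (S : ι → Set 𝔛) (B : ι → Ω → ℝ) (μ : Measure Ω) : Prop where
  gaussian : IsGaussianProcess B μ
  mean : ∀ i, ∫ ω, B i ω ∂μ = 0
  cov : ∀ i j, covariance (B i) (B j) μ = H.real (S i ∩ S j) - H.real (S i) * H.real (S j)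

end NIG

end

open MeasureTheory ProbabilityTheory Filter Topology

noncomputable section

namespace NIG

/-! ### The inverse-Gaussian distribution -/

/-! The normalized inverse-Gaussian law is the law of `Z / ∑ Z` for independent inverse-Gaussian `Z
i` with mean and variance `γ i` (`nigLaw_eq_map_normalize`): in the coordinates (total, direction)
the product density integrates over the total to the Bessel function. Hence the masses that `P`
gives to the cells of any finite partition are normalized independent variables with parameters `a *
H (A i)`, null cells included (`IsNIGProcess.hasLaw_cells`). Everything else is a statement about
independent variables with explicit transforms.

Finite-dimensional distributions. A linear functional of the normalized vector is, up to a factor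
close to 1, a linear functional of the independent centred variables (`normalize_sub_linear_form`).
The explicit characteristic function of the latter tends to a Gaussian one, and the limiting
variance is the variance under `H` of a step function, which is the variance of the same functional
of the bridge (`tendsto_charFun_normalize`, `IsBrownianBridge.integral_cexp`,
`tendsto_integral_fdd`).

Oscillation. The bound `2 * γ * u ^ 2` on the log-moment generating function of a centred variable
gives an exponential maximal inequality for partial sums. Over a block of `H`-mass at most `1 / N`
the path then oscillates by more than a small constant with probability exponentially small in `√N`,
for all `a > 4 * N` (`IsNIGProcess.oscillation_finset`). This beats the number `N` of blocks. The
blocks lie between consecutive `N`-quantiles of `H`, and only their interiors need small mass, so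
atoms of `H` do no harm: a large atom sits at a quantile. Thus the path is uniformly close, with
high probability, to the step path sampled at the quantiles. The bridge inherits the estimate
through the portmanteau theorem (`IsBrownianBridge.hasQuantileModulus`).

Conclusion. Up to a small error, a bounded Lipschitz function of the path is a bounded continuous
function of `N + 1` coordinates, for which the finite-dimensional convergence suffices
(`tendstoInDistribution_scaledPath`). No tightness criterion with time changes is needed, since the
jump positions are common to all approximating step paths. Time changes enter only in identifying
measurability on `D[-∞,∞]` with measurability of the evaluations. The bridge itself is built from a
Gaussian Hilbert space, and the same oscillation estimate with Borel–Cantelli gives it a càdlàg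
modification. -/

/-- The inverse-Gaussian density with mean `γ` and shape `γ²`, whose variance is `γ`. -/
def igDensity (γ x : ℝ) : ℝ :=
  γ / √(2 * Real.pi) / (x * √x) * Real.exp (-((x - γ) ^ 2 / (2 * x)))

/-- The inverse-Gaussian law with mean and variance `γ > 0`; the unit mass at `0` otherwise. -/
def igLaw (γ : ℝ) : Measure ℝ :=
  if 0 < γ then (volume.restrict (Set.Ioi 0)).withDensity fun x => ENNReal.ofReal (igDensity γ x)
  else Measure.dirac 0

theorem igLaw_of_pos {γ : ℝ} (hγ : 0 < γ) : igLaw γ =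
    (volume.restrict (Set.Ioi 0)).withDensity fun x => ENNReal.ofReal (igDensity γ x) :=
  if_pos hγ

theorem igLaw_zero : igLaw 0 = Measure.dirac 0 := if_neg (lt_irrefl _)

theorem measurable_igDensity (γ : ℝ) : Measurable (igDensity γ) := by
  unfold igDensity
  fun_prop

theorem igDensity_nonneg {γ x : ℝ} (hγ : 0 ≤ γ) (hx : 0 ≤ x) : 0 ≤ igDensity γ x := by
  unfold igDensity
  positivity

/-- The inversion `x ↦ γ ^ 2 / x` preserves `(x - γ) ^ 2 / x` and exchanges the two weights. -/
theorem lintegral_inv_sqrt_eq {γ : ℝ} (hγ : 0 < γ) :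
    ∫⁻ x in Set.Ioi (0 : ℝ), ENNReal.ofReal (1 / √x * Real.exp (-((x - γ) ^ 2 / (2 * x)))) =
    ∫⁻ x in Set.Ioi (0 : ℝ),
      ENNReal.ofReal (γ / (x * √x) * Real.exp (-((x - γ) ^ 2 / (2 * x)))) := by
  have himg : (fun x : ℝ => γ ^ 2 / x) '' Set.Ioi 0 = Set.Ioi 0 := by
    ext y
    constructor
    · rintro ⟨x, hx, rfl⟩
      exact div_pos (pow_pos hγ 2) hx
    · intro (hy : 0 < y)
      exact ⟨γ ^ 2 / y, div_pos (pow_pos hγ 2) hy, by field_simp⟩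
  have hinj : Set.InjOn (fun x : ℝ => γ ^ 2 / x) (Set.Ioi 0) := by
    intro x (hx : 0 < x) y (hy : 0 < y) h
    have h' : γ ^ 2 / x = γ ^ 2 / y := h
    rw [div_eq_div_iff hx.ne' hy.ne'] at h'
    exact (mul_left_cancel₀ (pow_ne_zero 2 hγ.ne') h').symm
  have hd : ∀ x ∈ Set.Ioi (0 : ℝ),
      HasDerivWithinAt (fun x : ℝ => γ ^ 2 / x) (-(γ ^ 2) / x ^ 2) (Set.Ioi 0) x := by
    intro x (hx : 0 < x)
    have := ((hasDerivAt_inv hx.ne').const_mul (γ ^ 2)).hasDerivWithinAt (s := Set.Ioi 0)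
    refine this.congr_deriv ?_
    ring
  have := lintegral_image_eq_lintegral_abs_deriv_mul (measurableSet_Ioi (a := (0 : ℝ))) hd hinj
    (fun x => ENNReal.ofReal (1 / √x * Real.exp (-((x - γ) ^ 2 / (2 * x)))))
  rw [himg] at this
  rw [this]
  refine setLIntegral_congr_fun measurableSet_Ioi fun x (hx : 0 < x) => ?_
  rw [← ENNReal.ofReal_mul (abs_nonneg _), ← mul_assoc]
  have hs : √(γ ^ 2 / x) = γ / √x := by
    rw [Real.sqrt_div (by positivity), Real.sqrt_sq hγ.le]
  have h1 : |-(γ ^ 2) / x ^ 2| = γ ^ 2 / x ^ 2 := by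
    rw [neg_div, abs_neg, abs_of_nonneg (by positivity)]
  have h2 : (γ ^ 2 / x - γ) ^ 2 / (2 * (γ ^ 2 / x)) = (x - γ) ^ 2 / (2 * x) := by
    field_simp
    ring
  have hx' : √x * √x = x := Real.mul_self_sqrt hx.le
  have hsx : 0 < √x := Real.sqrt_pos.2 hx
  rw [hs, h1, h2]
  congr 2
  field_simp
  nlinarith

/-- The map `y = √x - γ / √x` is a bijection of the positive half-line onto `ℝ` with `y ^ 2 = (x -
γ) ^ 2 / x`, so this is a Gaussian integral. By the inversion symmetry both halves of the weight
contribute equally, which normalizes the inverse-Gaussian density. -/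
theorem lintegral_gaussian_substitution {γ : ℝ} (hγ : 0 < γ) :
    ∫⁻ x in Set.Ioi (0 : ℝ), ENNReal.ofReal
      ((1 / 2) * (1 / √x + γ / (x * √x)) * Real.exp (-((x - γ) ^ 2 / (2 * x)))) =
    ENNReal.ofReal √(2 * Real.pi) := by
  have himg : (fun x : ℝ => √x - γ / √x) '' Set.Ioi 0 = Set.univ := by
    refine Set.eq_univ_of_forall fun y => ?_
    have h0 : |y| < √(y ^ 2 + 4 * γ) := by
      rw [← Real.sqrt_sq_eq_abs]
      exact Real.sqrt_lt_sqrt (sq_nonneg _) (by linarith)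
    have hsq : √(y ^ 2 + 4 * γ) ^ 2 = y ^ 2 + 4 * γ := Real.sq_sqrt (by positivity)
    set q := √(y ^ 2 + 4 * γ)
    have hr : 0 < (y + q) / 2 := by linarith [neg_abs_le y]
    refine ⟨((y + q) / 2) ^ 2, by simp only [Set.mem_Ioi]; positivity, ?_⟩
    simp only
    rw [Real.sqrt_sq hr.le]
    have hr' : y + q ≠ 0 := by linarith
    field_simp
    nlinarith
  have hinj : Set.InjOn (fun x : ℝ => √x - γ / √x) (Set.Ioi 0) := by
    intro x (hx : 0 < x) y (hy : 0 < y) h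
    have hx' := Real.sqrt_pos.2 hx
    have hy' := Real.sqrt_pos.2 hy
    have h' : √x - γ / √x = √y - γ / √y := h
    have h2 : (√x - √y) * (√x * √y + γ) = 0 := by
      field_simp at h'
      nlinarith
    rcases mul_eq_zero.1 h2 with h3 | h3
    · exact (Real.sqrt_inj hx.le hy.le).1 (by linarith)
    · nlinarith [mul_pos hx' hy']
  have hd : ∀ x ∈ Set.Ioi (0 : ℝ), HasDerivWithinAt (fun x : ℝ => √x - γ / √x)
      ((1 / 2) * (1 / √x + γ / (x * √x))) (Set.Ioi 0) x := by
    intro x (hx : 0 < x)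
    have h1 := Real.hasDerivAt_sqrt hx.ne'
    have h2 := (h1.sub ((h1.inv (Real.sqrt_pos.2 hx).ne').const_mul γ)).hasDerivWithinAt
      (s := Set.Ioi 0)
    refine h2.congr_deriv ?_
    rw [Real.sq_sqrt hx.le]
    have := Real.sqrt_pos.2 hx
    field_simp
    ring
  have h := lintegral_image_eq_lintegral_abs_deriv_mul (measurableSet_Ioi (a := (0 : ℝ))) hd hinj
    (fun y => ENNReal.ofReal (Real.exp (-(1 / 2) * y ^ 2)))
  rw [himg, Measure.restrict_univ, ← ofReal_integral_eq_lintegral_ofReal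
    (integrable_exp_neg_mul_sq (by norm_num)) (ae_of_all _ fun _ => (Real.exp_pos _).le),
    integral_gaussian] at h
  have h2 : Real.pi / (1 / 2) = 2 * Real.pi := by ring
  rw [h2] at h
  rw [h]
  refine setLIntegral_congr_fun measurableSet_Ioi fun x (hx : 0 < x) => ?_
  have hsx := Real.sqrt_pos.2 hx
  rw [← ENNReal.ofReal_mul (abs_nonneg _), abs_of_nonneg (by positivity)]
  congr 3
  have hx' : √x ^ 2 = x := Real.sq_sqrt hx.le
  have : (√x - γ / √x) ^ 2 = (x - γ) ^ 2 / x := by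
    rw [sub_sq, div_pow, hx']
    field_simp
    ring
  rw [this]
  field_simp

theorem lintegral_igDensity {γ : ℝ} (hγ : 0 < γ) :
    ∫⁻ x in Set.Ioi (0 : ℝ), ENNReal.ofReal (igDensity γ x) = 1 := by
  have hπ : 0 < √(2 * Real.pi) := Real.sqrt_pos.2 (by positivity)
  set A := ∫⁻ x in Set.Ioi (0 : ℝ),
      ENNReal.ofReal (γ / (x * √x) * Real.exp (-((x - γ) ^ 2 / (2 * x)))) with hA
  have h1 : ENNReal.ofReal √(2 * Real.pi) = A := by
    rw [← lintegral_gaussian_substitution hγ]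
    calc _ = ∫⁻ x in Set.Ioi (0 : ℝ), (ENNReal.ofReal (1 / 2) *
          ENNReal.ofReal (1 / √x * Real.exp (-((x - γ) ^ 2 / (2 * x)))) +
          ENNReal.ofReal (1 / 2) *
          ENNReal.ofReal (γ / (x * √x) * Real.exp (-((x - γ) ^ 2 / (2 * x))))) := by
          refine setLIntegral_congr_fun measurableSet_Ioi fun x (hx : 0 < x) => ?_
          rw [← ENNReal.ofReal_mul (by norm_num), ← ENNReal.ofReal_mul (by norm_num),
            ← ENNReal.ofReal_add (by positivity) (by positivity)]
          congr 1
          ring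
      _ = ENNReal.ofReal (1 / 2) * A + ENNReal.ofReal (1 / 2) * A := by
          rw [lintegral_add_left (by fun_prop), lintegral_const_mul _ (by fun_prop),
            lintegral_const_mul _ (by fun_prop), lintegral_inv_sqrt_eq hγ]
      _ = A := by
          rw [← add_mul, ← ENNReal.ofReal_add (by norm_num) (by norm_num)]
          norm_num
  calc _ = ∫⁻ x in Set.Ioi (0 : ℝ), ENNReal.ofReal (1 / √(2 * Real.pi)) *
        ENNReal.ofReal (γ / (x * √x) * Real.exp (-((x - γ) ^ 2 / (2 * x)))) := by
        refine lintegral_congr fun x => ?_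
        rw [← ENNReal.ofReal_mul (by positivity), igDensity]
        congr 1
        ring
    _ = 1 := by
        rw [lintegral_const_mul _ (by fun_prop), ← hA, ← h1, ← ENNReal.ofReal_mul (by positivity),
          one_div, inv_mul_cancel₀ hπ.ne', ENNReal.ofReal_one]

instance isProbabilityMeasure_igLaw (γ : ℝ) : IsProbabilityMeasure (igLaw γ) := by
  by_cases hγ : 0 < γ
  · rw [igLaw_of_pos hγ]
    exact ⟨by rw [withDensity_apply _ MeasurableSet.univ, Measure.restrict_univ,
      lintegral_igDensity hγ]⟩
  · rw [igLaw, if_neg hγ]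
    infer_instance

theorem lintegral_igLaw {γ : ℝ} (hγ : 0 < γ) {g : ℝ → ENNReal} (hg : Measurable g) :
    ∫⁻ x, g x ∂igLaw γ = ∫⁻ x in Set.Ioi 0, ENNReal.ofReal (igDensity γ x) * g x := by
  rw [igLaw_of_pos hγ, lintegral_withDensity_eq_lintegral_mul _
    (measurable_igDensity γ).ennreal_ofReal hg]
  rfl

/-- Exponential tilting stays in the family: after rescaling `x` by `c = 1 - 2 * u`, the tilted
density is a constant times the density with parameter `γ * √c`, whose integral is 1. -/
theorem lintegral_exp_igLaw {γ : ℝ} (hγ : 0 ≤ γ) {u : ℝ} (hu : u < 1 / 2) :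
    ∫⁻ x, ENNReal.ofReal (Real.exp (u * x)) ∂igLaw γ =
      ENNReal.ofReal (Real.exp (γ * (1 - √(1 - 2 * u)))) := by
  rcases hγ.eq_or_lt with rfl | hγ
  · rw [igLaw_zero, lintegral_dirac]
    simp
  have hc : 0 < 1 - 2 * u := by linarith
  set c := 1 - 2 * u with hcdef
  set s := √c with hs
  have hspos : 0 < s := Real.sqrt_pos.2 hc
  have hs2 : s ^ 2 = c := Real.sq_sqrt hc.le
  rw [lintegral_igLaw hγ (by fun_prop)]
  have himg : (fun x : ℝ => x / c) '' Set.Ioi 0 = Set.Ioi 0 := by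
    ext y
    constructor
    · rintro ⟨x, hx, rfl⟩
      exact div_pos hx hc
    · intro (hy : 0 < y)
      exact ⟨y * c, mul_pos hy hc, by field_simp⟩
  have hinj : Set.InjOn (fun x : ℝ => x / c) (Set.Ioi 0) := by
    intro x _ y _ h
    exact (div_left_inj' hc.ne').1 h
  have hd : ∀ x ∈ Set.Ioi (0 : ℝ), HasDerivWithinAt (fun x : ℝ => x / c) (1 / c) (Set.Ioi 0) x :=
    fun x _ => ((hasDerivAt_id x).div_const c).hasDerivWithinAt
  have h := lintegral_image_eq_lintegral_abs_deriv_mul (measurableSet_Ioi (a := (0 : ℝ))) hd hinj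
    (fun x => ENNReal.ofReal (igDensity γ x) * ENNReal.ofReal (Real.exp (u * x)))
  rw [himg] at h
  rw [h]
  calc _ = ∫⁻ x in Set.Ioi (0 : ℝ), ENNReal.ofReal (Real.exp (γ * (1 - s))) *
        ENNReal.ofReal (igDensity (γ * s) x) := by
        refine setLIntegral_congr_fun measurableSet_Ioi fun x (hx : 0 < x) => ?_
        rw [abs_of_nonneg (by positivity),
          ← ENNReal.ofReal_mul (igDensity_nonneg hγ.le (by positivity)),
          ← ENNReal.ofReal_mul (by positivity), ← ENNReal.ofReal_mul (by positivity)]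
        congr 1
        unfold igDensity
        have h1 : √(x / c) = √x / s := Real.sqrt_div hx.le c
        have hexp : Real.exp (-((x / c - γ) ^ 2 / (2 * (x / c)))) * Real.exp (u * (x / c)) =
            Real.exp (γ * (1 - s)) * Real.exp (-((x - γ * s) ^ 2 / (2 * x))) := by
          rw [← Real.exp_add, ← Real.exp_add]
          congr 1
          have hu' : u = (1 - s ^ 2) / 2 := by rw [hs2, hcdef]; ring
          rw [hu', ← hs2]
          field_simp
          ring
        have hsx := Real.sqrt_pos.2 hx
        rw [mul_assoc (γ / _ / _), hexp, h1, ← hs2]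
        field_simp
    _ = _ := by
        rw [lintegral_const_mul _ (measurable_igDensity _).ennreal_ofReal,
          lintegral_igDensity (mul_pos hγ hspos), mul_one]

/-- With `s = √(1 - 2 * u)` the gap is `(1 - s) ^ 2 / 2 * ((1 + s) ^ 2 - 1)`. Negative `u` are
covered as well, so one bound serves both tails. -/
theorem one_sub_sqrt_le {u : ℝ} (hu : u < 1 / 2) : 1 - √(1 - 2 * u) ≤ u + 2 * u ^ 2 := by
  have h0 : 0 ≤ 1 - 2 * u := by linarith
  set s := √(1 - 2 * u) with hs
  have hs0 : 0 ≤ s := Real.sqrt_nonneg _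
  have hs2 : s ^ 2 = 1 - 2 * u := Real.sq_sqrt h0
  have hu' : u = (1 - s ^ 2) / 2 := by linarith
  have : u + 2 * u ^ 2 - (1 - s) = (1 - s) ^ 2 / 2 * ((1 + s) ^ 2 - 1) := by rw [hu']; ring
  nlinarith [mul_nonneg (sq_nonneg (1 - s)) (by nlinarith : 0 ≤ (1 + s) ^ 2 - 1)]

/-- The sub-exponential bound for the centred inverse-Gaussian law. -/
theorem lintegral_exp_centred_igLaw_le {γ : ℝ} (hγ : 0 ≤ γ) {u : ℝ} (hu : u < 1 / 2) :
    ∫⁻ x, ENNReal.ofReal (Real.exp (u * (x - γ) - 2 * γ * u ^ 2)) ∂igLaw γ ≤ 1 := by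
  calc _ = ∫⁻ x, ENNReal.ofReal (Real.exp (-(u * γ) - 2 * γ * u ^ 2)) *
        ENNReal.ofReal (Real.exp (u * x)) ∂igLaw γ := by
        refine lintegral_congr fun x => ?_
        rw [← ENNReal.ofReal_mul (Real.exp_pos _).le, ← Real.exp_add]
        congr 2
        ring
    _ ≤ 1 := by
        rw [lintegral_const_mul _ (by fun_prop), lintegral_exp_igLaw hγ hu,
          ← ENNReal.ofReal_mul (Real.exp_pos _).le, ← Real.exp_add]
        refine ENNReal.ofReal_le_one.2 (Real.exp_le_one_iff.2 ?_)
        nlinarith [mul_le_mul_of_nonneg_left (one_sub_sqrt_le hu) hγ]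

theorem integrable_exp_igLaw {γ : ℝ} (hγ : 0 ≤ γ) {u : ℝ} (hu : u < 1 / 2) :
    Integrable (fun x => Real.exp (u * x)) (igLaw γ) := by
  refine ⟨by fun_prop, ?_⟩
  rw [hasFiniteIntegral_iff_ofReal (ae_of_all _ fun _ => (Real.exp_pos _).le),
    lintegral_exp_igLaw hγ hu]
  exact ENNReal.ofReal_lt_top

theorem mgf_igLaw {γ : ℝ} (hγ : 0 ≤ γ) {u : ℝ} (hu : u < 1 / 2) :
    mgf id (igLaw γ) u = Real.exp (γ * (1 - √(1 - 2 * u))) := by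
  have := lintegral_exp_igLaw hγ hu
  rw [← ofReal_integral_eq_lintegral_ofReal (integrable_exp_igLaw hγ hu)
    (ae_of_all _ fun _ => (Real.exp_pos _).le),
    ENNReal.ofReal_eq_ofReal_iff (integral_nonneg fun _ => (Real.exp_pos _).le)
    (Real.exp_pos _).le] at this
  exact this

/-- Analytic continuation of the moment generating function: both sides are analytic on `re z < 1 /
2`, where `1 - 2 * z` avoids the branch cut of the root, and they agree on the real points. -/
theorem charFun_igLaw {γ : ℝ} (hγ : 0 ≤ γ) (t : ℝ) : charFun (igLaw γ) t =
    Complex.exp (γ * (1 - (1 - 2 * (t * Complex.I)) ^ (1 / 2 : ℂ))) := by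
  set U : Set ℂ := {z | z.re < 1 / 2} with hU
  have hUo : IsOpen U := isOpen_lt Complex.continuous_re continuous_const
  have hUc : IsPreconnected U := (convex_halfSpace_re_lt (1 / 2)).isPreconnected
  have hint : Set.Iio (1 / 2) ⊆ interior (integrableExpSet id (igLaw γ)) :=
    interior_maximal (fun u hu => integrable_exp_igLaw hγ hu) isOpen_Iio
  have h1 : AnalyticOnNhd ℂ (complexMGF id (igLaw γ)) U :=
    analyticOnNhd_complexMGF.mono fun z hz => hint hz
  have h2 : AnalyticOnNhd ℂ (fun z : ℂ => Complex.exp (γ * (1 - (1 - 2 * z) ^ (1 / 2 : ℂ)))) U := by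
    refine DifferentiableOn.analyticOnNhd (fun z hz => ?_) hUo
    refine DifferentiableAt.differentiableWithinAt ?_
    have : (1 - 2 * z) ∈ Complex.slitPlane := by
      left
      have : z.re < 1 / 2 := hz
      simp
      linarith
    fun_prop (disch := assumption)
  have heq : Set.EqOn (complexMGF id (igLaw γ))
      (fun z : ℂ => Complex.exp (γ * (1 - (1 - 2 * z) ^ (1 / 2 : ℂ)))) U := by
    refine h1.eqOn_of_preconnected_of_frequently_eq h2 hUc (z₀ := 0) (by simp [hU]) ?_
    have hreal : ∀ u : ℝ, u < 1 / 2 → complexMGF id (igLaw γ) u =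
        Complex.exp (γ * (1 - (1 - 2 * (u : ℂ)) ^ (1 / 2 : ℂ))) := by
      intro u hu
      rw [complexMGF_ofReal, mgf_igLaw hγ hu, Real.sqrt_eq_rpow, Complex.ofReal_exp]
      push_cast
      rw [Complex.ofReal_cpow (by linarith)]
      push_cast
      rfl
    -- Real points accumulating at `0` suffice for the identity theorem.
    have ht : Tendsto (fun n : ℕ => ((-(1 / ((n : ℝ) + 1)) : ℝ) : ℂ)) atTop (𝓝[≠] 0) := by
      refine tendsto_nhdsWithin_iff.2 ⟨?_, Eventually.of_forall fun n => ?_⟩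
      · have := (tendsto_one_div_add_atTop_nhds_zero_nat (𝕜 := ℝ)).neg
        rw [neg_zero] at this
        exact (Complex.continuous_ofReal.tendsto 0).comp this
      · have : (0 : ℝ) < 1 / ((n : ℝ) + 1) := by positivity
        simp only [Set.mem_compl_iff, Set.mem_singleton_iff, Complex.ofReal_eq_zero]
        linarith
    refine ht.frequently (Frequently.of_forall fun n => hreal _ ?_)
    have : (0 : ℝ) < 1 / ((n : ℝ) + 1) := by positivity
    linarith
  have := heq (show (t : ℂ) * Complex.I ∈ U by simp [hU])
  rw [complexMGF_id_mul_I] at this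
  exact this

/-! ### Product measures on `ℝⁿ` -/

theorem lintegral_pi_fin_prod {n : ℕ} (μ : Fin n → Measure ℝ) [∀ i, SigmaFinite (μ i)]
    {f : Fin n → ℝ → ENNReal} (hf : ∀ i, Measurable (f i)) :
    ∫⁻ z, ∏ i, f i (z i) ∂Measure.pi μ = ∏ i, ∫⁻ x, f i x ∂μ i := by
  induction n with
  | zero => simp
  | succ n ih =>
    have hm := (measurePreserving_piFinSuccAbove μ 0).symm
    have hmeas : Measurable fun z : Fin (n + 1) → ℝ => ∏ i, f i (z i) :=
      Finset.measurable_fun_prod _ fun i _ => (hf i).comp (measurable_pi_apply i)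
    rw [← hm.lintegral_comp hmeas, Fin.prod_univ_succ, ← ih _ fun i => hf i.succ]
    simp_rw [Fin.prod_univ_succ]
    exact lintegral_prod_mul (μ := μ 0) (ν := Measure.pi fun j => μ j.succ) (f := fun x => f 0 x)
      (g := fun z : Fin n → ℝ => ∏ i, f i.succ (z i)) (hf 0).aemeasurable
      (Finset.measurable_fun_prod _ fun i _ =>
        (hf i.succ).comp (measurable_pi_apply i)).aemeasurable

theorem pi_fin_withDensity {n : ℕ} {f : Fin n → ℝ → ENNReal} (hf : ∀ i, Measurable (f i))
    [∀ i, SigmaFinite ((volume : Measure ℝ).withDensity (f i))] :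
    Measure.pi (fun i => (volume : Measure ℝ).withDensity (f i)) =
      (volume : Measure (Fin n → ℝ)).withDensity fun z => ∏ i, f i (z i) := by
  refine Measure.pi_eq fun s hs => ?_
  rw [withDensity_apply _ (MeasurableSet.univ_pi hs), ← lintegral_indicator (.univ_pi hs)]
  have hr : ∀ i, (volume : Measure ℝ).withDensity (f i) (s i) =
      ∫⁻ x, (s i).indicator (f i) x := fun i => by
    rw [withDensity_apply _ (hs i), lintegral_indicator (hs i)]
  simp_rw [hr]
  rw [← lintegral_pi_fin_prod _ fun i => (hf i).indicator (hs i), volume_pi]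
  refine lintegral_congr fun z => ?_
  by_cases hz : ∀ i, z i ∈ s i
  · rw [Set.indicator_of_mem (by simpa using hz)]
    exact Finset.prod_congr rfl fun i _ => (Set.indicator_of_mem (hz i) _).symm
  · rw [Set.indicator_of_notMem (by simpa using hz)]
    push Not at hz
    obtain ⟨i, hi⟩ := hz
    exact (Finset.prod_eq_zero (Finset.mem_univ i) (Set.indicator_of_notMem hi _)).symm

theorem lintegral_comp_smul_pi {m : ℕ} {s : ℝ} (hs : 0 < s) {g : (Fin m → ℝ) → ENNReal}
    (hg : Measurable g) : ∫⁻ w, g w = ENNReal.ofReal (s ^ m) * ∫⁻ w, g (s • w) := by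
  have h := Measure.map_addHaar_smul (volume : Measure (Fin m → ℝ)) hs.ne'
  have h2 : ∫⁻ w, g (s • w) = ∫⁻ w, g w ∂(volume.map (s • ·)) :=
    (lintegral_map hg (measurable_const_smul s)).symm
  rw [h2, h, lintegral_smul_measure, smul_eq_mul, ← mul_assoc, Module.finrank_fin_fun,
    ← ENNReal.ofReal_mul (by positivity), abs_of_pos (by positivity),
    mul_inv_cancel₀ (by positivity), ENNReal.ofReal_one, one_mul]

theorem measurable_completeToOne {m : ℕ} :
    Measurable (completeToOne : (Fin m → ℝ) → Fin (m + 1) → ℝ) := by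
  refine measurable_pi_lambda _ fun i => ?_
  refine Fin.lastCases ?_ (fun j => ?_) i
  · simp only [completeToOne, Fin.snoc_last]
    fun_prop
  · simp only [completeToOne, Fin.snoc_castSucc]
    fun_prop

theorem sum_completeToOne {m : ℕ} (w : Fin m → ℝ) : ∑ i, completeToOne w i = 1 := by
  rw [Fin.sum_univ_castSucc]
  simp [completeToOne]

/-- Polar coordinates for the simplex: replace the last coordinate by the total `s`, a shift for
fixed `w`, then scale `w` by `s`, which produces the Jacobian `s ^ m`. The hypothesis `h0` discards
`s ≤ 0`. -/
theorem lintegral_polar_simplex {m : ℕ} {G : (Fin (m + 1) → ℝ) → ENNReal} (hG : Measurable G)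
    (h0 : ∀ z, ∑ i, z i ≤ 0 → G z = 0) :
    ∫⁻ z, G z = ∫⁻ w : Fin m → ℝ, ∫⁻ s in Set.Ioi (0 : ℝ),
      ENNReal.ofReal (s ^ m) * G (s • completeToOne w) := by
  have hm := (volume_preserving_piFinSuccAbove (fun _ : Fin (m + 1) => ℝ) (Fin.last m)).symm
  have hsnoc : Measurable fun p : ℝ × (Fin m → ℝ) => (Fin.snoc p.2 p.1 : Fin (m + 1) → ℝ) := by
    refine measurable_pi_lambda _ fun i => ?_
    refine Fin.lastCases ?_ (fun j => ?_) i
    · simp only [Fin.snoc_last]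
      fun_prop
    · simp only [Fin.snoc_castSucc]
      fun_prop
  have hshift : Measurable fun p : (Fin m → ℝ) × ℝ =>
      G (Fin.snoc p.1 (p.2 - ∑ i, p.1 i) : Fin (m + 1) → ℝ) :=
    hG.comp (hsnoc.comp (f := fun p : (Fin m → ℝ) × ℝ => (p.2 - ∑ i, p.1 i, p.1)) (by fun_prop))
  have hscale : Measurable fun p : (Fin m → ℝ) × ℝ =>
      ENNReal.ofReal (p.2 ^ m) * G (p.2 • completeToOne p.1) := by
    refine Measurable.mul (by fun_prop) (hG.comp ?_)
    exact measurable_snd.smul (measurable_completeToOne.comp measurable_fst)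
  calc ∫⁻ z, G z = ∫⁻ p : ℝ × (Fin m → ℝ), G (Fin.snoc p.2 p.1 : Fin (m + 1) → ℝ) := by
        rw [← hm.lintegral_comp hG]
        refine lintegral_congr fun p => ?_
        congr 1
        exact Fin.insertNth_last' p.1 p.2
    _ = ∫⁻ w : Fin m → ℝ, ∫⁻ t : ℝ, G (Fin.snoc w t : Fin (m + 1) → ℝ) :=
        lintegral_prod_symm' _ (hG.comp hsnoc)
    _ = ∫⁻ w : Fin m → ℝ, ∫⁻ s : ℝ, G (Fin.snoc w (s - ∑ i, w i) : Fin (m + 1) → ℝ) := by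
        refine lintegral_congr fun w => ?_
        exact (lintegral_sub_right_eq_self (fun t => G (Fin.snoc w t : Fin (m + 1) → ℝ)) _).symm
    _ = ∫⁻ s : ℝ, ∫⁻ w : Fin m → ℝ, G (Fin.snoc w (s - ∑ i, w i) : Fin (m + 1) → ℝ) :=
        lintegral_lintegral_swap hshift.aemeasurable
    _ = ∫⁻ s in Set.Ioi (0 : ℝ),
          ∫⁻ w : Fin m → ℝ, G (Fin.snoc w (s - ∑ i, w i) : Fin (m + 1) → ℝ) := by
        rw [← lintegral_indicator measurableSet_Ioi]
        refine lintegral_congr fun s => ?_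
        by_cases hs : 0 < s
        · rw [Set.indicator_of_mem (show s ∈ Set.Ioi 0 from hs)]
        · rw [Set.indicator_of_notMem (show s ∉ Set.Ioi 0 from hs)]
          refine (lintegral_congr fun w => h0 _ ?_).trans lintegral_zero
          rw [Fin.sum_univ_castSucc]
          simpa using hs
    _ = ∫⁻ s in Set.Ioi (0 : ℝ), ∫⁻ w : Fin m → ℝ,
          ENNReal.ofReal (s ^ m) * G (s • completeToOne w) := by
        refine setLIntegral_congr_fun measurableSet_Ioi fun s (hs : 0 < s) => ?_
        have hmeas : Measurable fun w : Fin m → ℝ =>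
            G (Fin.snoc w (s - ∑ i, w i) : Fin (m + 1) → ℝ) :=
          hshift.comp (measurable_id.prodMk measurable_const)
        rw [lintegral_comp_smul_pi hs hmeas, lintegral_const_mul]
        · congr 1
          refine lintegral_congr fun w => ?_
          congr 1
          refine funext fun i => Fin.lastCases ?_ (fun j => ?_) i
          · simp [completeToOne, ← Finset.mul_sum, mul_sub]
          · simp [completeToOne]
        · exact hG.comp (measurable_completeToOne.const_smul s)
    _ = _ := lintegral_lintegral_swap (hscale.comp measurable_swap).aemeasurable

/-! ### The Bessel integral -/

theorem rpow_mul_exp_neg_le (q : ℝ) {c : ℝ} (hc : 0 < c) :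
    ∃ C : ℝ, 0 ≤ C ∧ ∀ y : ℝ, 1 ≤ y → y ^ q * Real.exp (-(c * y)) ≤ C := by
  obtain ⟨k, hk⟩ := exists_nat_ge q
  refine ⟨k.factorial / c ^ k, by positivity, fun y hy => ?_⟩
  have hy0 : 0 < y := by linarith
  have h1 : y ^ q ≤ y ^ k := by
    rw [← Real.rpow_natCast]
    exact Real.rpow_le_rpow_of_exponent_le hy hk
  have h2 := Real.pow_div_factorial_le_exp (c * y) (by positivity) k
  rw [div_le_iff₀ (by positivity), mul_pow] at h2
  rw [Real.exp_neg, ← div_eq_mul_inv, div_le_div_iff₀ (Real.exp_pos _) (by positivity)]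
  calc y ^ q * c ^ k ≤ y ^ k * c ^ k := by gcongr
    _ ≤ _ := by linarith

/-- Half of the exponential decay absorbs the power of `u`, through `u` when `1 ≤ u` and through
`u⁻¹` otherwise. The other half is integrable. -/
theorem integrableOn_besselK (ν : ℝ) {x : ℝ} (hx : 0 < x) :
    IntegrableOn (fun u : ℝ => u ^ (ν - 1) * Real.exp (-(x / 2) * (u + u⁻¹))) (Set.Ioi 0) := by
  obtain ⟨C, hC0, hC⟩ := rpow_mul_exp_neg_le (ν - 1) (show 0 < x / 4 by positivity)
  obtain ⟨D, hD0, hD⟩ := rpow_mul_exp_neg_le (-(ν - 1)) (show 0 < x / 4 by positivity)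
  have hint : IntegrableOn (fun u : ℝ => (C + D) * Real.exp (-(x / 4) * u)) (Set.Ioi 0) :=
    (exp_neg_integrableOn_Ioi 0 (by positivity)).const_mul _
  refine Integrable.mono' hint (by fun_prop) ?_
  refine (ae_restrict_mem measurableSet_Ioi).mono fun u (hu : 0 < u) => ?_
  have hui : 0 < u⁻¹ := inv_pos.2 hu
  rw [Real.norm_of_nonneg (by positivity)]
  have hsplit : Real.exp (-(x / 2) * (u + u⁻¹)) = Real.exp (-(x / 4 * u)) *
      Real.exp (-(x / 4 * u⁻¹)) * Real.exp (-(x / 4) * (u + u⁻¹)) := by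
    rw [← Real.exp_add, ← Real.exp_add]
    congr 1
    ring
  have hle : Real.exp (-(x / 4) * (u + u⁻¹)) ≤ Real.exp (-(x / 4) * u) := by
    refine Real.exp_le_exp.2 ?_
    nlinarith
  have h1 : Real.exp (-(x / 4 * u)) ≤ 1 := Real.exp_le_one_iff.2 (by nlinarith)
  have h2 : Real.exp (-(x / 4 * u⁻¹)) ≤ 1 := Real.exp_le_one_iff.2 (by nlinarith)
  have hp : 0 ≤ u ^ (ν - 1) := by positivity
  have key : u ^ (ν - 1) * (Real.exp (-(x / 4 * u)) * Real.exp (-(x / 4 * u⁻¹))) ≤ C + D := by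
    rcases le_total 1 u with h | h
    · have := hC u h
      calc _ ≤ u ^ (ν - 1) * (Real.exp (-(x / 4 * u)) * 1) := by gcongr
        _ ≤ C + D := by linarith
    · have := hD u⁻¹ ((one_le_inv₀ hu).2 h)
      rw [Real.inv_rpow hu.le, Real.rpow_neg hu.le, inv_inv] at this
      calc _ ≤ u ^ (ν - 1) * (1 * Real.exp (-(x / 4 * u⁻¹))) := by gcongr
        _ ≤ C + D := by linarith
  rw [hsplit, ← mul_assoc]
  exact mul_le_mul key hle (Real.exp_pos _).le (by positivity)

/-- The Bessel integral with the scaling `s = √g · u`. -/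
theorem lintegral_eq_besselK (ν : ℝ) {g : ℝ} (hg : 0 < g) :
    ∫⁻ s in Set.Ioi (0 : ℝ), ENNReal.ofReal (s ^ (ν - 1) * Real.exp (-(g / (2 * s)) - s / 2)) =
      ENNReal.ofReal (2 * besselK ν √g * g ^ (ν / 2)) := by
  set x := √g with hxdef
  have hx : 0 < x := Real.sqrt_pos.2 hg
  have hx2 : x ^ 2 = g := Real.sq_sqrt hg.le
  have himg : (fun u : ℝ => x * u) '' Set.Ioi 0 = Set.Ioi 0 := by
    ext y
    constructor
    · rintro ⟨u, hu, rfl⟩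
      exact mul_pos hx hu
    · intro (hy : 0 < y)
      exact ⟨y / x, div_pos hy hx, by field_simp⟩
  have hd : ∀ u ∈ Set.Ioi (0 : ℝ), HasDerivWithinAt (fun u : ℝ => x * u) x (Set.Ioi 0) u :=
    fun u _ => by simpa using ((hasDerivAt_id u).const_mul x).hasDerivWithinAt
  have h := lintegral_image_eq_lintegral_abs_deriv_mul (measurableSet_Ioi (a := (0 : ℝ))) hd
    (fun u _ v _ h => mul_left_cancel₀ hx.ne' h)
    (fun s => ENNReal.ofReal (s ^ (ν - 1) * Real.exp (-(g / (2 * s)) - s / 2)))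
  rw [himg] at h
  have hnn : 0 ≤ᵐ[volume.restrict (Set.Ioi 0)]
      fun u : ℝ => u ^ (ν - 1) * Real.exp (-(x / 2) * (u + u⁻¹)) :=
    (ae_restrict_mem measurableSet_Ioi).mono fun u (hu : 0 < u) => by
      simp only [Pi.zero_apply]
      positivity
  have h2 : 2 * besselK ν x = ∫ u in Set.Ioi (0 : ℝ),
      u ^ (ν - 1) * Real.exp (-(x / 2) * (u + u⁻¹)) := by
    unfold besselK
    ring
  rw [h, h2, mul_comm, ENNReal.ofReal_mul (by positivity),
    ofReal_integral_eq_lintegral_ofReal (integrableOn_besselK ν hx) hnn,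
    ← lintegral_const_mul _ (by fun_prop)]
  refine setLIntegral_congr_fun measurableSet_Ioi fun u (hu : 0 < u) => ?_
  rw [← ENNReal.ofReal_mul (abs_nonneg _), ← ENNReal.ofReal_mul (by positivity), abs_of_pos hx]
  congr 1
  have e1 : g ^ (ν / 2) = x ^ ν := by
    rw [← hx2, ← Real.rpow_natCast, ← Real.rpow_mul hx.le]
    congr 1
    push_cast
    ring
  have e2 : x ^ ν = x * x ^ (ν - 1) := by
    rw [Real.rpow_sub_one hx.ne']
    field_simp
  have e3 : -(g / (2 * (x * u))) - x * u / 2 = -(x / 2) * (u + u⁻¹) := by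
    rw [← hx2]
    field_simp
    ring
  rw [e1, e2, e3, Real.mul_rpow hx.le hu.le]
  ring

/-! ### The normalized inverse-Gaussian law is the law of normalized independent variables -/

theorem igLaw_eq_withDensity {γ : ℝ} (hγ : 0 < γ) : igLaw γ = (volume : Measure ℝ).withDensity
    ((Set.Ioi 0).indicator fun x => ENNReal.ofReal (igDensity γ x)) := by
  rw [igLaw_of_pos hγ, withDensity_indicator measurableSet_Ioi]

/-- Each exponent expands as `γ i - γ i ^ 2 / (2 * s * z i) - s * z i / 2`, so the last terms sum to
`-s / 2` on the simplex. The powers of `s` collect to `m - 3 * (m + 1) / 2 = -(m + 1) / 2 - 1`,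
leaving the Bessel integrand of order `-(m + 1) / 2`. -/
theorem prod_igDensity_smul {m : ℕ} {γ z : Fin (m + 1) → ℝ} (hz : ∀ i, 0 < z i)
    (hz1 : ∑ i, z i = 1) {s : ℝ} (hs : 0 < s) :
    s ^ m * ∏ i, igDensity (γ i) (s * z i) =
      (Real.exp (∑ i, γ i) * (∏ i, γ i) / √(2 * Real.pi) ^ (m + 1) *
        ∏ i, z i ^ (-(3 : ℝ) / 2)) * (s ^ (-((m + 1 : ℕ) : ℝ) / 2 - 1) *
        Real.exp (-((∑ i, γ i ^ 2 / z i) / (2 * s)) - s / 2)) := by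
  have h32 : ∀ x : ℝ, 0 < x → (x * √x)⁻¹ = x ^ (-(3 : ℝ) / 2) := by
    intro x hx
    rw [Real.sqrt_eq_rpow, ← Real.rpow_one_add' hx.le (by norm_num), ← Real.rpow_neg hx.le]
    norm_num
  have hfac : ∀ i, igDensity (γ i) (s * z i) = γ i * (√(2 * Real.pi))⁻¹ * s ^ (-(3 : ℝ) / 2) *
      z i ^ (-(3 : ℝ) / 2) *
      Real.exp (γ i - γ i ^ 2 / z i * (2 * s)⁻¹ - s / 2 * z i) := by
    intro i
    have := hz i
    have e : -((s * z i - γ i) ^ 2 / (2 * (s * z i))) =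
        γ i - γ i ^ 2 / z i * (2 * s)⁻¹ - s / 2 * z i := by
      field_simp
      ring
    rw [igDensity, e, div_eq_mul_inv, div_eq_mul_inv, h32 _ (mul_pos hs this),
      Real.mul_rpow hs.le this.le]
    ring
  simp_rw [hfac, Finset.prod_mul_distrib, ← Real.exp_sum, Finset.sum_sub_distrib,
    ← Finset.sum_mul, ← Finset.mul_sum, hz1, Finset.prod_const, Finset.card_univ, Fintype.card_fin]
  have hpow : s ^ m * (s ^ (-(3 : ℝ) / 2)) ^ (m + 1) = s ^ (-((m + 1 : ℕ) : ℝ) / 2 - 1) := by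
    rw [← Real.rpow_natCast, ← Real.rpow_natCast, ← Real.rpow_mul hs.le, ← Real.rpow_add hs]
    congr 1
    push_cast
    ring
  rw [← hpow, mul_one, sub_sub, sub_eq_add_neg (∑ i, γ i), Real.exp_add]
  have e2 : -((∑ i, γ i ^ 2 / z i) / (2 * s)) - s / 2 =
      -((∑ i, γ i ^ 2 / z i) * (2 * s)⁻¹ + s / 2) := by
    rw [div_eq_mul_inv]
    ring
  rw [e2, inv_pow]
  ring

theorem lintegral_prod_igDensity {m : ℕ} {γ : Fin (m + 1) → ℝ} (hγ : ∀ i, 0 < γ i)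
    {z : Fin (m + 1) → ℝ} (hz1 : ∑ i, z i = 1) :
    ∫⁻ s in Set.Ioi (0 : ℝ), ENNReal.ofReal (s ^ m) *
      ∏ i, (Set.Ioi 0).indicator (fun x => ENNReal.ofReal (igDensity (γ i) x)) (s * z i) =
      ENNReal.ofReal (nigDensity γ z) := by
  by_cases hz : ∀ i, 0 < z i
  · have hmem : z ∈ stdSimplex ℝ (Fin (m + 1)) := ⟨fun i => (hz i).le, hz1⟩
    set C := Real.exp (∑ i, γ i) * (∏ i, γ i) / √(2 * Real.pi) ^ (m + 1) *
        ∏ i, z i ^ (-(3 : ℝ) / 2) with hC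
    have hC0 : 0 ≤ C := by
      have h1 : 0 ≤ ∏ i, γ i := Finset.prod_nonneg fun i _ => (hγ i).le
      have h2 : 0 ≤ ∏ i, z i ^ (-(3 : ℝ) / 2) :=
        Finset.prod_nonneg fun i _ => Real.rpow_nonneg (hz i).le _
      positivity
    have hG : 0 < ∑ i, γ i ^ 2 / z i :=
      Finset.sum_pos (fun i _ => div_pos (pow_pos (hγ i) 2) (hz i)) Finset.univ_nonempty
    calc _ = ∫⁻ s in Set.Ioi (0 : ℝ), ENNReal.ofReal C *
          ENNReal.ofReal (s ^ (-((m + 1 : ℕ) : ℝ) / 2 - 1) *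
          Real.exp (-((∑ i, γ i ^ 2 / z i) / (2 * s)) - s / 2)) := by
          refine setLIntegral_congr_fun measurableSet_Ioi fun s (hs : 0 < s) => ?_
          rw [← ENNReal.ofReal_mul hC0, ← prod_igDensity_smul hz hz1 hs,
            ENNReal.ofReal_mul (by positivity), ENNReal.ofReal_prod_of_nonneg fun i _ =>
              igDensity_nonneg (hγ i).le (mul_pos hs (hz i)).le]
          congr 1
          refine Finset.prod_congr rfl fun i _ => ?_
          rw [Set.indicator_of_mem (show s * z i ∈ Set.Ioi 0 from mul_pos hs (hz i))]
      _ = _ := by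
          rw [lintegral_const_mul _ (by fun_prop), lintegral_eq_besselK _ hG,
            ← ENNReal.ofReal_mul hC0, nigDensity, Set.indicator_of_mem hmem, hC]
          congr 1
          have e1 : √(2 * Real.pi) ^ (m + 1) =
              2 * (2 ^ (((m + 1 : ℕ) : ℝ) / 2 - 1) * Real.pi ^ (((m + 1 : ℕ) : ℝ) / 2)) := by
            rw [Real.sqrt_eq_rpow, ← Real.rpow_natCast, ← Real.rpow_mul (by positivity),
              Real.mul_rpow (by norm_num) Real.pi_pos.le, Real.rpow_sub_one (by norm_num)]
            have : 1 / 2 * (((m + 1 : ℕ) : ℝ)) = ((m + 1 : ℕ) : ℝ) / 2 := by ring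
            rw [this]
            ring
          have e2 : -((m + 1 : ℕ) : ℝ) / 2 / 2 = -((m + 1 : ℕ) : ℝ) / 4 := by ring
          rw [e1, e2]
          have : (0 : ℝ) < 2 ^ (((m + 1 : ℕ) : ℝ) / 2 - 1) := by positivity
          have : (0 : ℝ) < Real.pi ^ (((m + 1 : ℕ) : ℝ) / 2) := by positivity
          field_simp
  · push Not at hz
    obtain ⟨j, hj⟩ := hz
    have h0 : nigDensity γ z = 0 := by
      unfold nigDensity
      refine Set.indicator_apply_eq_zero.2 fun hmem => ?_
      have hzj : z j = 0 := le_antisymm hj (hmem.1 j)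
      -- The convention `0 ^ (-3 / 2) = 0` makes `nigDensity` vanish on the boundary of the simplex,
      -- in agreement with the product of densities on open half-lines.
      have : ∏ i, z i ^ (-(3 : ℝ) / 2) = 0 := Finset.prod_eq_zero (Finset.mem_univ j)
        (by rw [hzj, Real.zero_rpow (by norm_num)])
      rw [this, mul_zero]
    rw [h0, ENNReal.ofReal_zero]
    refine (setLIntegral_congr_fun measurableSet_Ioi fun s (hs : 0 < s) => ?_).trans lintegral_zero
    rw [Finset.prod_eq_zero (Finset.mem_univ j), mul_zero]
    refine Set.indicator_of_notMem ?_ _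
    simp only [Set.mem_Ioi, not_lt]
    exact mul_nonpos_of_nonneg_of_nonpos hs.le hj

/-- Division of a vector by the sum of its coordinates. -/
def normalize {ι : Type*} [Fintype ι] (z : ι → ℝ) : ι → ℝ := (∑ i, z i)⁻¹ • z

theorem measurable_normalize {ι : Type*} [Fintype ι] :
    Measurable (normalize : (ι → ℝ) → ι → ℝ) := by
  unfold normalize
  fun_prop

/-- In polar coordinates the direction is `completeToOne w`, and integrating out the radius turns
the product density into `nigDensity`. -/
theorem nigLaw_eq_map_normalize {m : ℕ} {γ : Fin (m + 1) → ℝ} (hγ : ∀ i, 0 < γ i) :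
    nigLaw γ = (Measure.pi fun i => igLaw (γ i)).map normalize := by
  have hmf : ∀ i, Measurable ((Set.Ioi (0 : ℝ)).indicator
      fun x => ENNReal.ofReal (igDensity (γ i) x)) := fun i =>
    (measurable_igDensity _).ennreal_ofReal.indicator measurableSet_Ioi
  have hmprod : Measurable fun z : Fin (m + 1) → ℝ => ∏ i,
      (Set.Ioi (0 : ℝ)).indicator (fun x => ENNReal.ofReal (igDensity (γ i) x)) (z i) :=
    Finset.measurable_fun_prod _ fun i _ => (hmf i).comp (measurable_pi_apply i)
  have hpi : (Measure.pi fun i => igLaw (γ i)) =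
      (volume : Measure (Fin (m + 1) → ℝ)).withDensity fun z => ∏ i,
        (Set.Ioi (0 : ℝ)).indicator (fun x => ENNReal.ofReal (igDensity (γ i) x)) (z i) := by
    have hinst : ∀ i, SigmaFinite ((volume : Measure ℝ).withDensity
        ((Set.Ioi 0).indicator fun x => ENNReal.ofReal (igDensity (γ i) x))) := fun i => by
      rw [← igLaw_eq_withDensity (hγ i)]
      infer_instance
    rw [← pi_fin_withDensity hmf]
    congr 1
    funext i
    exact igLaw_eq_withDensity (hγ i)
  have hint : ∀ w : Fin m → ℝ, ∫⁻ s in Set.Ioi (0 : ℝ), ENNReal.ofReal (s ^ m) *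
      ∏ i, (Set.Ioi 0).indicator (fun x => ENNReal.ofReal (igDensity (γ i) x))
        (s * completeToOne w i) = ENNReal.ofReal (nigDensity γ (completeToOne w)) := fun w =>
    lintegral_prod_igDensity hγ (sum_completeToOne w)
  have hmeas : Measurable fun w : Fin m → ℝ =>
      ENNReal.ofReal (nigDensity γ (completeToOne w)) := by
    -- Measurability of the density is read off its representation as a parametric integral, which
    -- bypasses the Bessel function.
    simp_rw [← hint]
    refine Measurable.lintegral_prod_right' (f := fun p : (Fin m → ℝ) × ℝ =>
      ENNReal.ofReal (p.2 ^ m) * ∏ i, (Set.Ioi 0).indicator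
        (fun x => ENNReal.ofReal (igDensity (γ i) x)) (p.2 * completeToOne p.1 i)) ?_
    refine Measurable.mul (by fun_prop) (hmprod.comp (measurable_pi_lambda _ fun i => ?_))
    exact measurable_snd.mul ((measurable_pi_apply i).comp
      (measurable_completeToOne.comp measurable_fst))
  refine Measure.ext_of_lintegral _ fun g hg => ?_
  rw [nigLaw, lintegral_map hg measurable_completeToOne,
    lintegral_withDensity_eq_lintegral_mul _ hmeas
      (g := fun w => g (completeToOne w)) (hg.comp measurable_completeToOne),
    lintegral_map hg measurable_normalize, hpi,
    lintegral_withDensity_eq_lintegral_mul _ hmprod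
      (g := fun z => g (normalize z)) (hg.comp measurable_normalize),
    lintegral_polar_simplex]
  · refine lintegral_congr fun w => ?_
    simp only [Pi.mul_apply]
    rw [← hint, ← lintegral_mul_const]
    · refine setLIntegral_congr_fun measurableSet_Ioi fun s (hs : 0 < s) => ?_
      have : normalize (s • completeToOne w) = completeToOne w := by
        simp only [normalize, Pi.smul_apply, smul_eq_mul, ← Finset.mul_sum, sum_completeToOne,
          mul_one, smul_smul, inv_mul_cancel₀ hs.ne', one_smul]
      simp only [this, Pi.smul_apply, smul_eq_mul, mul_assoc]
    · refine Measurable.mul (by fun_prop) (hmprod.comp (measurable_pi_lambda _ fun i => ?_))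
      fun_prop
  · exact hmprod.mul (hg.comp measurable_normalize)
  · intro z hz
    have : ∃ i, z i ≤ 0 := by
      by_contra! h
      exact absurd (Finset.sum_pos (fun i _ => h i) Finset.univ_nonempty) (not_lt.2 hz)
    obtain ⟨i, hi⟩ := this
    simp only [Pi.mul_apply]
    rw [Finset.prod_eq_zero (Finset.mem_univ i), zero_mul]
    exact Set.indicator_of_notMem (by simpa using hi) _

/-! ### The masses of a finite partition, with cells that may be null -/

/-- Extension of a vector by zero along an injection. -/
def extendZero {κ ι : Type*} (e : κ → ι) (z : κ → ℝ) : ι → ℝ := Function.extend e z 0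

theorem sum_extendZero {κ ι : Type*} [Fintype κ] [Fintype ι] {e : κ → ι}
    (he : Function.Injective e) (z : κ → ℝ) : ∑ i, extendZero e z i = ∑ k, z k := by
  classical
  have h : ∀ i, i ∉ Finset.univ.image e → extendZero e z i = 0 := fun i hi =>
    Function.extend_apply' _ _ _ (by simpa using hi)
  rw [← Finset.sum_subset (Finset.subset_univ (Finset.univ.image e)) fun i _ hi => h i hi,
    Finset.sum_image fun x _ y _ hxy => he hxy]
  exact Finset.sum_congr rfl fun k _ => he.extend_apply _ _ _

theorem measurable_extendZero {κ ι : Type*} {e : κ → ι} (he : Function.Injective e) :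
    Measurable (extendZero e) := by
  refine measurable_pi_lambda _ fun i => ?_
  by_cases hi : ∃ k, e k = i
  · obtain ⟨k, rfl⟩ := hi
    simp only [extendZero, he.extend_apply]
    fun_prop
  · simp only [extendZero, Function.extend_apply' _ _ _ hi]
    fun_prop

theorem normalize_extendZero {κ ι : Type*} [Fintype κ] [Fintype ι] {e : κ → ι}
    (he : Function.Injective e) (z : κ → ℝ) :
    normalize (extendZero e z) = extendZero e (normalize z) := by
  funext i
  simp only [normalize, sum_extendZero he, Pi.smul_apply, smul_eq_mul]
  by_cases hi : ∃ k, e k = i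
  · obtain ⟨k, rfl⟩ := hi
    simp [extendZero, he.extend_apply]
  · simp [extendZero, Function.extend_apply' _ _ _ hi]

/-- The product of inverse-Gaussian laws with some parameters `0` is supported by the coordinates
with a positive parameter. -/
theorem map_extendZero_pi_igLaw {κ ι : Type*} [Fintype κ] [Fintype ι] {e : κ → ι}
    (he : Function.Injective e) {γ : ι → ℝ} (hγ : ∀ i, i ∉ Set.range e → γ i = 0) :
    (Measure.pi fun k => igLaw (γ (e k))).map (extendZero e) = Measure.pi fun i => igLaw (γ i) := by
  have hind : iIndepFun (fun k (z : ι → ℝ) => z (e k)) (Measure.pi fun i => igLaw (γ i)) :=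
    (iIndepFun_pi (X := fun _ => id) fun i => aemeasurable_id).precomp he
  have hr : (Measure.pi fun i => igLaw (γ i)).map (fun z k => z (e k)) =
      Measure.pi fun k => igLaw (γ (e k)) := by
    rw [(iIndepFun_iff_map_fun_eq_pi_map fun k => (measurable_pi_apply (e k)).aemeasurable).1 hind]
    congr 1
    funext k
    exact (measurePreserving_eval (fun i => igLaw (γ i)) (e k)).map_eq
  have hae : ∀ᵐ z ∂Measure.pi fun i => igLaw (γ i), ∀ i, i ∉ Set.range e → z i = 0 := by
    refine ae_all_iff.2 fun i => ?_
    by_cases hi : i ∈ Set.range e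
    · exact ae_of_all _ fun _ h => absurd hi h
    · have h0 : ∀ᵐ x ∂igLaw (γ i), x = 0 := by
        rw [hγ i hi, igLaw_zero, ae_dirac_eq]
        rfl
      exact ((measurePreserving_eval (fun i => igLaw (γ i)) i).quasiMeasurePreserving.ae h0).mono
        fun z hz _ => hz
  rw [← hr, Measure.map_map (measurable_extendZero he) (by fun_prop)]
  have : extendZero e ∘ (fun (z : ι → ℝ) k => z (e k)) =ᵐ[Measure.pi fun i => igLaw (γ i)] id := by
    filter_upwards [hae] with z hz
    funext i
    by_cases hi : ∃ k, e k = i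
    · obtain ⟨k, rfl⟩ := hi
      simp [extendZero, he.extend_apply]
    · simp only [Function.comp, extendZero, Function.extend_apply' _ _ _ hi]
      exact (hz i hi).symm
  rw [Measure.map_congr this, Measure.map_id]

/-- The definition of the process describes only partitions into cells of positive mass. The null
cells are therefore merged into one positive cell; they carry no random mass almost surely, which
matches `igLaw 0` being the unit mass at `0`. -/
theorem IsNIGProcess.hasLaw_cells {𝔛 Ω ι : Type*} [MeasurableSpace 𝔛] [MeasurableSpace Ω]
    [Fintype ι] {a : ℝ} {H : Measure 𝔛} [IsProbabilityMeasure H] {P : Kernel Ω 𝔛}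
    [IsMarkovKernel P] {μ : Measure Ω} (h : IsNIGProcess a H P μ) (ha : 0 < a)
    {A : ι → Set 𝔛} (hA : ∀ i, MeasurableSet (A i)) (hd : Pairwise (Function.onFun Disjoint A))
    (hU : (⋃ i, A i) = Set.univ) :
    HasLaw (fun ω i => (P ω).real (A i))
      ((Measure.pi fun i => igLaw (a * H.real (A i))).map normalize) μ := by
  classical
  have hne : Nonempty {i // 0 < H (A i)} := by
    by_contra hcon
    rw [nonempty_subtype] at hcon
    push Not at hcon
    have : H Set.univ ≤ 0 := by
      rw [← hU]
      refine (measure_iUnion_le A).trans ?_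
      rw [ENNReal.tsum_eq_zero.2 fun i => nonpos_iff_eq_zero.1 (hcon i)]
    simp at this
  obtain ⟨m, hm⟩ : ∃ m, Fintype.card {i // 0 < H (A i)} = m + 1 :=
    Nat.exists_eq_succ_of_ne_zero Fintype.card_ne_zero
  let e' : Fin (m + 1) ≃ {i // 0 < H (A i)} := (Fintype.equivFinOfCardEq hm).symm
  let e : Fin (m + 1) → ι := fun k => (e' k).1
  have he : Function.Injective e := Subtype.val_injective.comp e'.injective
  have hepos : ∀ k, 0 < H (A (e k)) := fun k => (e' k).2
  have hnull : ∀ i, i ∉ Set.range e → H (A i) = 0 := fun i hi => by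
    by_contra hne
    exact hi ⟨e'.symm ⟨i, pos_iff_ne_zero.2 hne⟩, by simp [e]⟩
  set N : Set 𝔛 := ⋃ i ∈ {i | i ∉ Set.range e}, A i with hN
  have hNm : MeasurableSet N := MeasurableSet.biUnion (Set.to_countable _) fun i _ => hA i
  have hHN : H N = 0 := (measure_biUnion_null_iff (Set.to_countable _)).2 hnull
  have hNdisj : ∀ k, Disjoint (A (e k)) N := fun k => by
    rw [hN, Set.disjoint_iUnion₂_right]
    exact fun i hi => hd fun hik => hi ⟨k, hik⟩
  -- Absorbing `N`, the union of the null cells, changes neither the `H`-mass nor, almost surely,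
  -- the random mass of cell `0`.
  let A' : Fin (m + 1) → Set 𝔛 := fun k => if k = 0 then A (e k) ∪ N else A (e k)
  have hsub : ∀ k, A (e k) ⊆ A' k := fun k => by
    by_cases hk : k = 0 <;> simp [A', hk]
  have hsub' : ∀ k, A' k ⊆ A (e k) ∪ N := fun k => by
    by_cases hk : k = 0 <;> simp [A', hk]
  have hA' : ∀ k, MeasurableSet (A' k) := fun k => by
    by_cases hk : k = 0
    · simpa [A', hk] using (hA _).union hNm
    · simpa [A', hk] using hA _
  have hd' : Pairwise (Function.onFun Disjoint A') := by
    intro j k hjk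
    have h1 : Disjoint (A (e j)) (A (e k)) := hd fun hh => hjk (he hh)
    simp only [Function.onFun, A']
    split_ifs with hj hk
    · exact absurd (hj.trans hk.symm) hjk
    · exact Set.disjoint_union_left.2 ⟨h1, (hNdisj k).symm⟩
    · exact Set.disjoint_union_right.2 ⟨h1, hNdisj j⟩
    · exact h1
  have hU' : (⋃ k, A' k) = Set.univ := by
    refine Set.eq_univ_of_forall fun x => ?_
    have hx : x ∈ ⋃ i, A i := hU ▸ Set.mem_univ x
    obtain ⟨i, hi⟩ := Set.mem_iUnion.1 hx
    by_cases hir : i ∈ Set.range e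
    · obtain ⟨k, rfl⟩ := hir
      exact Set.mem_iUnion.2 ⟨k, hsub k hi⟩
    · refine Set.mem_iUnion.2 ⟨0, ?_⟩
      have hxN : x ∈ N := Set.mem_biUnion (show i ∈ {i | i ∉ Set.range e} from hir) hi
      simp [A', hxN]
  have hpos' : ∀ k, 0 < H (A' k) := fun k => (hepos k).trans_le (measure_mono (hsub k))
  have hlaw := h.partition m A' hA' hd' hU' hpos'
  have hHA' : ∀ k, H.real (A' k) = H.real (A (e k)) := fun k => by
    refine le_antisymm ?_ (measureReal_mono (hsub k))
    refine (measureReal_mono (hsub' k)).trans ((measureReal_union_le _ _).trans ?_)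
    simp [measureReal_def, hHN]
  have hgpos : ∀ k, 0 < a * H.real (A' k) := fun k =>
    mul_pos ha (ENNReal.toReal_pos (hpos' k).ne' (measure_ne_top _ _))
  rw [nigLaw_eq_map_normalize hgpos] at hlaw
  have hae : ∀ᵐ ω ∂μ, ∀ i, i ∉ Set.range e → P ω (A i) = 0 := by
    refine ae_all_iff.2 fun i => ?_
    by_cases hi : i ∈ Set.range e
    · exact ae_of_all _ fun _ hh => absurd hi hh
    · exact (h.null (A i) (hA i) (hnull i hi)).mono fun ω hω _ => hω
  have hcongr : (fun ω i => (P ω).real (A i)) =ᵐ[μ]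
      fun ω => extendZero e fun k => (P ω).real (A' k) := by
    filter_upwards [hae] with ω hω
    have hPN : P ω N = 0 := (measure_biUnion_null_iff (Set.to_countable _)).2 hω
    funext i
    by_cases hi : ∃ k, e k = i
    · obtain ⟨k, rfl⟩ := hi
      rw [extendZero, he.extend_apply]
      refine le_antisymm (measureReal_mono (hsub k)) ?_
      refine (measureReal_mono (hsub' k)).trans ((measureReal_union_le _ _).trans ?_)
      simp [measureReal_def, hPN]
    · rw [extendZero, Function.extend_apply' _ _ _ hi, measureReal_def, hω i hi]
      rfl
  refine HasLaw.congr ?_ hcongr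
  have hme := measurable_extendZero he
  refine ⟨hme.comp_aemeasurable hlaw.aemeasurable, ?_⟩
  have hcomp : (fun ω => extendZero e fun k => (P ω).real (A' k)) =
      extendZero e ∘ fun ω k => (P ω).real (A' k) := rfl
  rw [hcomp, ← AEMeasurable.map_map_of_aemeasurable hme.aemeasurable hlaw.aemeasurable,
    hlaw.map_eq, Measure.map_map hme measurable_normalize]
  have : extendZero e ∘ normalize = normalize ∘ extendZero e := by
    funext z
    exact (normalize_extendZero he z).symm
  rw [this, ← Measure.map_map measurable_normalize hme]
  simp_rw [hHA']
  rw [map_extendZero_pi_igLaw he (γ := fun i => a * H.real (A i)) fun i hi => by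
    simp [measureReal_def, hnull i hi]]

/-! ### A maximal inequality for independent variables -/

/-- Exponential maximal inequality for the partial sums of independent variables. -/
theorem pi_exists_le_partialSum_le {n : ℕ} (ρ : Fin n → Measure ℝ) [∀ i, IsProbabilityMeasure (ρ i)]
    {g : Fin n → ℝ → ℝ} (hg : ∀ i, Measurable (g i))
    (h1 : ∀ i, ∫⁻ x, ENNReal.ofReal (Real.exp (g i x)) ∂ρ i ≤ 1) (c : ℝ) :
    Measure.pi ρ {z | ∃ j, c ≤ ∑ i, if i ≤ j then g i (z i) else 0} ≤
      ENNReal.ofReal (Real.exp (-c)) := by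
  induction n generalizing c with
  | zero => simp
  | succ n ih =>
    have hmeas : ∀ c, MeasurableSet {z : Fin (n + 1) → ℝ |
        ∃ j, c ≤ ∑ i, if i ≤ j then g i (z i) else 0} := fun c => by
      rw [Set.ofPred_exists]
      refine MeasurableSet.iUnion fun j => measurableSet_le measurable_const ?_
      refine Finset.measurable_fun_sum _ fun i _ => ?_
      by_cases hij : i ≤ j
      · simp only [hij, if_true]
        exact (hg i).comp (measurable_pi_apply i)
      · simp only [hij, if_false]
        fun_prop
    have hm := (measurePreserving_piFinSuccAbove ρ 0).symm
    rw [← hm.measure_preimage (hmeas c).nullMeasurableSet,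
      Measure.prod_apply (hm.measurable (hmeas c))]
    have hsplit : ∀ (x : ℝ) (z : Fin n → ℝ) (j : Fin (n + 1)),
        (∑ i, if i ≤ j then g i ((Fin.cons x z : Fin (n + 1) → ℝ) i) else 0) =
        g 0 x + ∑ i : Fin n, if i.succ ≤ j then g i.succ (z i) else 0 := fun x z j => by
      rw [Fin.sum_univ_succ]
      simp
    -- Condition on the first variable. If it reaches the level `c` alone, the factor `exp (g 0 x -
    -- c)` is at least 1 and bounds any probability; otherwise the remaining sums must reach `c - g
    -- 0 x`, and induction applies.
    calc _ ≤ ∫⁻ x, ENNReal.ofReal (Real.exp (-c)) * ENNReal.ofReal (Real.exp (g 0 x)) ∂ρ 0 := by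
          refine lintegral_mono fun x => ?_
          rw [← ENNReal.ofReal_mul (Real.exp_pos _).le, ← Real.exp_add]
          by_cases hx : c ≤ g 0 x
          · refine prob_le_one.trans ?_
            rw [← ENNReal.ofReal_one]
            exact ENNReal.ofReal_le_ofReal (Real.one_le_exp (by linarith))
          · refine (measure_mono ?_).trans ((ih (fun i => ρ i.succ) (fun i => hg i.succ)
              (fun i => h1 i.succ) (c - g 0 x)).trans (le_of_eq ?_))
            · rintro z ⟨j, hj⟩
              have hcons : (MeasurableEquiv.piFinSuccAbove (fun _ => ℝ) 0).symm (x, z) =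
                  (Fin.cons x z : Fin (n + 1) → ℝ) := Fin.insertNth_zero' x z
              have hj' : c ≤ ∑ i, if i ≤ j then g i ((Fin.cons x z : Fin (n + 1) → ℝ) i) else 0 := by
                rw [← hcons]
                exact hj
              rw [hsplit] at hj'
              refine Fin.cases (fun hj' => ?_) (fun k hj' => ?_) j hj'
              · have h0 : ∀ i : Fin n, ¬ i.succ ≤ 0 := fun i => by simp
                simp only [h0, if_false, Finset.sum_const_zero, add_zero] at hj'
                exact absurd hj' hx
              · refine ⟨k, ?_⟩
                simp only [Fin.succ_le_succ_iff] at hj'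
                linarith
            · congr 2
              ring
      _ ≤ _ := by
          rw [lintegral_const_mul _ (by have := hg 0; fun_prop)]
          exact mul_le_of_le_one_right zero_le (h1 0)

/-- The increments `u * (x - γ i) - 2 * γ i * u ^ 2` have exponential moment at most 1, and
increments outside `I` are set to zero. The total compensation over `I` is at most `2 * s * u ^ 2`.
-/
theorem pi_igLaw_exists_le_mul_sum {n : ℕ} {γ : Fin n → ℝ} (hγ : ∀ i, 0 ≤ γ i)
    (I : Finset (Fin n)) {s : ℝ} (hs : ∑ i ∈ I, γ i ≤ s) {u : ℝ} (hu : u < 1 / 2) (c : ℝ) :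
    (Measure.pi fun i => igLaw (γ i)) {z | ∃ j, c ≤ u * ∑ i ∈ I with i ≤ j, (z i - γ i)} ≤
      ENNReal.ofReal (Real.exp (2 * s * u ^ 2 - c)) := by
  classical
  let g : Fin n → ℝ → ℝ := fun i x => if i ∈ I then u * (x - γ i) - 2 * γ i * u ^ 2 else 0
  have hg : ∀ i, Measurable (g i) := fun i => by
    by_cases hi : i ∈ I
    · simp only [g, hi, if_true]
      fun_prop
    · simp only [g, hi, if_false]
      fun_prop
  have h1 : ∀ i, ∫⁻ x, ENNReal.ofReal (Real.exp (g i x)) ∂igLaw (γ i) ≤ 1 := fun i => by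
    by_cases hi : i ∈ I
    · simp only [g, hi, if_true]
      exact lintegral_exp_centred_igLaw_le (hγ i) hu
    · simp [g, hi]
  refine (measure_mono ?_).trans ((pi_exists_le_partialSum_le (fun i => igLaw (γ i)) hg h1
    (c - 2 * s * u ^ 2)).trans (le_of_eq ?_))
  · rintro z ⟨j, hj⟩
    refine ⟨j, ?_⟩
    have h2 : (∑ i, if i ≤ j then g i (z i) else 0) =
        u * ∑ i ∈ I with i ≤ j, (z i - γ i) - 2 * (∑ i ∈ I with i ≤ j, γ i) * u ^ 2 := by
      rw [Finset.mul_sum, Finset.mul_sum, Finset.sum_mul, ← Finset.sum_sub_distrib,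
        Finset.sum_filter, ← Finset.sum_filter_add_sum_filter_not Finset.univ (· ∈ I)]
      have e1 : ∑ i with i ∉ I, (if i ≤ j then g i (z i) else 0) = 0 :=
        Finset.sum_eq_zero fun i hi => by
          have : i ∉ I := (Finset.mem_filter.1 hi).2
          simp [g, this]
      rw [e1, add_zero]
      have e2 : Finset.univ.filter (· ∈ I) = I := by ext; simp
      rw [e2]
      refine Finset.sum_congr rfl fun i hi => ?_
      simp [g, hi]
    have h3 : ∑ i ∈ I with i ≤ j, γ i ≤ s :=
      (Finset.sum_le_sum_of_subset_of_nonneg (Finset.filter_subset _ _)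
        fun i _ _ => hγ i).trans hs
    rw [h2]
    nlinarith [mul_le_mul_of_nonneg_right h3 (sq_nonneg u)]
  · congr 2
    ring

/-- Both tails come from `u = ± θ / √a`, which cancels the scale `√a`. The condition `2 * θ < √a` is
`u < 1 / 2`. -/
theorem pi_igLaw_exists_le_abs_sum {n : ℕ} {γ : Fin n → ℝ} (hγ : ∀ i, 0 ≤ γ i)
    (I : Finset (Fin n)) {a δ θ : ℝ} (hs : ∑ i ∈ I, γ i ≤ a * δ) (hθ : 0 < θ) (ha : 2 * θ < √a)
    (ε : ℝ) :
    (Measure.pi fun i => igLaw (γ i)) {z | ∃ j, ε * √a ≤ |∑ i ∈ I with i ≤ j, (z i - γ i)|} ≤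
      ENNReal.ofReal (2 * Real.exp (2 * δ * θ ^ 2 - θ * ε)) := by
  have hsa : 0 < √a := by linarith
  have ha2 : √a ^ 2 = a := Real.sq_sqrt (Real.sqrt_pos.1 hsa).le
  have hu : θ / √a < 1 / 2 := by
    rw [div_lt_div_iff₀ hsa (by norm_num)]
    linarith
  have hu' : -(θ / √a) < 1 / 2 := by
    have : 0 < θ / √a := by positivity
    linarith
  have e : 2 * (a * δ) * (θ / √a) ^ 2 = 2 * δ * θ ^ 2 := by
    rw [← ha2, Real.sqrt_sq hsa.le]
    field_simp
  have b1 := pi_igLaw_exists_le_mul_sum hγ I hs hu (θ * ε)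
  have b2 := pi_igLaw_exists_le_mul_sum hγ I hs hu' (θ * ε)
  rw [neg_sq] at b2
  rw [e] at b1 b2
  refine (measure_mono ?_).trans ((measure_union_le _ _).trans ((add_le_add b1 b2).trans
    (le_of_eq ?_)))
  · rintro z ⟨j, hj⟩
    have key : θ * ε ≤ θ / √a * |∑ i ∈ I with i ≤ j, (z i - γ i)| := by
      have := mul_le_mul_of_nonneg_left hj (show 0 ≤ θ / √a by positivity)
      calc θ * ε = θ / √a * (ε * √a) := by field_simp
        _ ≤ _ := this
    rcases abs_choice (∑ i ∈ I with i ≤ j, (z i - γ i)) with h | h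
    · left
      exact ⟨j, by rwa [h] at key⟩
    · right
      exact ⟨j, by rw [h] at key; linarith⟩
  · rw [← ENNReal.ofReal_add (Real.exp_pos _).le (Real.exp_pos _).le,
      two_mul (Real.exp _)]

/-- The bound for the oscillation of the centred process over a block of mass `1 / N`. -/
def blockBound (N : ℕ) (ε : ℝ) : ℝ := 2 * Real.exp (2 - √N * ε) + 2 * Real.exp (2 - √N)

/-- The normalized deviation equals `(w - h * (S - a)) / S`, and `S` is at least `a / 2`. The error
in the total is thus damped by the small mass `h` of the block. -/
theorem abs_normalized_sum_le {S a h w ε δ K : ℝ} (hδ : 0 ≤ δ) (hK : 0 ≤ K) (ha : 2 * K ≤ √a)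
    (ha0 : 0 < a) (hS : |S - a| < K * √a) (hw : |w| < ε * √a) (h0 : 0 ≤ h) (hδ' : h ≤ δ) :
    √a * |S⁻¹ * (w + a * h) - h| < 2 * (ε + δ * K) := by
  have hsa : 0 < √a := Real.sqrt_pos.2 ha0
  have ha2 : √a * √a = a := Real.mul_self_sqrt ha0.le
  have hS2 : a / 2 ≤ S := by
    have := (abs_lt.1 hS).1
    nlinarith
  have hS0 : 0 < S := by linarith
  have e : S⁻¹ * (w + a * h) - h = (w - h * (S - a)) / S := by
    field_simp
    ring
  have hnum : |w - h * (S - a)| < (ε + δ * K) * √a := by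
    have h2 : |h * (S - a)| ≤ δ * (K * √a) := by
      rw [abs_mul, abs_of_nonneg h0]
      exact mul_le_mul hδ' hS.le (abs_nonneg _) hδ
    calc _ ≤ |w| + |h * (S - a)| := abs_sub _ _
      _ < ε * √a + δ * (K * √a) := by linarith
      _ = _ := by ring
  have hpos : 0 ≤ |w - h * (S - a)| := abs_nonneg _
  rw [e, abs_div, abs_of_pos hS0, ← mul_div_assoc, div_lt_iff₀ hS0]
  nlinarith

/-- Normalization costs only the control of the total: a deviation up to `√N * √a` is harmless, as
multiplied by the block mass `1 / N` it contributes `1 / √N`. The condition `4 * N < a` is `2 * √N <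
√a`, needed both for the exponential bound and for `S ≥ a / 2`. -/
theorem pi_igLaw_normalize_oscillation {n : ℕ} {a : ℝ} {h : Fin (n + 1) → ℝ} (hh : ∀ i, 0 ≤ h i)
    (hsum : ∑ i, h i = 1) (I : Finset (Fin (n + 1))) {N : ℕ} (hN : 0 < N)
    (hI : ∑ i ∈ I, h i ≤ 1 / N) (ha : 4 * N < a) (ε : ℝ) :
    (Measure.pi fun i => igLaw (a * h i)) {z | ∃ j, 2 * (ε + 1 / √N) ≤
      √a * |∑ i ∈ I with i ≤ j, (normalize z i - h i)|} ≤ ENNReal.ofReal (blockBound N ε) := by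
  have hN1 : (1 : ℝ) ≤ N := by exact_mod_cast hN
  have ha0 : 0 < a := by linarith
  have hsN : 0 < √(N : ℝ) := Real.sqrt_pos.2 (by linarith)
  have hsN2 : √(N : ℝ) ^ 2 = N := Real.sq_sqrt (by linarith)
  have hsa : 2 * √(N : ℝ) < √a := by
    refine Real.lt_sqrt_of_sq_lt ?_
    rw [mul_pow, hsN2]
    linarith
  have hs1 : 1 ≤ √(N : ℝ) := Real.one_le_sqrt.2 hN1
  have hγ : ∀ i, 0 ≤ a * h i := fun i => mul_nonneg ha0.le (hh i)
  -- With `δ = 1 / N`, the choice `θ = √N` keeps the quadratic term `2 * δ * θ ^ 2` equal to 2 and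
  -- makes the linear gain `√N * ε`.
  have b1 := pi_igLaw_exists_le_abs_sum hγ I (a := a) (δ := 1 / N) (θ := √N)
    (by rw [← Finset.mul_sum]; exact mul_le_mul_of_nonneg_left hI ha0.le) hsN hsa ε
  have b2 := pi_igLaw_exists_le_abs_sum hγ Finset.univ (a := a) (δ := 1) (θ := 1)
    (by rw [← Finset.mul_sum, hsum]) one_pos (by linarith) √N
  have e1 : 2 * (1 / (N : ℝ)) * √N ^ 2 - √N * ε = 2 - √N * ε := by
    rw [hsN2]
    field_simp
  have e2 : 2 * 1 * 1 ^ 2 - 1 * √(N : ℝ) = 2 - √N := by ring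
  rw [e1] at b1
  rw [e2] at b2
  rw [blockBound, ENNReal.ofReal_add (by positivity) (by positivity)]
  refine (measure_mono ?_).trans ((measure_union_le _ _).trans (add_le_add b1 b2))
  rintro z ⟨j, hj⟩
  by_contra hcon
  simp only [Set.mem_union, Set.mem_ofPred_eq, not_or, not_exists, not_le] at hcon
  have hw := hcon.1 j
  have hS := hcon.2 (Fin.last n)
  have e3 : (Finset.univ.filter (· ≤ Fin.last n)) = Finset.univ :=
    Finset.filter_true_of_mem fun i _ => Fin.le_last i
  rw [e3, Finset.sum_sub_distrib, ← Finset.mul_sum, hsum, mul_one] at hS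
  have hle : ∑ i ∈ I with i ≤ j, h i ≤ 1 / N :=
    (Finset.sum_le_sum_of_subset_of_nonneg (Finset.filter_subset _ _) fun i _ _ => hh i).trans hI
  have key := abs_normalized_sum_le (S := ∑ i, z i) (δ := 1 / (N : ℝ)) (by positivity) hsN.le
    hsa.le ha0 hS hw (Finset.sum_nonneg fun i _ => hh i) hle
  have e4 : ∑ i ∈ I with i ≤ j, (normalize z i - h i) =
      (∑ i, z i)⁻¹ * (∑ i ∈ I with i ≤ j, (z i - a * h i) + a * ∑ i ∈ I with i ≤ j, h i) -
        ∑ i ∈ I with i ≤ j, h i := by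
    rw [Finset.sum_sub_distrib, Finset.sum_sub_distrib, ← Finset.mul_sum _ _ a, sub_add_cancel,
      Finset.mul_sum]
    rfl
  have e5 : 1 / (N : ℝ) * √N = 1 / √N := by
    rw [← hsN2, Real.sqrt_sq hsN.le]
    field_simp
  rw [e4, ← e5] at hj
  exact absurd key (not_lt.2 hj)

/-! ### Oscillation of the centred process over a block of small mass -/

/-- The number of elements of `T` to the left of `x`. -/
def rayCount (T : Finset EReal) (x : EReal) : ℕ := (T.filter (· < x)).card

theorem rayCount_mono (T : Finset EReal) {x y : EReal} (h : x ≤ y) :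
    rayCount T x ≤ rayCount T y :=
  Finset.card_le_card (Finset.monotone_filter_right _ fun _ _ ht => lt_of_lt_of_le ht h)

/-- Since `t` itself is in `T`, every point beyond `t` counts at least one more element of `T`.
Hence half-lines ending in `T` are unions of initial cells. -/
theorem le_iff_rayCount_le {T : Finset EReal} {t : EReal} (ht : t ∈ T) (x : EReal) :
    x ≤ t ↔ rayCount T x ≤ rayCount T t := by
  refine ⟨rayCount_mono T, fun h => ?_⟩
  by_contra! hlt
  refine absurd h (not_le.2 (Finset.card_lt_card ?_))
  refine ⟨Finset.monotone_filter_right _ fun _ _ h' => lt_trans h' hlt, fun hsub => ?_⟩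
  exact lt_irrefl _ (Finset.mem_filter.1 (hsub (Finset.mem_filter.2 ⟨ht, hlt⟩))).2

theorem rayCount_lt_card {T : Finset EReal} {t : EReal} (ht : t ∈ T) :
    rayCount T t < T.card :=
  Finset.card_lt_card ⟨Finset.filter_subset _ _, fun h =>
    lt_irrefl _ (Finset.mem_filter.1 (h ht)).2⟩

/-- The cells of the partition of the line into intervals with end points in `T`. -/
def rayCell (T : Finset EReal) (i : Fin (T.card + 1)) : Set ℝ := {x | rayCount T x = i}

theorem measurableSet_rayCell (T : Finset EReal) (i : Fin (T.card + 1)) :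
    MeasurableSet (rayCell T i) := by
  have hm : Measurable fun x : ℝ => rayCount T x := by
    simp_rw [rayCount, Finset.card_filter]
    refine Finset.measurable_fun_sum _ fun t _ => ?_
    refine Measurable.ite ?_ measurable_const measurable_const
    exact measurable_coe_real_ereal measurableSet_Ioi
  exact hm (MeasurableSet.singleton (i : ℕ))

theorem pairwise_disjoint_rayCell (T : Finset EReal) :
    Pairwise (Function.onFun Disjoint (rayCell T)) := fun _ _ hij =>
  Set.disjoint_left.2 fun _ hi hj => hij (Fin.ext (hi.symm.trans hj))

theorem iUnion_rayCell (T : Finset EReal) : ⋃ i, rayCell T i = Set.univ :=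
  Set.eq_univ_of_forall fun _ => Set.mem_iUnion.2
    ⟨⟨_, Nat.lt_succ_of_le (Finset.card_le_card (Finset.filter_subset _ _))⟩, rfl⟩

/-- The indices of the bounded cells. -/
def innerCells (T : Finset EReal) : Finset (Fin (T.card + 1)) :=
  Finset.univ.filter fun i => 0 < i.1 ∧ i.1 < T.card

/-- As `u` is the least element of `T`, cell `0` is exactly `lowerRay u`. Increments from `u` become
partial sums in the order of the cells, the form required by the maximal inequality. -/
theorem real_lowerRay_sub {T : Finset EReal} {u t : EReal} (hu : u ∈ T) (huT : ∀ t ∈ T, u ≤ t)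
    (ht : t ∈ T) (Q : Measure ℝ) [IsFiniteMeasure Q] :
    Q.real (lowerRay t) - Q.real (lowerRay u) =
      ∑ i ∈ innerCells T with i ≤ ⟨rayCount T t, (rayCount_lt_card ht).trans_le (Nat.le_succ _)⟩,
        Q.real (rayCell T i) := by
  have hu0 : rayCount T u = 0 := by
    refine Finset.card_eq_zero.2 (Finset.filter_eq_empty_iff.2 fun t ht => ?_)
    exact not_lt.2 (huT t ht)
  rw [← measureReal_sdiff (lowerRay_mono (huT t ht)) (measurableSet_lowerRay u),
    ← measureReal_biUnion_finset (fun _ _ _ _ hij => pairwise_disjoint_rayCell T hij)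
      fun i _ => measurableSet_rayCell T i]
  congr 1
  ext x
  simp only [Set.mem_sdiff, lowerRay, Set.mem_ofPred_eq, le_iff_rayCount_le ht,
    le_iff_rayCount_le hu, hu0, Set.mem_iUnion, Finset.mem_filter, innerCells, Finset.mem_univ,
    true_and, rayCell, exists_prop, Fin.le_def]
  constructor
  · rintro ⟨h1, h2⟩
    have := rayCount_lt_card ht
    exact ⟨⟨rayCount T x, by omega⟩, ⟨⟨by simpa using Nat.pos_of_ne_zero (by omega),
      by simpa using by omega⟩, h1⟩, rfl⟩
  · rintro ⟨i, ⟨⟨h1, h2⟩, h3⟩, h4⟩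
    rw [h4]
    exact ⟨h3, by omega⟩

/-- An atom at `u` falls into cell `0` and an atom at `v` into the last cell, so only the open
interval counts. -/
theorem sum_innerCells_le {T : Finset EReal} {u v : EReal} (huT : ∀ t ∈ T, u ≤ t)
    (hvT : ∀ t ∈ T, t < v) (Q : Measure ℝ) [IsFiniteMeasure Q] :
    ∑ i ∈ innerCells T, Q.real (rayCell T i) ≤ Q.real {x : ℝ | u < x ∧ x < v} := by
  rw [← measureReal_biUnion_finset (fun _ _ _ _ hij => pairwise_disjoint_rayCell T hij)
      fun i _ => measurableSet_rayCell T i]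
  refine measureReal_mono fun x hx => ?_
  simp only [Set.mem_iUnion, innerCells, Finset.mem_filter, Finset.mem_univ, true_and,
    rayCell, exists_prop, Set.mem_ofPred_eq] at hx
  obtain ⟨i, ⟨h1, h2⟩, h3⟩ := hx
  constructor
  · by_contra! h
    have : rayCount T u = 0 := by
      refine Finset.card_eq_zero.2 (Finset.filter_eq_empty_iff.2 fun t ht => ?_)
      exact not_lt.2 (huT t ht)
    have := rayCount_mono T h
    omega
  · by_contra! h
    have : rayCount T x = T.card := by
      rw [rayCount, Finset.filter_true_of_mem fun t ht => (hvT t ht).trans_le h]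
    omega

/-- The bound does not depend on the number of points in `T`. This is what allows passing to all
times in the block. -/
theorem IsNIGProcess.oscillation_finset {Ω : Type*} [MeasurableSpace Ω] {a : ℝ} {H : Measure ℝ}
    [IsProbabilityMeasure H] {P : Kernel Ω ℝ} [IsMarkovKernel P] {μ : Measure Ω}
    (h : IsNIGProcess a H P μ) {N : ℕ} (hN : 0 < N) (ha : 4 * N < a) {u v : EReal}
    (huv : H.real {x : ℝ | u < x ∧ x < v} ≤ 1 / N) {T : Finset EReal} (hu : u ∈ T)
    (huT : ∀ t ∈ T, u ≤ t) (hvT : ∀ t ∈ T, t < v) (ε : ℝ) :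
    μ {ω | ∃ t ∈ T, 2 * (ε + 1 / √N) ≤
      |scaledPath a H (P ω) t - scaledPath a H (P ω) u|} ≤ ENNReal.ofReal (blockBound N ε) := by
  have ha0 : 0 < a := lt_of_le_of_lt (by positivity) ha
  have hlaw := h.hasLaw_cells ha0 (measurableSet_rayCell T) (pairwise_disjoint_rayCell T)
    (iUnion_rayCell T)
  set γ := fun i => H.real (rayCell T i) with hγ
  have hsum : ∑ i, γ i = 1 := by
    rw [hγ, ← measureReal_iUnion_fintype (pairwise_disjoint_rayCell T) (measurableSet_rayCell T),
      iUnion_rayCell, probReal_univ]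
  have hb := pi_igLaw_normalize_oscillation (h := γ) (fun i => measureReal_nonneg) hsum
    (innerCells T) hN ((sum_innerCells_le huT hvT H).trans huv) ha ε
  set E : Set (Fin (T.card + 1) → ℝ) := {y | ∃ j, 2 * (ε + 1 / √N) ≤
      √a * |∑ i ∈ innerCells T with i ≤ j, (y i - γ i)|} with hE
  have hEm : MeasurableSet E := by
    rw [hE, Set.ofPred_exists]
    exact MeasurableSet.iUnion fun j => measurableSet_le measurable_const (by fun_prop)
  have hE2 : μ {ω | (fun i => (P ω).real (rayCell T i)) ∈ E} =
      (Measure.pi fun i => igLaw (a * γ i)) {z | normalize z ∈ E} := by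
    have h1 := Measure.map_apply_of_aemeasurable hlaw.aemeasurable hEm
    rw [hlaw.map_eq, Measure.map_apply measurable_normalize hEm] at h1
    exact h1.symm
  refine (measure_mono ?_).trans (hE2.le.trans hb)
  rintro ω ⟨t, ht, hle⟩
  refine ⟨⟨rayCount T t, (rayCount_lt_card ht).trans_le (Nat.le_succ _)⟩, hle.trans (le_of_eq ?_)⟩
  rw [Finset.sum_sub_distrib, ← real_lowerRay_sub hu huT ht (P ω), hγ,
    ← real_lowerRay_sub hu huT ht H]
  simp only [scaledPath]
  rw [← mul_sub, abs_mul, abs_of_nonneg (Real.sqrt_nonneg a)]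
  congr 2
  ring

/-! ### From finite sets of times to whole blocks -/

/-- By right continuity a strict inequality at `t` persists on an interval to the right of `t`,
which meets the dense sequence before `v`. -/
theorem Cadlag.exists_mem_denseSeq {x : Cadlag} {u v t : EReal} (ht : u ≤ t) (htv : t < v) {η : ℝ}
    (h : η < |x t - x u|) :
    ∃ k, (u ≤ TopologicalSpace.denseSeq EReal k ∧ TopologicalSpace.denseSeq EReal k < v) ∧
      η < |x (TopologicalSpace.denseSeq EReal k) - x u| := by
  have hc : ContinuousWithinAt (fun s => |x s - x u|) (Set.Ioi t) t :=
    (((x.right_continuous t).mono Set.Ioi_subset_Ici_self).sub continuousWithinAt_const).abs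
  have h1 : ∀ᶠ s in 𝓝[>] t, η < |x s - x u| := hc.eventually (lt_mem_nhds h)
  obtain ⟨w, hw, hws⟩ := (mem_nhdsGT_iff_exists_Ioo_subset' htv).1 h1
  have hne : (Set.Ioo t (min w v)).Nonempty := Set.nonempty_Ioo.2 (lt_min hw htv)
  obtain ⟨s, hs, k, rfl⟩ := (TopologicalSpace.denseRange_denseSeq EReal).inter_open_nonempty _
    isOpen_Ioo hne
  exact ⟨k, ⟨ht.trans hs.1.le, hs.2.trans_le (min_le_right _ _)⟩,
    hws ⟨hs.1, hs.2.trans_le (min_le_left _ _)⟩⟩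

/-! ### Quantile partitions -/

/-- The `i`-th of the `N`-quantiles of `H`, with end points `⊥` and `⊤`. -/
def quantile (H : Measure ℝ) (N i : ℕ) : EReal :=
  if N ≤ i then ⊤ else sInf {t | (i : ℝ) / N ≤ H.real (lowerRay t)}

theorem quantile_zero (H : Measure ℝ) {N : ℕ} (hN : 0 < N) : quantile H N 0 = ⊥ := by
  rw [quantile, if_neg (by omega)]
  exact le_bot_iff.1 (sInf_le (by simp))

theorem quantile_of_le (H : Measure ℝ) {N i : ℕ} (h : N ≤ i) : quantile H N i = ⊤ := if_pos h

theorem quantile_mono (H : Measure ℝ) (N : ℕ) : Monotone (quantile H N) := by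
  intro i j hij
  by_cases hj : N ≤ j
  · rw [quantile_of_le H hj]
    exact le_top
  · rw [quantile, quantile, if_neg hj, if_neg (by omega)]
    refine sInf_le_sInf fun t (ht : (j : ℝ) / N ≤ H.real (lowerRay t)) => ?_
    refine le_trans (b := (j : ℝ) / N) ?_ ht
    gcongr

/-- The infimum defining the quantile is attained, by right continuity of the distribution function.
-/
theorem le_real_lowerRay_quantile (H : Measure ℝ) [IsProbabilityMeasure H] {N i : ℕ} (h : i < N) :
    (i : ℝ) / N ≤ H.real (lowerRay (quantile H N i)) := by
  have hN : (0 : ℝ) < N := by exact_mod_cast (Nat.zero_le i).trans_lt h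
  rw [quantile, if_neg (by omega)]
  set s := {t | (i : ℝ) / N ≤ H.real (lowerRay t)} with hs
  have hne : s.Nonempty := by
    refine ⟨⊤, ?_⟩
    have : lowerRay ⊤ = Set.univ := by simp [lowerRay]
    rw [hs, Set.mem_ofPred_eq, this, probReal_univ, div_le_one hN]
    exact_mod_cast h.le
  obtain ⟨v, -, hv, hvs⟩ := exists_seq_tendsto_sInf hne (OrderBot.bddBelow s)
  have hc := rayMeasure_right H (sInf s)
  have hv' : Tendsto v atTop (𝓝[Set.Ici (sInf s)] (sInf s)) :=
    tendsto_nhdsWithin_iff.2 ⟨hv, Eventually.of_forall fun n => sInf_le (hvs n)⟩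
  exact ge_of_tendsto (hc.tendsto.comp hv') (Eventually.of_forall hvs)

theorem real_Iio_le {H : Measure ℝ} [IsProbabilityMeasure H] {v : EReal} {c : ℝ} (hc : 0 ≤ c)
    (h : ∀ t < v, H.real (lowerRay t) ≤ c) : H.real {x : ℝ | (x : EReal) < v} ≤ c := by
  rcases eq_bot_or_bot_lt v with rfl | hv
  · simpa using hc
  · obtain ⟨w, hw, hwv, hwt⟩ := exists_seq_strictMono_tendsto' hv
    have hU : {x : ℝ | (x : EReal) < v} = ⋃ n, lowerRay (w n) := by
      ext x
      simp only [Set.mem_ofPred_eq, Set.mem_iUnion, lowerRay]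
      refine ⟨fun hx => ?_, fun ⟨n, hn⟩ => hn.trans_lt (hwv n).2⟩
      exact ((hwt.eventually (lt_mem_nhds hx)).exists).imp fun n hn => hn.le
    have hm : Monotone fun n => lowerRay (w n) := fun m n hmn => lowerRay_mono (hw.monotone hmn)
    have ht := tendsto_measure_iUnion_atTop (μ := H) hm
    rw [← hU] at ht
    exact le_of_tendsto ((ENNReal.tendsto_toReal (measure_ne_top _ _)).comp ht)
      (Eventually.of_forall fun n => h _ (hwv n).2)

/-- At most `(i + 1) / N` lies strictly to the left of the next quantile, and at least `i / N` lies
up to and including the current one. -/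
theorem real_quantile_block_le (H : Measure ℝ) [IsProbabilityMeasure H] {N i : ℕ} (h : i < N) :
    H.real {x : ℝ | quantile H N i < x ∧ x < quantile H N (i + 1)} ≤ 1 / N := by
  have hN : (0 : ℝ) < N := by exact_mod_cast (Nat.zero_le i).trans_lt h
  have h1 := le_real_lowerRay_quantile H h
  have h2 : H.real {x : ℝ | (x : EReal) < quantile H N (i + 1)} ≤ ((i + 1 : ℕ) : ℝ) / N := by
    refine real_Iio_le (by positivity) fun t ht => ?_
    by_cases hi : N ≤ i + 1
    · refine measureReal_le_one.trans ?_
      rw [one_le_div hN]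
      exact_mod_cast hi
    · rw [quantile, if_neg hi] at ht
      by_contra! hcon
      exact absurd (sInf_le (show t ∈ {t | ((i + 1 : ℕ) : ℝ) / N ≤ H.real (lowerRay t)} from
        hcon.le)) (not_le.2 ht)
  -- The maximum covers coinciding quantiles, as produced by a large atom: the block is then empty.
  have h3 : H.real {x : ℝ | quantile H N i < x ∧ x < quantile H N (i + 1)} +
      H.real (lowerRay (quantile H N i)) ≤
      max (H.real {x : ℝ | (x : EReal) < quantile H N (i + 1)})
        (H.real (lowerRay (quantile H N i))) := by
    rcases lt_or_ge (quantile H N i) (quantile H N (i + 1)) with hlt | hge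
    · refine le_trans ?_ (le_max_left _ _)
      rw [← measureReal_union ?_ (measurableSet_lowerRay _)]
      · refine measureReal_mono fun x hx => ?_
        rcases hx with hx | hx
        · exact hx.2
        · exact lt_of_le_of_lt hx hlt
      · exact Set.disjoint_left.2 fun x hx hx' => absurd hx' (not_le.2 hx.1)
    · refine le_trans ?_ (le_max_right _ _)
      have : {x : ℝ | quantile H N i < x ∧ x < quantile H N (i + 1)} = ∅ :=
        Set.eq_empty_of_forall_notMem fun x hx => absurd (hx.1.trans hx.2) (not_lt.2 hge)
      rw [this]
      simp
  have h4 : ((i + 1 : ℕ) : ℝ) / N = i / N + 1 / N := by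
    push_cast
    ring
  rcases le_max_iff.1 h3 with h5 | h5
  · linarith
  · have : (0 : ℝ) < 1 / N := by positivity
    linarith

/-- The last of the `N`-quantiles of `H` that is at most `t`. -/
def lastQuantile (H : Measure ℝ) (N : ℕ) (t : EReal) : EReal :=
  quantile H N (Nat.findGreatest (fun i => quantile H N i ≤ t) N)

theorem lastQuantile_spec (H : Measure ℝ) {N : ℕ} (hN : 0 < N) (t : EReal) :
    t = ⊤ ∧ lastQuantile H N t = ⊤ ∨ ∃ i < N, lastQuantile H N t = quantile H N i ∧
      quantile H N i ≤ t ∧ t < quantile H N (i + 1) := by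
  classical
  set i := Nat.findGreatest (fun i => quantile H N i ≤ t) N with hi
  have hle : quantile H N i ≤ t := Nat.findGreatest_spec (P := fun i => quantile H N i ≤ t)
    (Nat.zero_le N) (by rw [quantile_zero H hN]; exact bot_le)
  rcases (Nat.findGreatest_le (P := fun i => quantile H N i ≤ t) N).eq_or_lt with h | h
  · left
    have hq : quantile H N i = ⊤ := quantile_of_le H h.ge
    refine ⟨top_le_iff.1 (hq ▸ hle), hq⟩
  · right
    refine ⟨i, h, rfl, hle, ?_⟩
    exact not_le.1 (Nat.findGreatest_is_greatest (P := fun i => quantile H N i ≤ t)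
      (Nat.lt_succ_self i) h)

/-! ### Characteristic functions in the Gaussian limit -/

theorem norm_cexp_mul_I_sub_le (x y : ℝ) :
    ‖Complex.exp (x * Complex.I) - Complex.exp (y * Complex.I)‖ ≤ |x - y| := by
  have h : Complex.exp (x * Complex.I) - Complex.exp (y * Complex.I) =
      Complex.exp (Complex.I * y) * (Complex.exp (Complex.I * ((x - y : ℝ) : ℂ)) - 1) := by
    rw [mul_sub, mul_one, ← Complex.exp_add]
    congr 2
    · push_cast
      ring
    · ring
  rw [h, norm_mul, Complex.norm_exp_I_mul_ofReal, one_mul]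
  exact Real.norm_exp_I_mul_ofReal_sub_one_le

/-- A quantitative Slutsky lemma: the integrands differ by at most `η` off the exceptional event and
by at most 2 on it. -/
theorem norm_integral_cexp_sub_le {α : Type*} [MeasurableSpace α] {ρ : Measure α}
    [IsProbabilityMeasure ρ] {X Y : α → ℝ} (hX : Measurable X) (hY : Measurable Y) {η β : ℝ}
    (hη : 0 ≤ η) (h : ρ.real {z | η < |X z - Y z|} ≤ β) :
    ‖(∫ z, Complex.exp (X z * Complex.I) ∂ρ) - ∫ z, Complex.exp (Y z * Complex.I) ∂ρ‖ ≤
      η + 2 * β := by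
  have hint : ∀ {Z : α → ℝ}, Measurable Z →
      Integrable (fun z => Complex.exp (Z z * Complex.I)) ρ := fun hZ =>
    Integrable.of_bound (by fun_prop) 1 (ae_of_all _ fun z => by
      rw [Complex.norm_exp_ofReal_mul_I])
  have hE : MeasurableSet {z | η < |X z - Y z|} :=
    measurableSet_lt measurable_const (by fun_prop)
  rw [← integral_sub (hint hX) (hint hY)]
  calc _ ≤ ∫ z, (η + {z | η < |X z - Y z|}.indicator (fun _ => (2 : ℝ)) z) ∂ρ := by
        refine norm_integral_le_of_norm_le ?_ (ae_of_all _ fun z => ?_)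
        · exact (integrable_const _).add ((integrable_const _).indicator hE)
        · by_cases hz : η < |X z - Y z|
          · rw [Set.indicator_of_mem (show z ∈ {z | η < |X z - Y z|} from hz)]
            refine (norm_sub_le _ _).trans ?_
            rw [Complex.norm_exp_ofReal_mul_I, Complex.norm_exp_ofReal_mul_I]
            linarith
          · rw [Set.indicator_of_notMem (show z ∉ {z | η < |X z - Y z|} from hz), add_zero]
            exact (norm_cexp_mul_I_sub_le _ _).trans (not_lt.1 hz)
    _ = η + 2 * ρ.real {z | η < |X z - Y z|} := by
        rw [integral_add (integrable_const _) ((integrable_const _).indicator hE),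
          integral_indicator hE]
        simp [mul_comm]
    _ ≤ _ := by linarith

/-- With `s = (1 - 2 * i * b / √a) ^ (1 / 2)` the exponent is `a * h * (1 - s) ^ 2 / 2`, and `(1 - s
^ 2) ^ 2 = -4 * b ^ 2 / a` turns it into `-2 * b ^ 2 * h / (1 + s) ^ 2`. The limit then needs only
`s → 1`. -/
theorem tendsto_charFun_centred_igLaw {h : ℝ} (hh : 0 ≤ h) (b : ℝ) :
    Tendsto (fun a : ℝ => ∫ x, Complex.exp ((b * (x - a * h) / √a : ℝ) * Complex.I) ∂igLaw (a * h))
      atTop (𝓝 (Complex.exp (-(b ^ 2 * h / 2 : ℝ)))) := by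
  set s : ℝ → ℂ := fun a => (1 - 2 * (((b / √a : ℝ) : ℂ) * Complex.I)) ^ (1 / 2 : ℂ) with hs
  have hinv : Tendsto (fun a : ℝ => b / √a) atTop (𝓝 0) :=
    tendsto_const_nhds.div_atTop Real.tendsto_sqrt_atTop
  have hs1 : Tendsto s atTop (𝓝 1) := by
    have hc : ContinuousAt (fun u : ℝ => (1 - 2 * ((u : ℂ) * Complex.I)) ^ (1 / 2 : ℂ)) 0 := by
      refine ContinuousAt.cpow (by fun_prop) continuousAt_const ?_
      simp
    have h := hc.tendsto.comp hinv
    have e : (1 - 2 * (((0 : ℝ) : ℂ) * Complex.I)) ^ (1 / 2 : ℂ) = 1 := by simp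
    rw [e] at h
    exact h
  have hlim : Tendsto (fun a => Complex.exp (-(2 * b ^ 2 * h) / (1 + s a) ^ 2)) atTop
      (𝓝 (Complex.exp (-(b ^ 2 * h / 2 : ℝ)))) := by
    have h2 : Tendsto (fun a => -(2 * b ^ 2 * h : ℂ) / (1 + s a) ^ 2) atTop
        (𝓝 (-(2 * b ^ 2 * h : ℂ) / (1 + 1) ^ 2)) :=
      tendsto_const_nhds.div ((tendsto_const_nhds.add hs1).pow 2) (by norm_num)
    have h3 : -(2 * b ^ 2 * h : ℂ) / (1 + 1) ^ 2 = ((-(b ^ 2 * h / 2) : ℝ) : ℂ) := by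
      push_cast
      ring
    rw [h3] at h2
    push_cast at h2 ⊢
    exact (Complex.continuous_exp.tendsto _).comp h2
  refine hlim.congr' ?_
  have hne : ∀ᶠ a in atTop, 1 + s a ≠ 0 := by
    have : Tendsto (fun a => 1 + s a) atTop (𝓝 (1 + 1)) := tendsto_const_nhds.add hs1
    exact this.eventually_ne (by norm_num)
  filter_upwards [hne, eventually_gt_atTop 0] with a ha1 ha
  have hsa : 0 < √a := Real.sqrt_pos.2 ha
  have hsa2 : √a ^ 2 = a := Real.sq_sqrt ha.le
  have hfac : ∀ x : ℝ, Complex.exp ((b * (x - a * h) / √a : ℝ) * Complex.I) =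
      Complex.exp (-((b / √a : ℝ) * (a * h : ℝ) * Complex.I)) *
        Complex.exp ((b / √a : ℝ) * x * Complex.I) := fun x => by
    rw [← Complex.exp_add]
    congr 1
    push_cast
    ring
  simp_rw [hfac]
  rw [integral_const_mul, ← charFun_apply_real, charFun_igLaw (mul_nonneg ha.le hh),
    ← Complex.exp_add]
  congr 1
  have hs2 : s a ^ 2 = 1 - 2 * (((b / √a : ℝ) : ℂ) * Complex.I) := by
    simp only [hs, one_div]
    exact Complex.cpow_ofNat_inv_pow _ 2
  have hI : ((b / √a : ℝ) : ℂ) * Complex.I = (1 - s a ^ 2) / 2 := by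
    rw [hs2]
    ring
  have hb : ((1 - s a ^ 2) / 2) ^ 2 = -(b ^ 2 / a : ℂ) := by
    rw [← hI, mul_pow, Complex.I_sq]
    have : ((b / √a : ℝ) : ℂ) ^ 2 = (b ^ 2 / a : ℂ) := by
      rw [← Complex.ofReal_pow, div_pow, hsa2]
      push_cast
      rfl
    rw [this]
    ring
  have haC : (a : ℂ) ≠ 0 := by exact_mod_cast ha.ne'
  have hb2 : (b : ℂ) ^ 2 = -a * ((1 - s a ^ 2) / 2) ^ 2 := by
    rw [hb]
    field_simp
  have e1 : -((b / √a : ℝ) * (a * h : ℝ) * Complex.I) =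
      -(((b / √a : ℝ) : ℂ) * Complex.I * (a * h : ℝ)) := by ring
  change _ = _ + ((a * h : ℝ) : ℂ) * (1 - s a)
  rw [e1, hI, hb2]
  push_cast
  field_simp
  ring

theorem pi_igLaw_abs_sum_ge_le {n : ℕ} {γ : Fin (n + 1) → ℝ} (hγ : ∀ i, 0 ≤ γ i)
    (I : Finset (Fin (n + 1))) {a : ℝ} (hs : ∑ i ∈ I, γ i ≤ a) (ha : 2 < √a) (K : ℝ) :
    (Measure.pi fun i => igLaw (γ i)).real {z | K * √a ≤ |∑ i ∈ I, (z i - γ i)|} ≤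
      2 * Real.exp (2 - K) := by
  have h := pi_igLaw_exists_le_abs_sum hγ I (a := a) (δ := 1) (θ := 1) (by linarith) one_pos
    (by linarith) K
  refine ENNReal.toReal_le_of_le_ofReal (by positivity) (le_trans (measure_mono ?_) (h.trans ?_))
  · intro z hz
    refine ⟨Fin.last n, ?_⟩
    rw [Finset.filter_true_of_mem fun i _ => Fin.le_last i]
    exact hz
  · refine le_of_eq ?_
    congr 3
    ring

/-- Adding a constant to `g` changes nothing on the normalized side, since both `normalize z` and
`h` sum to 1; centring `g` by its `h`-mean then makes the linearization error an exact multiple of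
the linear form. The factor `(a - S) / S` is of order `1 / √a` with high probability. -/
theorem normalize_sub_linear_form {n : ℕ} {a : ℝ} (ha : 0 < a) {h g z : Fin (n + 1) → ℝ}
    (hsum : ∑ i, h i = 1) (hz : 0 < ∑ i, z i) :
    √a * ∑ i, g i * (normalize z i - h i) -
      ∑ i, (g i - ∑ k, g k * h k) * (z i - a * h i) / √a =
    (a - ∑ i, z i) / (∑ i, z i) *
      ∑ i, (g i - ∑ k, g k * h k) * ((z i - a * h i) / √a) := by
  set m := ∑ k, g k * h k with hm
  set S := ∑ i, z i with hS
  have hsa : 0 < √a := Real.sqrt_pos.2 ha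
  have hsa2 : √a ^ 2 = a := Real.sq_sqrt ha.le
  have e1 : ∑ i, (g i - m) * (z i - a * h i) = ∑ i, g i * z i - m * S := by
    have : ∀ i, (g i - m) * (z i - a * h i) =
        g i * z i - m * z i - a * (g i * h i) + m * a * h i := fun i => by ring
    simp_rw [this, Finset.sum_add_distrib, Finset.sum_sub_distrib, ← Finset.mul_sum]
    rw [← hm, ← hS, hsum]
    ring
  have e2 : ∑ i, g i * (normalize z i - h i) = (∑ i, g i * z i) / S - m := by
    simp_rw [mul_sub, Finset.sum_sub_distrib]
    rw [← hm, div_eq_inv_mul, Finset.mul_sum]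
    congr 1
    refine Finset.sum_congr rfl fun i _ => ?_
    simp only [normalize, Pi.smul_apply, smul_eq_mul]
    ring
  simp_rw [← mul_div_assoc, ← Finset.sum_div]
  rw [e1, e2]
  field_simp
  rw [hsa2]

/-- Linear functionals of the normalized and centred vector are asymptotically Gaussian. -/
theorem tendsto_charFun_normalize {n : ℕ} {h : Fin (n + 1) → ℝ} (hh : ∀ i, 0 ≤ h i)
    (hsum : ∑ i, h i = 1) (g : Fin (n + 1) → ℝ) :
    Tendsto (fun a : ℝ => ∫ z, Complex.exp ((√a * ∑ i, g i * (normalize z i - h i) : ℝ) *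
        Complex.I) ∂Measure.pi fun i => igLaw (a * h i)) atTop
      (𝓝 (Complex.exp (-((∑ i, (g i - ∑ k, g k * h k) ^ 2 * h i) / 2 : ℝ)))) := by
  set m := ∑ k, g k * h k with hm
  set B := ∑ i, |g i - m| with hB
  have hB0 : 0 ≤ B := Finset.sum_nonneg fun _ _ => abs_nonneg _
  have hY : Tendsto (fun a : ℝ => ∫ z, Complex.exp
      ((∑ i, (g i - m) * (z i - a * h i) / √a : ℝ) * Complex.I)
        ∂Measure.pi fun i => igLaw (a * h i)) atTop
      (𝓝 (Complex.exp (-((∑ i, (g i - m) ^ 2 * h i) / 2 : ℝ)))) := by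
    have hprod : Complex.exp (-((∑ i, (g i - m) ^ 2 * h i) / 2 : ℝ)) =
        ∏ i, Complex.exp (-((g i - m) ^ 2 * h i / 2 : ℝ)) := by
      rw [← Complex.exp_sum]
      congr 1
      push_cast
      rw [Finset.sum_neg_distrib, Finset.sum_div]
    rw [hprod]
    refine (tendsto_finsetProd _ fun i _ =>
      tendsto_charFun_centred_igLaw (hh i) (g i - m)).congr fun a => ?_
    rw [← integral_fintype_prod_eq_prod
      (fun i x => Complex.exp (((g i - m) * (x - a * h i) / √a : ℝ) * Complex.I))]
    refine integral_congr_ae (ae_of_all _ fun z => ?_)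
    simp only
    rw [← Complex.exp_sum, Complex.ofReal_sum, Finset.sum_mul]
  refine tendsto_iff_norm_sub_tendsto_zero.2 ?_
  have hY' := tendsto_iff_norm_sub_tendsto_zero.1 hY
  have key : ∀ K : ℝ, 0 < K → ∀ᶠ a : ℝ in atTop,
      ‖(∫ z, Complex.exp ((√a * ∑ i, g i * (normalize z i - h i) : ℝ) * Complex.I)
        ∂Measure.pi fun i => igLaw (a * h i)) - ∫ z, Complex.exp
      ((∑ i, (g i - m) * (z i - a * h i) / √a : ℝ) * Complex.I)
        ∂Measure.pi fun i => igLaw (a * h i)‖ ≤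
      2 * K / √a * (K * B) + 2 * ((n + 2) * (2 * Real.exp (2 - K))) := by
    intro K hK
    filter_upwards [eventually_gt_atTop 0,
      Real.tendsto_sqrt_atTop.eventually_gt_atTop (max 2 (2 * K))] with a ha hsa'
    have hsa2 : 2 < √a := lt_of_le_of_lt (le_max_left _ _) hsa'
    have hsaK : 2 * K < √a := lt_of_le_of_lt (le_max_right _ _) hsa'
    have hsa : 0 < √a := by linarith
    have haa : √a * √a = a := Real.mul_self_sqrt ha.le
    have hγ : ∀ i, 0 ≤ a * h i := fun i => mul_nonneg ha.le (hh i)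
    refine norm_integral_cexp_sub_le ?_ (by fun_prop) (by positivity) ?_
    · have := measurable_normalize (ι := Fin (n + 1))
      fun_prop
    -- The index `none` stands for a large deviation of the total, `some i` for one of the
    -- coordinate `i`: `n + 2` exceptional events in all.
    let E : Option (Fin (n + 1)) → Set (Fin (n + 1) → ℝ) := fun o =>
      {z | K * √a ≤ |∑ i ∈ o.elim Finset.univ (fun i => {i}), (z i - a * h i)|}
    have hEb : ∀ o, (Measure.pi fun i => igLaw (a * h i)).real (E o) ≤ 2 * Real.exp (2 - K) := by
      intro o
      refine pi_igLaw_abs_sum_ge_le hγ _ ?_ hsa2 K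
      rw [← Finset.mul_sum]
      refine mul_le_of_le_one_right ha.le ?_
      rw [← hsum]
      exact Finset.sum_le_sum_of_subset_of_nonneg (Finset.subset_univ _) fun i _ _ => hh i
    have hsub : {z : Fin (n + 1) → ℝ | 2 * K / √a * (K * B) <
        |√a * ∑ i, g i * (normalize z i - h i) -
          ∑ i, (g i - m) * (z i - a * h i) / √a|} ⊆ ⋃ o, E o := by
      intro z hz
      by_contra hcon
      simp only [Set.mem_iUnion, not_exists] at hcon
      have hS : |∑ i, z i - a| < K * √a := by
        have := hcon none
        simp only [E, Set.mem_ofPred_eq, not_le, Option.elim_none, Finset.sum_sub_distrib,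
          ← Finset.mul_sum, hsum, mul_one] at this
        exact this
      have hi : ∀ i, |(z i - a * h i) / √a| ≤ K := fun i => by
        have := hcon (some i)
        simp only [E, Set.mem_ofPred_eq, not_le, Option.elim_some, Finset.sum_singleton] at this
        rw [abs_div, abs_of_pos hsa, div_le_iff₀ hsa]
        exact this.le
      have hS2 : a / 2 ≤ ∑ i, z i := by
        have := (abs_lt.1 hS).1
        nlinarith
      have hS0 : 0 < ∑ i, z i := by linarith
      have hz' : 2 * K / √a * (K * B) < |√a * ∑ i, g i * (normalize z i - h i) -
          ∑ i, (g i - m) * (z i - a * h i) / √a| := hz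
      rw [normalize_sub_linear_form ha hsum hS0, ← hm, abs_mul] at hz'
      refine absurd hz' (not_lt.2 (mul_le_mul ?_ ?_ (abs_nonneg _) (by positivity)))
      · rw [abs_div, abs_of_pos hS0, div_le_div_iff₀ hS0 hsa, abs_sub_comm]
        nlinarith
      · refine (Finset.abs_sum_le_sum_abs _ _).trans ?_
        rw [hB, Finset.mul_sum]
        refine Finset.sum_le_sum fun i _ => ?_
        rw [abs_mul, mul_comm]
        exact mul_le_mul_of_nonneg_right (hi i) (abs_nonneg _)
    refine (measureReal_mono hsub).trans ((measureReal_iUnion_fintype_le E).trans ?_)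
    refine (Finset.sum_le_sum fun o _ => hEb o).trans (le_of_eq ?_)
    rw [Finset.sum_const, Finset.card_univ, Fintype.card_option, Fintype.card_fin, nsmul_eq_mul]
    push_cast
    ring
  refine Metric.tendsto_nhds.2 fun ε hε => ?_
  -- The cut-off `K` is fixed first, making the exceptional events rare uniformly in `a`; only then
  -- does `a` grow.
  have hKlim : Tendsto (fun K : ℝ => 2 * ((n + 2) * (2 * Real.exp (2 - K)))) atTop (𝓝 0) := by
    have : Tendsto (fun K : ℝ => Real.exp (2 - K)) atTop (𝓝 0) :=
      Real.tendsto_exp_comp_nhds_zero.2 (tendsto_atBot_add_const_left _ 2 tendsto_neg_atTop_atBot)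
    simpa using (((this.const_mul 2).const_mul ((n : ℝ) + 2)).const_mul 2)
  obtain ⟨K, hK0, hK⟩ := ((eventually_gt_atTop 0).and
    (hKlim.eventually (gt_mem_nhds (show 0 < ε / 3 by positivity)))).exists
  have hlim2 : Tendsto (fun a : ℝ => 2 * K / √a * (K * B)) atTop (𝓝 0) := by
    have : Tendsto (fun a : ℝ => 2 * K / √a) atTop (𝓝 0) :=
      tendsto_const_nhds.div_atTop Real.tendsto_sqrt_atTop
    simpa using this.mul_const (K * B)
  filter_upwards [key K hK0, hlim2.eventually (gt_mem_nhds (show 0 < ε / 3 by positivity)),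
    hY'.eventually (gt_mem_nhds (show 0 < ε / 3 by positivity))] with a h1 h2 h3
  rw [Real.dist_0_eq_abs, abs_norm]
  exact (norm_sub_le_norm_sub_add_norm_sub _ _ _).trans_lt
    ((add_lt_add_of_le_of_lt h1 h3).trans_le (by linarith))

/-! ### Convergence of the finite-dimensional distributions -/

/-- The indicator that the cell of index `k` lies to the left of `t`. -/
def leftCell (T : Finset EReal) (t : EReal) (k : Fin (T.card + 1)) : ℝ :=
  if (k : ℕ) ≤ rayCount T t then 1 else 0

theorem real_lowerRay_inter {T : Finset EReal} {s t : EReal} (hs : s ∈ T) (ht : t ∈ T)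
    (Q : Measure ℝ) [IsFiniteMeasure Q] :
    Q.real (lowerRay s ∩ lowerRay t) =
      ∑ k, leftCell T s k * leftCell T t k * Q.real (rayCell T k) := by
  have h1 : ∀ k, leftCell T s k * leftCell T t k * Q.real (rayCell T k) =
      if (k : ℕ) ≤ rayCount T s ∧ (k : ℕ) ≤ rayCount T t then Q.real (rayCell T k) else 0 := by
    intro k
    unfold leftCell
    split_ifs <;> simp_all
  simp_rw [h1]
  rw [← Finset.sum_filter, ← measureReal_biUnion_finset
    (fun _ _ _ _ hij => pairwise_disjoint_rayCell T hij) fun i _ => measurableSet_rayCell T i]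
  congr 1
  ext x
  simp only [Set.mem_inter_iff, lowerRay, Set.mem_ofPred_eq, le_iff_rayCount_le hs,
    le_iff_rayCount_le ht, Set.mem_iUnion, Finset.mem_filter, Finset.mem_univ, true_and, rayCell,
    exists_prop]
  constructor
  · intro h
    exact ⟨⟨rayCount T x, h.1.trans_lt ((rayCount_lt_card hs).trans (Nat.lt_succ_self _))⟩, h, rfl⟩
  · rintro ⟨i, h, h2⟩
    rwa [h2]

theorem real_lowerRay {T : Finset EReal} {t : EReal} (ht : t ∈ T) (Q : Measure ℝ)
    [IsFiniteMeasure Q] :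
    Q.real (lowerRay t) = ∑ k, leftCell T t k * Q.real (rayCell T k) := by
  have := real_lowerRay_inter ht ht Q
  rw [Set.inter_self] at this
  rw [this]
  refine Finset.sum_congr rfl fun k _ => ?_
  unfold leftCell
  split_ifs <;> simp

theorem IsNIGProcess.integral_cexp {Ω : Type*} [MeasurableSpace Ω] {a : ℝ} {H : Measure ℝ}
    [IsProbabilityMeasure H] {P : Kernel Ω ℝ} [IsMarkovKernel P] {μ : Measure Ω}
    (h : IsNIGProcess a H P μ) (ha : 0 < a) {n : ℕ} {T : Finset EReal} {t : Fin n → EReal}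
    (ht : ∀ j, t j ∈ T) (c : Fin n → ℝ) :
    ∫ ω, Complex.exp ((∑ j, c j * scaledPath a H (P ω) (t j) : ℝ) * Complex.I) ∂μ =
      ∫ z, Complex.exp ((√a * ∑ k, (∑ j, c j * leftCell T (t j) k) *
        (normalize z k - H.real (rayCell T k)) : ℝ) * Complex.I)
        ∂Measure.pi fun k => igLaw (a * H.real (rayCell T k)) := by
  have hlaw := h.hasLaw_cells ha (measurableSet_rayCell T) (pairwise_disjoint_rayCell T)
    (iUnion_rayCell T)
  have hlin : ∀ ω, ∑ j, c j * scaledPath a H (P ω) (t j) = √a * ∑ k,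
      (∑ j, c j * leftCell T (t j) k) * ((P ω).real (rayCell T k) - H.real (rayCell T k)) := by
    intro ω
    simp only [scaledPath, real_lowerRay (ht _) (P ω), real_lowerRay (ht _) H,
      ← Finset.sum_sub_distrib, ← mul_sub, Finset.mul_sum, Finset.sum_mul]
    rw [Finset.sum_comm]
    refine Finset.sum_congr rfl fun k _ => Finset.sum_congr rfl fun j _ => ?_
    ring
  simp_rw [hlin]
  have hmeas : Measurable fun y : Fin (T.card + 1) → ℝ => Complex.exp
    ((√a * ∑ k, (∑ j, c j * leftCell T (t j) k) * (y k - H.real (rayCell T k)) : ℝ) *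
      Complex.I) := by fun_prop
  have h1 := hlaw.integral_comp hmeas.aestronglyMeasurable
  rw [integral_map measurable_normalize.aemeasurable hmeas.aestronglyMeasurable] at h1
  exact h1

/-- The variance of `∑ j, c j * B (t j)` is the variance under `H` of `∑ j, c j` times the indicator
of `lowerRay (t j)`. That function is constant on the cells, so the variance takes the form of the
limit in `tendsto_charFun_normalize`. -/
theorem IsBrownianBridge.integral_cexp {Ω : Type*} [MeasurableSpace Ω] {μ : Measure Ω}
    [IsProbabilityMeasure μ] {H : Measure ℝ} [IsProbabilityMeasure H] {B : EReal → Ω → ℝ}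
    (hB : IsBrownianBridge H lowerRay B μ) {n : ℕ} {T : Finset EReal} {t : Fin n → EReal}
    (ht : ∀ j, t j ∈ T) (c : Fin n → ℝ) :
    ∫ ω, Complex.exp ((∑ j, c j * B (t j) ω : ℝ) * Complex.I) ∂μ =
      Complex.exp (-((∑ k, ((∑ j, c j * leftCell T (t j) k) -
        ∑ l, (∑ j, c j * leftCell T (t j) l) * H.real (rayCell T l)) ^ 2 *
        H.real (rayCell T k)) / 2 : ℝ)) := by
  have hG : HasGaussianLaw (fun ω => ∑ j, c j * B (t j) ω) μ := by
    have := ((hB.gaussian.comp_right t).smul c).hasGaussianLaw_fun_sum (I := Finset.univ)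
    simpa using this
  have hL2 : ∀ j, MemLp (B (t j)) 2 μ := fun j => (hB.gaussian.hasGaussianLaw_eval (t j)).memLp_two
  have hint : ∀ j, Integrable (B (t j)) μ := fun j =>
    (hB.gaussian.hasGaussianLaw_eval (t j)).integrable
  have hmean : ∫ ω, ∑ j, c j * B (t j) ω ∂μ = 0 := by
    rw [integral_finsetSum _ fun j _ => (hint j).const_mul _]
    simp [integral_const_mul, hB.mean]
  have hvar : Var[fun ω => ∑ j, c j * B (t j) ω; μ] =
      ∑ k, ((∑ j, c j * leftCell T (t j) k) -
        ∑ l, (∑ j, c j * leftCell T (t j) l) * H.real (rayCell T l)) ^ 2 *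
        H.real (rayCell T k) := by
    have hsum : ∑ k, H.real (rayCell T k) = 1 := by
      rw [← measureReal_iUnion_fintype (pairwise_disjoint_rayCell T) (measurableSet_rayCell T),
        iUnion_rayCell, probReal_univ]
    rw [← covariance_self hG.aemeasurable, covariance_fun_sum_fun_sum
      (fun j => (hL2 j).const_mul (c j)) fun j => (hL2 j).const_mul (c j)]
    simp_rw [covariance_const_mul_left, covariance_const_mul_right, hB.cov]
    set g : Fin (T.card + 1) → ℝ := fun k => ∑ j, c j * leftCell T (t j) k with hg
    set m := ∑ l, g l * H.real (rayCell T l) with hm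
    have e1 : ∑ k, (g k - m) ^ 2 * H.real (rayCell T k) =
        ∑ k, g k ^ 2 * H.real (rayCell T k) - m * m := by
      have : ∀ k, (g k - m) ^ 2 * H.real (rayCell T k) = g k ^ 2 * H.real (rayCell T k) -
          2 * m * (g k * H.real (rayCell T k)) + m ^ 2 * H.real (rayCell T k) := fun k => by ring
      simp_rw [this, Finset.sum_add_distrib, Finset.sum_sub_distrib, ← Finset.mul_sum]
      rw [← hm, hsum]
      ring
    have e2 : m = ∑ j, c j * H.real (lowerRay (t j)) := by
      rw [hm]
      simp_rw [hg, Finset.sum_mul]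
      rw [Finset.sum_comm]
      refine Finset.sum_congr rfl fun j _ => ?_
      rw [real_lowerRay (ht j) H, Finset.mul_sum]
      exact Finset.sum_congr rfl fun k _ => by ring
    have e3 : ∑ k, g k ^ 2 * H.real (rayCell T k) =
        ∑ i, ∑ j, c i * (c j * H.real (lowerRay (t i) ∩ lowerRay (t j))) := by
      have : ∀ k, g k ^ 2 * H.real (rayCell T k) = ∑ i, ∑ j, c i * (c j *
          (leftCell T (t i) k * leftCell T (t j) k * H.real (rayCell T k))) := fun k => by
        rw [sq, hg, Finset.sum_mul_sum, Finset.sum_mul]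
        refine Finset.sum_congr rfl fun i _ => ?_
        rw [Finset.sum_mul]
        exact Finset.sum_congr rfl fun j _ => by ring
      simp_rw [this]
      rw [Finset.sum_comm]
      refine Finset.sum_congr rfl fun i _ => ?_
      rw [Finset.sum_comm]
      refine Finset.sum_congr rfl fun j _ => ?_
      rw [real_lowerRay_inter (ht i) (ht j) H, Finset.mul_sum, Finset.mul_sum]
    rw [e1, e3, e2, Finset.sum_mul_sum, ← Finset.sum_sub_distrib]
    refine Finset.sum_congr rfl fun i _ => ?_
    rw [← Finset.sum_sub_distrib]
    exact Finset.sum_congr rfl fun j _ => by ring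
  have h1 := hG.map_eq_gaussianReal
  have h2 := charFun_gaussianReal (μ := μ[fun ω => ∑ j, c j * B (t j) ω])
    (v := Var[fun ω => ∑ j, c j * B (t j) ω; μ].toNNReal) 1
  rw [← h1, charFun_apply_real, integral_map hG.aemeasurable (by fun_prop), hmean,
    Real.coe_toNNReal _ (variance_nonneg _ _), hvar] at h2
  simp only [Complex.ofReal_one, one_mul, Complex.ofReal_zero, mul_zero, zero_mul, zero_sub,
    one_pow, mul_one] at h2
  rw [h2]
  congr 1
  push_cast
  rfl

theorem measurable_scaledPath_apply {Ω : Type*} [MeasurableSpace Ω] (a : ℝ) (H : Measure ℝ)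
    [IsProbabilityMeasure H] (P : Kernel Ω ℝ) [IsMarkovKernel P] (t : EReal) :
    Measurable fun ω => scaledPath a H (P ω) t := by
  have : Measurable fun ω => (P ω).real (lowerRay t) :=
    (P.measurable_coe (measurableSet_lowerRay t)).ennreal_toReal
  simp only [scaledPath]
  fun_prop

theorem isCountablyGenerated_atTop_Ioi :
    (atTop : Filter (Set.Ioi (0 : ℝ))).IsCountablyGenerated := by
  rw [atTop_Ioi_eq]
  infer_instance

/-- Lévy's continuity theorem, applied along sequences `a k → ∞` and on Euclidean space, where the
characteristic function lives. -/
theorem tendsto_integral_fdd {H : Measure ℝ} [IsProbabilityMeasure H]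
    {Ω : Set.Ioi (0 : ℝ) → Type*} [∀ a, MeasurableSpace (Ω a)] {μ : ∀ a, Measure (Ω a)}
    [∀ a, IsProbabilityMeasure (μ a)] {P : ∀ a, Kernel (Ω a) ℝ} [∀ a, IsMarkovKernel (P a)]
    (hP : ∀ a : Set.Ioi (0 : ℝ), IsNIGProcess (a : ℝ) H (P a) (μ a))
    {Ω' : Type*} [MeasurableSpace Ω'] {μ' : Measure Ω'} [IsProbabilityMeasure μ']
    {B : EReal → Ω' → ℝ} (hB : IsBrownianBridge H lowerRay B μ') {n : ℕ} (t : Fin n → EReal)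
    (f : BoundedContinuousFunction (Fin n → ℝ) ℝ) :
    Tendsto (fun a : Set.Ioi (0 : ℝ) => ∫ ω, f (fun j => scaledPath a H (P a ω) (t j)) ∂μ a) atTop
      (𝓝 (∫ ω, f (fun j => B (t j) ω) ∂μ')) := by
  classical
  have := isCountablyGenerated_atTop_Ioi
  refine tendsto_of_seq_tendsto fun a ha => ?_
  have hXm : ∀ a : Set.Ioi (0 : ℝ), Measurable fun ω =>
      WithLp.toLp 2 fun j => scaledPath a H (P a ω) (t j) := fun a =>
    (WithLp.measurable_toLp 2 _).comp
      (measurable_pi_lambda _ fun j => measurable_scaledPath_apply _ H (P a) (t j))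
  have hBm : AEMeasurable (fun ω => WithLp.toLp 2 fun j => B (t j) ω) μ' :=
    (WithLp.measurable_toLp 2 _).comp_aemeasurable
      (aemeasurable_pi_lambda _ fun j => hB.gaussian.aemeasurable (t j))
  let ν : ℕ → ProbabilityMeasure (EuclideanSpace ℝ (Fin n)) := fun k =>
    ⟨(μ (a k)).map _, Measure.isProbabilityMeasure_map (hXm (a k)).aemeasurable⟩
  let ν' : ProbabilityMeasure (EuclideanSpace ℝ (Fin n)) :=
    ⟨μ'.map _, Measure.isProbabilityMeasure_map hBm⟩
  have hinner : ∀ (x : Fin n → ℝ) (c : EuclideanSpace ℝ (Fin n)),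
      inner ℝ (WithLp.toLp 2 x : EuclideanSpace ℝ (Fin n)) c = ∑ j, c j * x j := fun x c => by
    simp [PiLp.inner_apply]
  have hν : Tendsto ν atTop (𝓝 ν') := by
    refine ProbabilityMeasure.tendsto_of_tendsto_charFun fun c => ?_
    set T := Finset.univ.image t with hT
    have ht : ∀ j, t j ∈ T := fun j => Finset.mem_image_of_mem _ (Finset.mem_univ j)
    have hsum : ∑ k, H.real (rayCell T k) = 1 := by
      rw [← measureReal_iUnion_fintype (pairwise_disjoint_rayCell T) (measurableSet_rayCell T),
        iUnion_rayCell, probReal_univ]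
    have e1 : ∀ k, charFun (ν k : Measure (EuclideanSpace ℝ (Fin n))) c =
        ∫ z, Complex.exp ((√(a k : ℝ) * ∑ l, (∑ j, c j * leftCell T (t j) l) *
        (normalize z l - H.real (rayCell T l)) : ℝ) * Complex.I)
        ∂Measure.pi fun l => igLaw ((a k : ℝ) * H.real (rayCell T l)) := fun k => by
      rw [← (hP (a k)).integral_cexp (a k).2 ht c, charFun_apply]
      change ∫ x, _ ∂(μ (a k)).map _ = _
      rw [integral_map (hXm (a k)).aemeasurable (by fun_prop)]
      simp_rw [hinner]
    have e2 : charFun (ν' : Measure (EuclideanSpace ℝ (Fin n))) c =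
        Complex.exp (-((∑ k, ((∑ j, c j * leftCell T (t j) k) -
        ∑ l, (∑ j, c j * leftCell T (t j) l) * H.real (rayCell T l)) ^ 2 *
        H.real (rayCell T k)) / 2 : ℝ)) := by
      rw [← hB.integral_cexp ht c, charFun_apply]
      change ∫ x, _ ∂μ'.map _ = _
      rw [integral_map hBm (by fun_prop)]
      simp_rw [hinner]
    simp_rw [e1, e2]
    refine (tendsto_charFun_normalize (fun k => measureReal_nonneg) hsum
      fun l => ∑ j, c j * leftCell T (t j) l).comp ?_
    exact (tendsto_comp_val_Ioi_atTop (f := id)).2 tendsto_id |>.comp ha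
  have hf : Continuous (WithLp.ofLp : EuclideanSpace ℝ (Fin n) → Fin n → ℝ) := by fun_prop
  have h := ProbabilityMeasure.tendsto_iff_forall_integral_tendsto.1 hν
    (f.compContinuous ⟨_, hf⟩)
  have e3 : ∀ k, ∫ x, (f.compContinuous ⟨_, hf⟩) x ∂(ν k : Measure (EuclideanSpace ℝ (Fin n))) =
      ∫ ω, f (fun j => scaledPath (a k) H (P (a k) ω) (t j)) ∂μ (a k) := fun k =>
    integral_map (hXm (a k)).aemeasurable
      (f.compContinuous ⟨_, hf⟩).continuous.measurable.aestronglyMeasurable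
  have e4 : ∫ x, (f.compContinuous ⟨_, hf⟩) x ∂(ν' : Measure (EuclideanSpace ℝ (Fin n))) =
      ∫ ω, f (fun j => B (t j) ω) ∂μ' :=
    integral_map hBm (f.compContinuous ⟨_, hf⟩).continuous.measurable.aestronglyMeasurable
  rw [e4] at h
  simp_rw [e3] at h
  exact h

/-! ### Evaluations on the Skorokhod space -/

theorem edist_eq_skorokhodEDist (x y : Cadlag) : edist x y = skorokhodEDist x y := rfl

theorem Cadlag.exists_timeChange {x y : Cadlag} {ε : ENNReal} (h : edist x y < ε) :
    ∃ σ : EReal ≃o EReal, (∀ t, edist (compress (σ t)) (compress t) < ε) ∧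
      ∀ t, edist (x (σ t)) (y t) < ε := by
  rw [edist_eq_skorokhodEDist, skorokhodEDist, iInf_lt_iff] at h
  obtain ⟨σ, hσ⟩ := h
  rw [timeChangeCost, max_lt_iff] at hσ
  exact ⟨σ, fun t => (le_iSup (fun t => edist (compress (σ t)) (compress t)) t).trans_lt hσ.1,
    fun t => (le_iSup (fun t => edist (x (σ t)) (y t)) t).trans_lt hσ.2⟩

theorem Cadlag.edist_le_of_timeChange {x y : Cadlag} {ε : ENNReal} (σ : EReal ≃o EReal)
    (h1 : ∀ t, edist (compress (σ t)) (compress t) ≤ ε) (h2 : ∀ t, edist (x (σ t)) (y t) ≤ ε) :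
    edist x y ≤ ε :=
  (iInf_le _ σ).trans (max_le (iSup_le h1) (iSup_le h2))

theorem Cadlag.edist_le_of_forall {x y : Cadlag} {ε : ENNReal} (h : ∀ t, edist (x t) (y t) ≤ ε) :
    edist x y ≤ ε :=
  Cadlag.edist_le_of_timeChange (OrderIso.refl EReal) (fun t => by simp) h

/-- A time change close to the identity moves the witness `s` so little that it stays in `U`. -/
theorem Cadlag.isOpen_exists_gt {U : Set EReal} (hU : IsOpen U) (c : ℝ) :
    IsOpen {x : Cadlag | ∃ s ∈ U, c < x s} := by
  rw [EMetric.isOpen_iff]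
  rintro x ⟨s, hs, hc⟩
  have hUs : compress.symm ⁻¹' U ∈ 𝓝 (compress s) := by
    refine (hU.preimage compress.symm.continuous).mem_nhds ?_
    simpa using hs
  obtain ⟨ε, hε, hball⟩ := EMetric.mem_nhds_iff.1 hUs
  refine ⟨min ε (ENNReal.ofReal (x s - c)), lt_min hε (by simpa using hc), fun y hy => ?_⟩
  rw [Metric.mem_eball, edist_comm] at hy
  obtain ⟨σ, h1, h2⟩ := Cadlag.exists_timeChange hy
  refine ⟨σ.symm s, ?_, ?_⟩
  · have := h1 (σ.symm s)
    rw [OrderIso.apply_symm_apply, edist_comm] at this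
    have := hball (Metric.mem_eball.2 (this.trans_le (min_le_left _ _)))
    simpa using this
  · have := (h2 (σ.symm s)).trans_le (min_le_right _ _)
    rw [OrderIso.apply_symm_apply, edist_dist, ENNReal.ofReal_lt_ofReal_iff (by linarith),
      Real.dist_eq] at this
    linarith [(abs_lt.1 this).2]

/-- The end point `⊤` is fixed by all time changes, so evaluation there is Lipschitz. Elsewhere
evaluation need not be continuous, but by right continuity `x t < c` says that `x ≤ q` just to the
right of `t` for some rational `q < c`, a countable union of closed conditions. -/
theorem Cadlag.measurable_apply (t : EReal) : Measurable fun x : Cadlag => x t := by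
  by_cases ht : t = ⊤
  · subst ht
    refine (LipschitzWith.continuous (K := 1) fun x y => ?_).measurable
    rw [ENNReal.coe_one, one_mul]
    refine le_of_forall_gt fun c hc => ?_
    obtain ⟨σ, -, h⟩ := Cadlag.exists_timeChange hc
    simpa using h ⊤
  have hlt : t < ⊤ := lt_top_iff_ne_top.2 ht
  obtain ⟨u, -, hu, hlim⟩ := exists_seq_strictAnti_tendsto' hlt
  refine measurable_of_Iio fun c => ?_
  have : (fun x : Cadlag => x t) ⁻¹' Set.Iio c = ⋃ (q : {q : ℚ // (q : ℝ) < c}), ⋃ n,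
      {x : Cadlag | ∃ s ∈ Set.Ioo t (u n), (q : ℝ) < x s}ᶜ := by
    ext x
    simp only [Set.mem_preimage, Set.mem_Iio, Set.mem_iUnion, Set.mem_compl_iff,
      Set.mem_ofPred_eq, not_exists, not_and, not_lt, Subtype.exists, exists_prop]
    constructor
    · intro hx
      obtain ⟨q, hq1, hq2⟩ := exists_rat_btwn hx
      refine ⟨q, hq2, ?_⟩
      have h1 : ∀ᶠ s in 𝓝[≥] t, x s < q := (x.right_continuous t).eventually_lt_const hq1
      obtain ⟨b, hb, hsub⟩ := (mem_nhdsGE_iff_exists_Ico_subset' hlt).1 h1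
      obtain ⟨n, hn⟩ := (hlim.eventually_lt_const hb).exists
      exact ⟨n, fun s hs => (hsub ⟨hs.1.le, hs.2.trans hn⟩).le⟩
    · rintro ⟨q, hq, n, h⟩
      refine lt_of_le_of_lt ?_ hq
      have hr : Tendsto x (𝓝[>] t) (𝓝 (x t)) :=
        (x.right_continuous t).mono_left (nhdsWithin_mono _ Set.Ioi_subset_Ici_self)
      have : (𝓝[>] t).NeBot := nhdsGT_neBot_of_exists_gt ⟨⊤, hlt⟩
      refine le_of_tendsto hr ?_
      filter_upwards [Ioo_mem_nhdsGT (hu n).1] with s hs using h s hs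
  rw [this]
  exact MeasurableSet.iUnion fun q => MeasurableSet.iUnion fun n =>
    (Cadlag.isOpen_exists_gt isOpen_Ioo _).measurableSet.compl

/-! ### Step paths -/

theorem findGreatest_congr {p p' : ℕ → Prop} [DecidablePred p] [DecidablePred p'] {n : ℕ}
    (h : ∀ i ≤ n, p i ↔ p' i) : Nat.findGreatest p n = Nat.findGreatest p' n := by
  induction n with
  | zero => simp
  | succ n ih =>
    rw [Nat.findGreatest_succ, Nat.findGreatest_succ, ih fun i hi => h i (hi.trans n.le_succ)]
    simp only [h (n + 1) le_rfl]

/-- The index of the last of the points `q 0, …, q n` that is at most `t`. -/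
def lastIndex (q : ℕ → EReal) (n : ℕ) (t : EReal) : ℕ := Nat.findGreatest (fun i => q i ≤ t) n

theorem lastIndex_le (q : ℕ → EReal) (n : ℕ) (t : EReal) : lastIndex q n t ≤ n :=
  Nat.findGreatest_le n

theorem lastIndex_eventually_right (q : ℕ → EReal) (n : ℕ) (t : EReal) :
    ∀ᶠ s in 𝓝[≥] t, lastIndex q n s = lastIndex q n t := by
  have h : ∀ i ∈ Finset.range (n + 1), ∀ᶠ s in 𝓝[≥] t, (q i ≤ s ↔ q i ≤ t) := by
    intro i _
    by_cases hi : q i ≤ t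
    · filter_upwards [self_mem_nhdsWithin] with s hs
      exact iff_of_true (hi.trans hs) hi
    · filter_upwards [nhdsWithin_le_nhds (Iio_mem_nhds (not_le.1 hi))] with s hs
      exact iff_of_false (not_le.2 hs) hi
  filter_upwards [(Finset.eventually_all _).2 h] with s hs
  exact findGreatest_congr fun i hi => hs i (Finset.mem_range.2 (Nat.lt_succ_of_le hi))

theorem lastIndex_eventually_left (q : ℕ → EReal) (n : ℕ) (t : EReal) :
    ∃ j, ∀ᶠ s in 𝓝[<] t, lastIndex q n s = j := by
  have h : ∀ i ∈ Finset.range (n + 1), ∀ᶠ s in 𝓝[<] t, (q i ≤ s ↔ q i < t) := by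
    intro i _
    by_cases hi : q i < t
    · filter_upwards [nhdsWithin_le_nhds (Ioi_mem_nhds hi)] with s hs
      exact iff_of_true (le_of_lt hs) hi
    · filter_upwards [self_mem_nhdsWithin] with s hs
      exact iff_of_false (fun h => hi (h.trans_lt hs)) hi
  refine ⟨Nat.findGreatest (fun i => q i < t) n, ?_⟩
  filter_upwards [(Finset.eventually_all _).2 h] with s hs
  exact findGreatest_congr fun i hi => hs i (Finset.mem_range.2 (Nat.lt_succ_of_le hi))

/-- The step path with the value `y i` from `q i` on. -/
def stepPath (q : ℕ → EReal) (n : ℕ) (y : Fin (n + 1) → ℝ) : Cadlag where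
  toFun t := y ⟨lastIndex q n t, Nat.lt_succ_of_le (lastIndex_le q n t)⟩
  right_continuous t := by
    refine tendsto_const_nhds.congr' ?_
    filter_upwards [lastIndex_eventually_right q n t] with s hs
    simp only [hs]
  left_limit t := by
    obtain ⟨j, hj⟩ := lastIndex_eventually_left q n t
    by_cases h : j < n + 1
    · refine ⟨y ⟨j, h⟩, tendsto_const_nhds.congr' ?_⟩
      filter_upwards [hj] with s hs
      simp only [hs]
    · refine ⟨0, tendsto_const_nhds.congr' ?_⟩
      filter_upwards [hj] with s hs
      exact absurd (Nat.lt_succ_of_le (hs ▸ lastIndex_le q n s)) h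

theorem lipschitzWith_stepPath (q : ℕ → EReal) (n : ℕ) : LipschitzWith 1 (stepPath q n) := by
  intro y z
  rw [ENNReal.coe_one, one_mul]
  exact Cadlag.edist_le_of_forall fun t => edist_le_pi_edist y z _

/-- The step path that agrees with `x` at the points `q 0, …, q n`. -/
def Cadlag.sample (x : Cadlag) (q : ℕ → EReal) (n : ℕ) : Cadlag :=
  stepPath q n fun i => x (q i)

theorem Cadlag.sample_apply (x : Cadlag) (q : ℕ → EReal) (n : ℕ) (t : EReal) :
    x.sample q n t = x (q (lastIndex q n t)) := rfl

theorem Cadlag.measurable_sample {Ω : Type*} [MeasurableSpace Ω] {X : Ω → Cadlag}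
    (hX : ∀ t, Measurable fun ω => X ω t) (q : ℕ → EReal) (n : ℕ) :
    Measurable fun ω => (X ω).sample q n :=
  (lipschitzWith_stepPath q n).continuous.measurable.comp
    (measurable_pi_lambda _ fun i => hX (q i))

/-! ### Approximation by step paths -/

/-- A càdlàg function oscillates little on the cells of some finite partition. -/
theorem Cadlag.exists_partition (x : Cadlag) {ε : ℝ} (hε : 0 < ε) :
    ∃ (r : ℕ) (u : ℕ → EReal), u 0 = ⊥ ∧ u r = ⊤ ∧ (∀ i < r, u i < u (i + 1)) ∧
      ∀ i < r, ∀ s, u i ≤ s → s < u (i + 1) → |x s - x (u i)| < ε := by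
  -- Times up to which a partition exists. The left limit at `sSup S` shows that the supremum
  -- belongs to `S`, and right continuity would extend the partition beyond it unless it is `⊤`.
  let S : Set EReal := {t | ∃ (r : ℕ) (u : ℕ → EReal), u 0 = ⊥ ∧ u r = t ∧
    (∀ i < r, u i < u (i + 1)) ∧
      ∀ i < r, ∀ s, u i ≤ s → s < u (i + 1) → |x s - x (u i)| < ε}
  have hstep : ∀ t ∈ S, ∀ t', t < t' → (∀ s, t ≤ s → s < t' → |x s - x t| < ε) → t' ∈ S := by
    rintro t ⟨r, u, h0, hr, hlt, hosc⟩ t' htt' hs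
    refine ⟨r + 1, fun i => if i ≤ r then u i else t', by simpa using h0, by simp, ?_, ?_⟩
    · intro i hi
      rcases (Nat.lt_succ_iff.1 hi).eq_or_lt with rfl | h
      · simpa [hr] using htt'
      · simpa [h.le, Nat.succ_le_of_lt h] using hlt i h
    · intro i hi
      rcases (Nat.lt_succ_iff.1 hi).eq_or_lt with rfl | h
      · simpa [hr] using hs
      · simpa [h.le, Nat.succ_le_of_lt h] using hosc i h
  have hbot : (⊥ : EReal) ∈ S := ⟨0, fun _ => ⊥, rfl, rfl, by simp, by simp⟩
  set τ := sSup S with hτ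
  have hτS : τ ∈ S := by
    obtain ⟨l, hl⟩ := x.left_limit τ
    by_cases hb : τ = ⊥
    · rwa [hb]
    have h1 : ∀ᶠ s in 𝓝[<] τ, |x s - l| < ε / 2 := by
      have := hl.eventually (Metric.ball_mem_nhds l (half_pos hε))
      simpa [Real.dist_eq] using this
    obtain ⟨b, hb', hsub⟩ := (mem_nhdsLT_iff_exists_Ioo_subset' (bot_lt_iff_ne_bot.2 hb)).1 h1
    obtain ⟨s, hsS, hbs⟩ := exists_lt_of_lt_csSup ⟨⊥, hbot⟩ hb'
    rcases (le_sSup hsS).eq_or_lt with h | h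
    · rwa [hτ, ← h]
    · refine hstep s hsS τ h fun t hst htτ => ?_
      have a1 : |x t - l| < ε / 2 := hsub ⟨hbs.trans_le hst, htτ⟩
      have a2 : |x s - l| < ε / 2 := hsub ⟨hbs, h⟩
      rw [abs_lt] at *
      constructor <;> linarith
  have hτtop : τ = ⊤ := by
    by_contra h
    have hlt : τ < ⊤ := lt_top_iff_ne_top.2 h
    have h1 : ∀ᶠ s in 𝓝[≥] τ, |x s - x τ| < ε := by
      have := (x.right_continuous τ).eventually (Metric.ball_mem_nhds _ hε)
      simpa [Real.dist_eq] using this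
    obtain ⟨b, hb, hsub⟩ := (mem_nhdsGE_iff_exists_Ico_subset' hlt).1 h1
    exact absurd (le_sSup (hstep τ hτS b hb fun s hs hsb => hsub ⟨hs, hsb⟩)) (not_le.2 hb)
  rw [hτtop] at hτS
  exact hτS

/-- A piecewise linear increasing bijection of `[0,1]` with prescribed knots. -/
theorem exists_orderIso_knots {r : ℕ} {U V : ℕ → ℝ} (hU0 : U 0 = 0) (hUr : U r = 1)
    (hV0 : V 0 = 0) (hVr : V r = 1) (hU : ∀ i < r, U i < U (i + 1))
    (hV : ∀ i < r, V i < V (i + 1)) :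
    ∃ σ : Set.Icc (0 : ℝ) 1 ≃o Set.Icc (0 : ℝ) 1,
      (∀ i ≤ r, ∀ h, (σ ⟨V i, h⟩ : ℝ) = U i) ∧
      ∀ t, |(σ t : ℝ) - t| ≤
        ∑ i ∈ Finset.range r, |(U (i + 1) - U i) - (V (i + 1) - V i)| := by
  -- For `t` in `[0,1]`, `c i t` is the length of the part of the cell `[V i, V (i + 1)]` to the
  -- left of `t`. These lengths sum to `t`; weighting them by the slopes `m i` gives the map, and
  -- each cell contributes at most its change of length to the displacement.
  let c : ℕ → ℝ → ℝ := fun i t => min (max t (V i)) (V (i + 1)) - V i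
  let m : ℕ → ℝ := fun i => (U (i + 1) - U i) / (V (i + 1) - V i)
  let f : ℝ → ℝ := fun t => ∑ i ∈ Finset.range r, m i * c i t
  have hm : ∀ i < r, 0 < m i := fun i hi =>
    div_pos (sub_pos.2 (hU i hi)) (sub_pos.2 (hV i hi))
  have hcmono : ∀ i, Monotone (c i) := fun i s t hst => by
    simp only [c]
    gcongr
  have hc0 : ∀ i t, t ≤ V i → i < r → c i t = 0 := fun i t h hi => by
    simp [c, max_eq_right h, min_eq_left (hV i hi).le]
  have hc1 : ∀ i t, V (i + 1) ≤ t → c i t = V (i + 1) - V i := fun i t h => by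
    simp [c, min_eq_right (h.trans (le_max_left t (V i)))]
  have hcsum : ∀ n ≤ r, ∀ t, 0 ≤ t → ∑ i ∈ Finset.range n, c i t = min t (V n) := by
    intro n
    induction n with
    | zero => intro _ t ht; simp [hV0, ht]
    | succ n ih =>
      intro hn t ht
      rw [Finset.sum_range_succ, ih (Nat.le_of_succ_le hn) t ht]
      have := hV n hn
      rcases le_total t (V n) with h | h
      · rw [hc0 n t h hn, min_eq_left h, min_eq_left (h.trans this.le), add_zero]
      · simp only [c]
        rw [min_eq_right h, max_eq_left h]
        ring
  have hid : ∀ t, 0 ≤ t → t ≤ 1 → ∑ i ∈ Finset.range r, c i t = t := fun t h0 h1 => by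
    rw [hcsum r le_rfl t h0, hVr, min_eq_left h1]
  have hVmono : ∀ j ≤ r, ∀ i ≤ j, V i ≤ V j := by
    intro j hj i hij
    induction j, hij using Nat.le_induction with
    | base => exact le_rfl
    | succ j _ ih => exact (ih (Nat.le_of_succ_le hj)).trans (hV j hj).le
  have hknot : ∀ j ≤ r, f (V j) = U j := by
    intro j hj
    have h1 : ∀ n ≤ j, ∑ i ∈ Finset.range n, m i * c i (V j) = U n := by
      intro n
      induction n with
      | zero => intro _; simp [hU0]
      | succ n ih =>
        intro hn
        rw [Finset.sum_range_succ, ih (Nat.le_of_succ_le hn), hc1 n _ (hVmono j hj _ hn)]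
        have := sub_pos.2 (hV n (Nat.lt_of_lt_of_le hn hj))
        simp only [m]
        field_simp
        ring
    have h2 : ∀ n, j ≤ n → n ≤ r → ∑ i ∈ Finset.range n, m i * c i (V j) = U j := by
      intro n hjn
      induction n, hjn using Nat.le_induction with
      | base => intro _; exact h1 j le_rfl
      | succ n hn ih =>
        intro hnr
        rw [Finset.sum_range_succ, ih (Nat.le_of_succ_le hnr),
          hc0 n _ (hVmono n (Nat.le_of_succ_le hnr) j hn) hnr, mul_zero, add_zero]
    exact h2 r hj le_rfl
  have hfmono : Monotone f := fun s t hst =>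
    Finset.sum_le_sum fun i hi =>
      mul_le_mul_of_nonneg_left (hcmono i hst) (hm i (Finset.mem_range.1 hi)).le
  have hf0 : f 0 = 0 := by rw [← hV0, hknot 0 (Nat.zero_le r), hU0, hV0]
  have hf1 : f 1 = 1 := by rw [← hVr, hknot r le_rfl, hUr, hVr]
  have hstrict : ∀ s t, 0 ≤ s → s < t → t ≤ 1 → f s < f t := by
    intro s t hs hst ht
    refine Finset.sum_lt_sum (fun i hi =>
      mul_le_mul_of_nonneg_left (hcmono i hst.le) (hm i (Finset.mem_range.1 hi)).le) ?_
    -- If no term increased strictly, no length `c i` would, although their sum grows from `s` to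
    -- `t`.
    by_contra! h
    have : ∑ i ∈ Finset.range r, c i t ≤ ∑ i ∈ Finset.range r, c i s :=
      Finset.sum_le_sum fun i hi => le_of_mul_le_mul_left (h i hi) (hm i (Finset.mem_range.1 hi))
    rw [hid t (hs.trans hst.le) ht, hid s hs (hst.le.trans ht)] at this
    linarith
  have hcont : Continuous f := by
    simp only [f, c]
    fun_prop
  let g : Set.Icc (0 : ℝ) 1 → Set.Icc (0 : ℝ) 1 := fun t =>
    ⟨f t, hf0.ge.trans (hfmono t.2.1), (hfmono t.2.2).trans hf1.le⟩
  have hg : StrictMono g := fun s t hst => hstrict s t s.2.1 hst t.2.2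
  have hsurj : Function.Surjective g := by
    rintro ⟨y, hy⟩
    rw [← hf0, ← hf1] at hy
    obtain ⟨t, ht, rfl⟩ := intermediate_value_Icc zero_le_one hcont.continuousOn hy
    exact ⟨⟨t, ht⟩, rfl⟩
  refine ⟨hg.orderIsoOfSurjective g hsurj, fun i hi h => hknot i hi, fun t => ?_⟩
  change |f t - t| ≤ _
  have hsub : f t - t = ∑ i ∈ Finset.range r, (m i * c i t - c i t) := by
    rw [Finset.sum_sub_distrib, hid t t.2.1 t.2.2]
  rw [hsub]
  refine (Finset.abs_sum_le_sum_abs _ _).trans (Finset.sum_le_sum fun i hi => ?_)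
  have hV' := sub_pos.2 (hV i (Finset.mem_range.1 hi))
  have hle : c i t ≤ V (i + 1) - V i := sub_le_sub_right (min_le_right _ _) _
  have hnn : 0 ≤ c i t := sub_nonneg.2
    (le_min (le_max_right _ _) (sub_pos.1 hV').le)
  have : m i * c i t - c i t = ((U (i + 1) - U i) - (V (i + 1) - V i)) *
      (c i t / (V (i + 1) - V i)) := by
    simp only [m]
    field_simp
  rw [this, abs_mul]
  refine mul_le_of_le_one_right (abs_nonneg _) ?_
  rw [abs_of_nonneg (div_nonneg hnn hV'.le)]
  exact (div_le_one hV').2 hle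

/-- The points of `[-∞,∞]` that correspond to the multiples of `1 / k` in `[0,1]`. -/
def gridPoint (k j : ℕ) : EReal :=
  compress.symm (Set.projIcc 0 1 zero_le_one ((j : ℝ) / k))

theorem compress_gridPoint {k j : ℕ} (hj : j ≤ k) :
    (compress (gridPoint k j) : ℝ) = (j : ℝ) / k := by
  have h : (j : ℝ) / k ∈ Set.Icc (0 : ℝ) 1 :=
    ⟨by positivity, div_le_one_of_le₀ (by exact_mod_cast hj) (Nat.cast_nonneg k)⟩
  rw [gridPoint, OrderIso.apply_symm_apply, Set.projIcc_of_mem zero_le_one h]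

theorem exists_lt_succ_of_le {V : ℕ → ℝ} {s : ℝ} {r : ℕ} (h0 : V 0 ≤ s) (hr : s < V r) :
    ∃ i < r, V i ≤ s ∧ s < V (i + 1) := by
  induction r with
  | zero => exact absurd hr (not_lt.2 h0)
  | succ r ih =>
    rcases lt_or_ge s (V r) with h | h
    · obtain ⟨i, hi, h'⟩ := ih h
      exact ⟨i, hi.trans r.lt_succ_self, h'⟩
    · exact ⟨r, r.lt_succ_self, h, hr⟩

/-- The jumps of `x` need not lie on the grid. Move each knot of a partition of small oscillation to
a nearby grid point by a time change; then the sampled path and the time-changed path take values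
from the same cell, hence differ by less than `2 * ε`. -/
theorem Cadlag.tendsto_sample_gridPoint (x : Cadlag) :
    Tendsto (fun k => x.sample (gridPoint k) k) atTop (𝓝 x) := by
  refine EMetric.tendsto_nhds.2 fun δ hδ => ?_
  obtain ⟨e, he0, heδ⟩ := ENNReal.lt_iff_exists_nnreal_btwn.1 hδ
  obtain ⟨ε, hε, hεe⟩ : ∃ ε : ℝ, 0 < ε ∧ 2 * ε ≤ e :=
    ⟨e / 2, half_pos (by exact_mod_cast he0), by linarith⟩
  obtain ⟨r, u, hu0, hur, hult, hosc⟩ := x.exists_partition hε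
  let U : ℕ → ℝ := fun i => compress (u i)
  have hU0 : U 0 = 0 := by simp [U, hu0]
  have hUr : U r = 1 := by simp [U, hur]
  have hU : ∀ i < r, U i < U (i + 1) := fun i hi => compress.strictMono (hult i hi)
  have hUI : ∀ i, U i ∈ Set.Icc (0 : ℝ) 1 := fun i => (compress (u i)).2
  have hgap : ∀ᶠ k : ℕ in atTop, ∀ i ∈ Finset.range r, 1 / (k : ℝ) < U (i + 1) - U i :=
    (Finset.eventually_all _).2 fun i hi => tendsto_one_div_atTop_nhds_zero_nat.eventually_lt_const
      (sub_pos.2 (hU i (Finset.mem_range.1 hi)))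
  have hsmall : ∀ᶠ k : ℕ in atTop, r * (1 / (k : ℝ)) < ε := by
    have := tendsto_one_div_atTop_nhds_zero_nat (𝕜 := ℝ).const_mul (r : ℝ)
    rw [mul_zero] at this
    exact this.eventually_lt_const hε
  filter_upwards [hgap, hsmall, eventually_gt_atTop 0] with k hgap hsmall hk
  have hk' : (0 : ℝ) < k := by exact_mod_cast hk
  -- Knots are rounded up: the sample keeps the value of the preceding grid point, so it enters cell
  -- `i` only at the first grid point not before `U i`. Gaps larger than `1 / k` keep the rounded
  -- knots distinct.
  let n : ℕ → ℕ := fun i => ⌈k * U i⌉₊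
  let V : ℕ → ℝ := fun i => n i / k
  have hnk : ∀ i, n i ≤ k := fun i => Nat.ceil_le.2 (mul_le_of_le_one_right hk'.le (hUI i).2)
  have hVlo : ∀ i, U i ≤ V i := fun i => by
    rw [le_div_iff₀ hk', mul_comm]
    exact Nat.le_ceil _
  have hVhi : ∀ i, V i < U i + 1 / k := fun i => by
    have : V i < (k * U i + 1) / k :=
      div_lt_div_of_pos_right (Nat.ceil_lt_add_one (mul_nonneg hk'.le (hUI i).1)) hk'
    refine this.trans_eq ?_
    field_simp
  have hV0 : V 0 = 0 := by simp [V, n, hU0]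
  have hVr : V r = 1 := by simp [V, n, hUr, hk'.ne']
  have hV : ∀ i < r, V i < V (i + 1) := fun i hi => by
    linarith [hVhi i, hVlo (i + 1), hgap i (Finset.mem_range.2 hi)]
  have hVI : ∀ i, V i ∈ Set.Icc (0 : ℝ) 1 := fun i =>
    ⟨by positivity, div_le_one_of_le₀ (by exact_mod_cast hnk i) hk'.le⟩
  obtain ⟨σ, hσknot, hσ⟩ := exists_orderIso_knots hU0 hUr hV0 hVr hU hV
  have hσ' : ∀ t, |(σ t : ℝ) - t| ≤ ε := fun t => by
    refine (hσ t).trans (le_trans (Finset.sum_le_sum (g := fun _ => 1 / (k : ℝ)) fun i _ => ?_) ?_)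
    · rw [abs_le]
      constructor <;> linarith [hVhi i, hVlo i, hVhi (i + 1), hVlo (i + 1)]
    · simpa using hsmall.le
  refine lt_of_le_of_lt ?_ heδ
  rw [edist_comm]
  refine Cadlag.edist_le_of_timeChange (compress.trans (σ.trans compress.symm)) (fun t => ?_)
    fun t => ?_
  · rw [OrderIso.trans_apply, OrderIso.trans_apply, OrderIso.apply_symm_apply, edist_dist]
    refine ENNReal.ofReal_le_of_le_toReal ?_
    rw [Subtype.dist_eq, Real.dist_eq]
    exact (hσ' _).trans (by simpa using by linarith)
  · rw [edist_dist]
    refine ENNReal.ofReal_le_of_le_toReal ?_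
    rw [ENNReal.coe_toReal, Real.dist_eq, Cadlag.sample_apply]
    set j := lastIndex (gridPoint k) k t with hj
    have hq0 : gridPoint k 0 ≤ t := by
      have : gridPoint k 0 = ⊥ := compress.injective (Subtype.ext (by
        rw [compress_gridPoint (Nat.zero_le k)]; simp))
      rw [this]
      exact bot_le
    have hjt : gridPoint k j ≤ t :=
      Nat.findGreatest_spec (P := fun i => gridPoint k i ≤ t) (Nat.zero_le k) hq0
    have hjk : j ≤ k := lastIndex_le _ _ _
    have hmax : ∀ i ≤ k, gridPoint k i ≤ t → i ≤ j := fun i hi h =>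
      Nat.le_findGreatest (P := fun i => gridPoint k i ≤ t) hi h
    rcases lt_or_ge (compress t : ℝ) (V r) with ht | ht
    · obtain ⟨i, hi, h1, h2⟩ := exists_lt_succ_of_le (hV0.trans_le (compress t).2.1) ht
      have hw : u i ≤ gridPoint k j ∧ gridPoint k j < u (i + 1) := by
        have a1 : n i ≤ j := hmax _ (hnk i) (compress.le_iff_le.1 (Subtype.coe_le_coe.1 (by
          rwa [compress_gridPoint (hnk i)])))
        have a2 : (j : ℝ) / k < n (i + 1) / k := by
          rw [← compress_gridPoint hjk]
          exact lt_of_le_of_lt (Subtype.coe_le_coe.2 (compress.monotone hjt)) h2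
        have a3 : j < n (i + 1) := by
          rw [div_lt_div_iff_of_pos_right hk'] at a2
          exact_mod_cast a2
        constructor
        · refine compress.le_iff_le.1 (Subtype.coe_le_coe.1 ?_)
          rw [compress_gridPoint hjk]
          refine (hVlo i).trans (div_le_div_of_nonneg_right (by exact_mod_cast a1) hk'.le)
        · refine compress.lt_iff_lt.1 (Subtype.coe_lt_coe.1 ?_)
          rw [compress_gridPoint hjk, div_lt_iff₀ hk', mul_comm]
          exact Nat.lt_ceil.1 a3
      have hs : u i ≤ compress.symm (σ (compress t)) ∧
          compress.symm (σ (compress t)) < u (i + 1) := by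
        rw [OrderIso.le_symm_apply, OrderIso.symm_apply_lt]
        constructor
        · refine Subtype.coe_le_coe.1 (le_trans (hσknot i hi.le (hVI i)).ge ?_)
          exact Subtype.coe_le_coe.2 (σ.monotone (Subtype.coe_le_coe.1 h1))
        · refine Subtype.coe_lt_coe.1 (lt_of_lt_of_le ?_ (hσknot (i + 1) hi (hVI _)).le)
          exact Subtype.coe_lt_coe.2 (σ.strictMono (Subtype.coe_lt_coe.1 h2))
      have b1 := hosc i hi _ hw.1 hw.2
      have b2 := hosc i hi _ hs.1 hs.2
      rw [OrderIso.trans_apply, OrderIso.trans_apply]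
      rw [abs_lt] at b1 b2
      rw [abs_le]
      constructor <;> linarith
    · have htop : t = ⊤ := by
        refine compress.injective (Subtype.ext (le_antisymm ?_ ?_))
        · exact Subtype.coe_le_coe.2 (compress.monotone le_top)
        · simpa [hVr] using ht
      have : gridPoint k j = ⊤ := by
        have hkk : k ≤ j := hmax k le_rfl (htop ▸ le_top)
        refine compress.injective (Subtype.ext ?_)
        rw [compress_gridPoint hjk, le_antisymm hjk hkk]
        simp [hk'.ne']
      rw [this, htop]
      simp only [OrderIso.map_top, sub_self, abs_zero]
      exact e.2

/-- A random càdlàg path is a random element of the Skorokhod space. -/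
theorem Cadlag.measurable_of_apply {Ω : Type*} [MeasurableSpace Ω] {X : Ω → Cadlag}
    (hX : ∀ t, Measurable fun ω => X ω t) : Measurable X :=
  measurable_of_tendsto_metrizable (fun k => Cadlag.measurable_sample hX (gridPoint k) k)
    (tendsto_pi_nhds.2 fun ω => (X ω).tendsto_sample_gridPoint)

/-! ### Oscillation between quantiles -/

/-- Except with probability at most `δ`, the process `X` stays within `δ` of its values at the
`N`-quantiles of `H`. -/
def HasQuantileModulus {Ω : Type*} [MeasurableSpace Ω] (H : Measure ℝ) (N : ℕ) (δ : ℝ)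
    (X : EReal → Ω → ℝ) (μ : Measure Ω) : Prop :=
  ∀ T : Finset EReal, μ {ω | ∃ t ∈ T, δ ≤ |X t ω - X (lastQuantile H N t) ω|} ≤ ENNReal.ofReal δ

theorem lastQuantile_eq {H : Measure ℝ} {N i : ℕ} {t : EReal} (hi : i ≤ N)
    (h1 : quantile H N i ≤ t) (h2 : t < quantile H N (i + 1)) :
    lastQuantile H N t = quantile H N i := by
  rw [lastQuantile, Nat.findGreatest_eq_iff.2 ⟨hi, fun _ => h1, fun j hj _ => ?_⟩]
  exact not_le.2 (h2.trans_le (quantile_mono H N hj))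

theorem lastQuantile_eq_of_le {H : Measure ℝ} {N : ℕ} (hN : 0 < N) {s t : EReal}
    (h1 : lastQuantile H N t ≤ s) (h2 : s ≤ t) : lastQuantile H N s = lastQuantile H N t := by
  rcases lastQuantile_spec H hN t with ⟨rfl, h⟩ | ⟨i, hi, h, -, h'⟩
  · rw [h, top_le_iff] at h1
    rw [h1]
  · rw [h] at h1 ⊢
    exact lastQuantile_eq hi.le h1 (h2.trans_lt h')

theorem lastQuantile_le (H : Measure ℝ) {N : ℕ} (hN : 0 < N) (t : EReal) :
    lastQuantile H N t ≤ t := by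
  rcases lastQuantile_spec H hN t with ⟨rfl, h⟩ | ⟨i, -, h, h', -⟩
  · exact h.le
  · exact h.trans_le h'

/-- A union bound over the `N` blocks. The time `⊤` is its own last quantile and contributes
nothing. -/
theorem hasQuantileModulus_of_block {Ω : Type*} [MeasurableSpace Ω] {H : Measure ℝ} {N : ℕ}
    (hN : 0 < N) {δ b : ℝ} (hδ : 0 < δ) (hb : N * b ≤ δ) {X : EReal → Ω → ℝ} {μ : Measure Ω}
    (h : ∀ i < N, ∀ T : Finset EReal, quantile H N i ∈ T → (∀ t ∈ T, quantile H N i ≤ t) →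
      (∀ t ∈ T, t < quantile H N (i + 1)) →
      μ {ω | ∃ t ∈ T, δ ≤ |X t ω - X (quantile H N i) ω|} ≤ ENNReal.ofReal b) :
    HasQuantileModulus H N δ X μ := by
  intro T
  let E : ℕ → Set Ω := fun i => {ω | ∃ t ∈ T, (quantile H N i ≤ t ∧ t < quantile H N (i + 1)) ∧
    δ ≤ |X t ω - X (quantile H N i) ω|}
  have hE : ∀ i ∈ Finset.range N, μ (E i) ≤ ENNReal.ofReal b := by
    intro i hi
    rcases lt_or_ge (quantile H N i) (quantile H N (i + 1)) with hlt | hge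
    · refine (measure_mono ?_).trans (h i (Finset.mem_range.1 hi) (insert (quantile H N i)
        (T.filter fun t => quantile H N i ≤ t ∧ t < quantile H N (i + 1)))
        (Finset.mem_insert_self _ _) ?_ ?_)
      · rintro ω ⟨t, ht, htb, hX⟩
        exact ⟨t, Finset.mem_insert_of_mem (Finset.mem_filter.2 ⟨ht, htb⟩), hX⟩
      · intro t ht
        rcases Finset.mem_insert.1 ht with rfl | ht
        · exact le_rfl
        · exact (Finset.mem_filter.1 ht).2.1
      · intro t ht
        rcases Finset.mem_insert.1 ht with rfl | ht
        · exact hlt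
        · exact (Finset.mem_filter.1 ht).2.2
    · have : E i = ∅ := Set.eq_empty_of_forall_notMem fun ω ⟨t, _, htb, _⟩ =>
        absurd (htb.1.trans_lt htb.2) (not_lt.2 hge)
      rw [this, measure_empty]
      exact zero_le
  have hsub : {ω | ∃ t ∈ T, δ ≤ |X t ω - X (lastQuantile H N t) ω|} ⊆
      ⋃ i ∈ Finset.range N, E i := by
    rintro ω ⟨t, ht, hX⟩
    rcases lastQuantile_spec H hN t with ⟨rfl, h'⟩ | ⟨i, hi, hq, h1, h2⟩
    · rw [h', sub_self, abs_zero] at hX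
      linarith
    · rw [hq] at hX
      exact Set.mem_biUnion (Finset.mem_coe.2 (Finset.mem_range.2 hi)) ⟨t, ht, ⟨h1, h2⟩, hX⟩
  calc _ ≤ μ (⋃ i ∈ Finset.range N, E i) := measure_mono hsub
    _ ≤ ∑ i ∈ Finset.range N, μ (E i) := measure_biUnion_finset_le _ _
    _ ≤ ∑ _i ∈ Finset.range N, ENNReal.ofReal b := Finset.sum_le_sum hE
    _ = ENNReal.ofReal (N * b) := by
      rw [Finset.sum_const, Finset.card_range, nsmul_eq_mul, ENNReal.ofReal_mul (by positivity),
        ENNReal.ofReal_natCast]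
    _ ≤ ENNReal.ofReal δ := ENNReal.ofReal_le_ofReal hb

/-- Exponential decay in `√N` beats the number of blocks, and `2 * (δ / 4 + 1 / √N)` tends to `δ /
2`. The resulting strict inequality leaves room to pass from closed to open events. -/
theorem exists_blockBound_le {δ : ℝ} (hδ : 0 < δ) :
    ∃ N : ℕ, 0 < N ∧ N * blockBound N (δ / 4) ≤ δ ∧ 2 * (δ / 4 + 1 / √N) < δ := by
  have hsqrt : Tendsto (fun N : ℕ => √(N : ℝ)) atTop atTop :=
    Real.tendsto_sqrt_atTop.comp tendsto_natCast_atTop_atTop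
  have hexp : ∀ c : ℝ, 0 < c → Tendsto (fun N : ℕ => (N : ℝ) * (2 * Real.exp (2 - √N * c)))
      atTop (𝓝 0) := by
    intro c hc
    have := ((tendsto_rpow_mul_exp_neg_mul_atTop_nhds_zero 2 c hc).comp hsqrt).const_mul
      (2 * Real.exp 2)
    rw [mul_zero] at this
    refine this.congr fun N => ?_
    simp only [Function.comp_apply]
    rw [show (2 : ℝ) - √N * c = 2 + -c * √N by ring, Real.exp_add, Real.rpow_two,
      Real.sq_sqrt (Nat.cast_nonneg N)]
    ring
  have h1 : Tendsto (fun N : ℕ => (N : ℝ) * blockBound N (δ / 4)) atTop (𝓝 0) := by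
    have := (hexp (δ / 4) (by positivity)).add (hexp 1 one_pos)
    rw [add_zero] at this
    refine this.congr fun N => ?_
    rw [blockBound, mul_one]
    ring
  have h2 : Tendsto (fun N : ℕ => 2 * (δ / 4 + 1 / √(N : ℝ))) atTop (𝓝 (2 * (δ / 4 + 0))) := by
    refine (Tendsto.const_add _ ?_).const_mul _
    simpa only [one_div, Function.comp_def] using tendsto_inv_atTop_zero.comp hsqrt
  obtain ⟨N, hN1, hN2, hN⟩ := ((h1.eventually_le_const hδ).and ((h2.eventually_lt_const
    (show 2 * (δ / 4 + 0) < δ by linarith)).and (eventually_gt_atTop 0))).exists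
  exact ⟨N, hN, hN1, hN2⟩

theorem IsNIGProcess.hasQuantileModulus {Ω : Type*} [MeasurableSpace Ω] {a : ℝ} {H : Measure ℝ}
    [IsProbabilityMeasure H] {P : Kernel Ω ℝ} [IsMarkovKernel P] {μ : Measure Ω}
    (h : IsNIGProcess a H P μ) {N : ℕ} (hN : 0 < N) (ha : 4 * N < a) {δ : ℝ} (hδ : 0 < δ)
    (hb : N * blockBound N (δ / 4) ≤ δ) (hη : 2 * (δ / 4 + 1 / √N) < δ) :
    HasQuantileModulus H N δ (fun t ω => scaledPath a H (P ω) t) μ := by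
  refine hasQuantileModulus_of_block hN hδ hb fun i hi T hu huT hvT => ?_
  refine (measure_mono ?_).trans (h.oscillation_finset hN ha (real_quantile_block_le H hi) hu huT
    hvT (δ / 4))
  rintro ω ⟨t, ht, hX⟩
  exact ⟨t, ht, hη.le.trans hX⟩

/-- The oscillation event at finitely many times, with strict inequality, is open, so the
portmanteau theorem carries the bound for the prelimit processes over to the limit. Only
finite-dimensional laws of `B` enter, so no path regularity is needed. -/
theorem IsBrownianBridge.hasQuantileModulus {H : Measure ℝ} [IsProbabilityMeasure H]
    {Ω : Set.Ioi (0 : ℝ) → Type*} [∀ a, MeasurableSpace (Ω a)] {μ : ∀ a, Measure (Ω a)}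
    [∀ a, IsProbabilityMeasure (μ a)] {P : ∀ a, Kernel (Ω a) ℝ} [∀ a, IsMarkovKernel (P a)]
    (hP : ∀ a : Set.Ioi (0 : ℝ), IsNIGProcess (a : ℝ) H (P a) (μ a))
    {Ω' : Type*} [MeasurableSpace Ω'] {μ' : Measure Ω'} [IsProbabilityMeasure μ']
    {B : EReal → Ω' → ℝ} (hB : IsBrownianBridge H lowerRay B μ') {N : ℕ} (hN : 0 < N) {δ : ℝ}
    (hδ : 0 < δ) (hb : N * blockBound N (δ / 4) ≤ δ) (hη : 2 * (δ / 4 + 1 / √N) < δ) :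
    HasQuantileModulus H N δ B μ' := by
  refine hasQuantileModulus_of_block hN hδ hb fun i hi T hu huT hvT => ?_
  set q := quantile H N i
  let τ : Fin T.card → EReal := fun j => T.equivFin.symm j
  have hτ : ∀ j, τ j ∈ T := fun j => (T.equivFin.symm j).2
  have hτs : ∀ t ∈ T, ∃ j, τ j = t := fun t ht => ⟨T.equivFin ⟨t, ht⟩, by simp [τ]⟩
  obtain ⟨j₀, hj₀⟩ := hτs q hu
  let G : Set (Fin T.card → ℝ) := {y | ∃ j, 2 * (δ / 4 + 1 / √N) < |y j - y j₀|}
  have hG : IsOpen G := by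
    have : G = ⋃ j, {y | 2 * (δ / 4 + 1 / √N) < |y j - y j₀|} := by
      ext y
      simp [G]
    rw [this]
    exact isOpen_iUnion fun j => isOpen_lt continuous_const (by fun_prop)
  have hmX : ∀ a : Set.Ioi (0 : ℝ), Measurable fun ω (j : Fin T.card) =>
      scaledPath a H (P a ω) (τ j) := fun a =>
    measurable_pi_lambda _ fun j => measurable_scaledPath_apply a H (P a) (τ j)
  have hmB : AEMeasurable (fun ω (j : Fin T.card) => B (τ j) ω) μ' :=
    aemeasurable_pi_lambda _ fun j => hB.gaussian.aemeasurable (τ j)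
  let ν : Set.Ioi (0 : ℝ) → ProbabilityMeasure (Fin T.card → ℝ) := fun a =>
    ⟨(μ a).map _, Measure.isProbabilityMeasure_map (hmX a).aemeasurable⟩
  let ν' : ProbabilityMeasure (Fin T.card → ℝ) :=
    ⟨μ'.map _, Measure.isProbabilityMeasure_map hmB⟩
  have hlim : Tendsto ν atTop (𝓝 ν') := by
    refine ProbabilityMeasure.tendsto_iff_forall_integral_tendsto.2 fun f => ?_
    have h := tendsto_integral_fdd hP hB τ f
    simp only [ν, ν', ProbabilityMeasure.coe_mk]
    rw [integral_map hmB f.continuous.aestronglyMeasurable]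
    refine h.congr fun a => ?_
    rw [integral_map (hmX a).aemeasurable f.continuous.aestronglyMeasurable]
  have hle := ProbabilityMeasure.le_liminf_measure_open_of_tendsto hlim hG
  have hub : liminf (fun a => (ν a : Measure (Fin T.card → ℝ)) G) atTop ≤
      ENNReal.ofReal (blockBound N (δ / 4)) := by
    refine liminf_le_of_frequently_le' (Eventually.frequently ?_)
    filter_upwards [eventually_gt_atTop (⟨4 * N, by simpa using hN⟩ : Set.Ioi (0 : ℝ))] with a ha
    simp only [ν, ProbabilityMeasure.coe_mk]
    rw [Measure.map_apply (hmX a) hG.measurableSet]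
    refine (measure_mono ?_).trans ((hP a).oscillation_finset hN (Subtype.coe_lt_coe.2 ha)
      (real_quantile_block_le H hi) hu huT hvT (δ / 4))
    rintro ω ⟨j, hj⟩
    refine ⟨τ j, hτ j, ?_⟩
    simp only [hj₀] at hj
    exact hj.le
  refine le_trans ?_ (hle.trans hub)
  simp only [ν', ProbabilityMeasure.coe_mk]
  rw [Measure.map_apply_of_aemeasurable hmB hG.measurableSet]
  refine measure_mono ?_
  rintro ω ⟨t, ht, hX⟩
  obtain ⟨j, rfl⟩ := hτs t ht
  exact ⟨j, by simp only [hj₀]; exact hη.trans_le hX⟩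

/-- Right continuity replaces all times by a dense sequence, and the event is contained in an
increasing union of events over finite sets. -/
theorem Cadlag.measure_exists_lt_le {Ω : Type*} [MeasurableSpace Ω] {μ : Measure Ω}
    {H : Measure ℝ} {N : ℕ} (hN : 0 < N) {δ : ℝ} (hδ : 0 ≤ δ) {X : Ω → Cadlag}
    (h : HasQuantileModulus H N δ (fun t ω => X ω t) μ) :
    μ {ω | ∃ t, δ < |X ω t - X ω (lastQuantile H N t)|} ≤ ENNReal.ofReal δ := by
  let T : ℕ → Finset EReal := fun n =>
    (Finset.range n).image (TopologicalSpace.denseSeq EReal)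
  have hmono : Monotone fun n => {ω | ∃ t ∈ T n, δ ≤ |X ω t - X ω (lastQuantile H N t)|} := by
    rintro m n hmn ω ⟨t, ht, hX⟩
    exact ⟨t, Finset.image_subset_image (Finset.range_mono hmn) ht, hX⟩
  have hsub : {ω | ∃ t, δ < |X ω t - X ω (lastQuantile H N t)|} ⊆
      ⋃ n, {ω | ∃ t ∈ T n, δ ≤ |X ω t - X ω (lastQuantile H N t)|} := by
    rintro ω ⟨t, hX⟩
    rcases lastQuantile_spec H hN t with ⟨rfl, h'⟩ | ⟨i, hi, hq, h1, h2⟩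
    · rw [h', sub_self, abs_zero] at hX
      linarith
    · rw [hq] at hX
      obtain ⟨k, ⟨hk1, hk2⟩, hkX⟩ := Cadlag.exists_mem_denseSeq h1 h2 hX
      refine Set.mem_iUnion.2 ⟨k + 1, _,
        Finset.mem_image.2 ⟨k, Finset.mem_range.2 k.lt_succ_self, rfl⟩, ?_⟩
      rw [lastQuantile_eq hi.le hk1 hk2]
      exact hkX.le
  refine (measure_mono hsub).trans ?_
  rw [hmono.measure_iUnion]
  exact iSup_le fun n => h (T n)

/-! ### Gaussian Hilbert spaces -/

theorem integral_abs_le_norm_Lp {Ω : Type*} [MeasurableSpace Ω] {P : Measure Ω}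
    [IsProbabilityMeasure P] (f : Lp ℝ 2 P) : ∫ ω, |f ω| ∂P ≤ ‖f‖ := by
  have h : eLpNorm f 1 P ≤ eLpNorm f 2 P :=
    eLpNorm_le_eLpNorm_of_exponent_le one_le_two (Lp.aestronglyMeasurable f)
  rw [Lp.norm_def]
  refine le_trans (le_of_eq ?_) (ENNReal.toReal_mono (Lp.eLpNorm_ne_top f) h)
  simp_rw [← Real.norm_eq_abs]
  rw [integral_norm_eq_lintegral_enorm (Lp.aestronglyMeasurable f), eLpNorm_one_eq_lintegral_enorm]

/-- Lipschitz with constant 1, since the `L¹` norm is at most the `L²` norm on a probability space.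
-/
theorem continuous_integral_cexp {Ω : Type*} [MeasurableSpace Ω] {P : Measure Ω}
    [IsProbabilityMeasure P] :
    Continuous fun f : Lp ℝ 2 P => ∫ ω, Complex.exp (f ω * Complex.I) ∂P := by
  have hint : ∀ f : Lp ℝ 2 P, Integrable (fun ω => Complex.exp (f ω * Complex.I)) P := fun f => by
    refine Integrable.of_bound ?_ 1 (ae_of_all _ fun ω => (Complex.norm_exp_ofReal_mul_I _).le)
    have : Continuous fun x : ℝ => Complex.exp (x * Complex.I) := by fun_prop
    exact this.comp_aestronglyMeasurable (Lp.aestronglyMeasurable f)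
  refine (LipschitzWith.of_dist_le_mul (K := 1) fun f g => ?_).continuous
  rw [dist_eq_norm, ← integral_sub (hint f) (hint g), NNReal.coe_one, one_mul, dist_eq_norm]
  refine (norm_integral_le_integral_norm _).trans ?_
  refine le_trans (integral_mono_ae ((hint f).sub (hint g)).norm ?_ ?_)
    (integral_abs_le_norm_Lp (f - g))
  · exact ((Lp.memLp (f - g)).integrable one_le_two).abs
  · filter_upwards [Lp.coeFn_sub f g] with ω hω
    rw [hω]
    exact norm_cexp_mul_I_sub_le _ _

/-- Every real Hilbert space embeds isometrically into the centred Gaussian variables of some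
probability space. -/
theorem exists_gaussian_isometry.{u} (E : Type u) [NormedAddCommGroup E] [InnerProductSpace ℝ E]
    [CompleteSpace E] :
    ∃ (Ω : Type u) (_ : MeasurableSpace Ω) (P : Measure Ω) (_ : IsProbabilityMeasure P)
      (W : E →ₗᵢ[ℝ] Lp ℝ 2 P), ∀ h, ∫ ω, Complex.exp (W h ω * Complex.I) ∂P =
        Complex.exp (-(‖h‖ ^ 2 / 2 : ℝ)) := by
  -- A Hilbert basis is sent to independent standard Gaussian variables, which are orthonormal in
  -- `L²`.
  obtain ⟨w, b, -⟩ := exists_hilbertBasis ℝ E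
  obtain ⟨Ω, mΩ, P, ξ, hξm, hξ, hind, hP⟩ := exists_iid w (gaussianReal 0 1)
  have hG : ∀ i, HasGaussianLaw (ξ i) P := fun i => (hξ i).hasGaussianLaw
  have hL2 : ∀ i, MemLp (ξ i) 2 P := fun i => (hG i).memLp_two
  have hmean : ∀ i, ∫ ω, ξ i ω ∂P = 0 := fun i => by
    rw [(hξ i).integral_eq, integral_id_gaussianReal]
  let v : w → Lp ℝ 2 P := fun i => (hL2 i).toLp (ξ i)
  have hinner : ∀ i j, inner ℝ (v i) (v j) = ∫ ω, ξ i ω * ξ j ω ∂P := fun i j => by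
    rw [L2.inner_def]
    refine integral_congr_ae ?_
    filter_upwards [(hL2 i).coeFn_toLp, (hL2 j).coeFn_toLp] with ω h1 h2
    simp only [v, h1, h2, RCLike.inner_apply, conj_trivial]
    ring
  have hself : ∀ i, inner ℝ (v i) (v i) = 1 := fun i => by
    have := (hξ i).variance_eq
    rw [variance_id_gaussianReal, variance_of_integral_eq_zero (hξm i).aemeasurable (hmean i)]
      at this
    rw [hinner]
    simpa [← sq] using this
  have hv : Orthonormal ℝ v := by
    refine ⟨fun i => ?_, fun i j hij => ?_⟩
    · rw [← sq_eq_sq₀ (norm_nonneg _) zero_le_one, ← real_inner_self_eq_norm_sq, hself, one_pow]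
    · change inner ℝ (v i) (v j) = 0
      rw [hinner, (hind.indepFun hij).integral_fun_mul_eq_mul_integral
        (hξm i).aestronglyMeasurable (hξm j).aestronglyMeasurable, hmean, zero_mul]
  let W : E →ₗᵢ[ℝ] Lp ℝ 2 P := hv.orthogonalFamily.linearIsometry.comp b.repr.toLinearIsometry
  have hWb : ∀ i, W (b i) = v i := fun i => by
    classical
    have h1 : W (b i) = hv.orthogonalFamily.linearIsometry (b.repr (b i)) := rfl
    rw [h1, b.repr_self]
    refine (OrthogonalFamily.linearIsometry_apply_single _ _).trans ?_
    simp
  refine ⟨Ω, mΩ, P, hP, W, fun h => ?_⟩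
  -- The Gaussian identity is a closed condition on `h`, so it suffices to check it for finite
  -- combinations of basis vectors.
  have hclosed : IsClosed {h : E | ∫ ω, Complex.exp (W h ω * Complex.I) ∂P =
      Complex.exp (-(‖h‖ ^ 2 / 2 : ℝ))} :=
    isClosed_eq (continuous_integral_cexp.comp W.continuous) (by fun_prop)
  have hsub : (Submodule.span ℝ (Set.range b) : Set E) ⊆ {h : E |
      ∫ ω, Complex.exp (W h ω * Complex.I) ∂P = Complex.exp (-(‖h‖ ^ 2 / 2 : ℝ))} := by
    intro h hh
    obtain ⟨c, rfl⟩ := Finsupp.mem_span_range_iff_exists_finsupp.1 hh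
    set h := c.sum fun i a => a • b i with hdef
    have hWh : W h =ᵐ[P] fun ω => ∑ i : c.support, c i * ξ i ω := by
      have e1 : W h = ∑ i : c.support, c i • v i := by
        rw [hdef, Finsupp.sum, map_sum, ← Finset.sum_coe_sort]
        simp only [map_smul, hWb]
      have e2 : ∀ᵐ ω ∂P, ∀ i : c.support, (c i • v i : Lp ℝ 2 P) ω = c i * ξ i ω := by
        refine ae_all_iff.2 fun i => ?_
        filter_upwards [Lp.coeFn_smul (c i) (v i), (hL2 i).coeFn_toLp] with ω h1 h2
        rw [h1, Pi.smul_apply, h2, smul_eq_mul]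
      rw [e1]
      filter_upwards [Lp.coeFn_finsetSum Finset.univ fun i : c.support => c i • v i, e2]
        with ω h1 h2
      rw [h1, Finset.sum_apply]
      exact Finset.sum_congr rfl fun i _ => h2 i
    have hGauss : HasGaussianLaw (W h) P := by
      refine HasGaussianLaw.congr ?_ hWh.symm
      have hi : iIndepFun (fun (i : c.support) ω => c i * ξ i ω) P :=
        (hind.precomp (g := fun i : c.support => (i : w)) Subtype.val_injective).comp
          (fun i x => c i * x) fun i => by fun_prop
      exact hi.hasGaussianLaw_fun_sum fun i => (hG i).fun_smul (c i)
    have hmean' : ∫ ω, W h ω ∂P = 0 := by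
      rw [integral_congr_ae hWh, integral_finsetSum _ fun (i : c.support) _ =>
        (hG i).integrable.const_mul (c i)]
      simp [integral_const_mul, hmean]
    have hvar : Var[W h; P] = ‖h‖ ^ 2 := by
      rw [variance_of_integral_eq_zero hGauss.aemeasurable hmean', ← W.norm_map h,
        ← real_inner_self_eq_norm_sq, L2.inner_def]
      refine integral_congr_ae (ae_of_all _ fun ω => ?_)
      simp [sq]
    have := hGauss.charFun_map_eq 1
    rw [charFun_apply, integral_map hGauss.aemeasurable (by fun_prop)] at this
    simp only [RCLike.inner_apply, conj_trivial, one_mul, mul_one] at this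
    change ∫ ω, Complex.exp (W h ω * Complex.I) ∂P = _
    rw [this, hmean', hvar]
    push_cast
    ring_nf
  have hmem : h ∈ closure (Submodule.span ℝ (Set.range b) : Set E) := by
    have := b.dense_span
    rw [← Submodule.topologicalClosure_coe, this]
    trivial
  exact hclosed.closure_subset_iff.2 hsub hmem

theorem covariance_congr_ae {Ω : Type*} [MeasurableSpace Ω] {P : Measure Ω} {X X' Y Y' : Ω → ℝ}
    (hX : X =ᵐ[P] X') (hY : Y =ᵐ[P] Y') : covariance X Y P = covariance X' Y' P := by
  rw [covariance, covariance, integral_congr_ae hX, integral_congr_ae hY]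
  refine integral_congr_ae ?_
  filter_upwards [hX, hY] with ω h1 h2
  rw [h1, h2]

/-- For every probability measure there is a Gaussian process with the mean and covariance of the
Brownian bridge. -/
theorem exists_isBrownianBridge (H : Measure ℝ) [IsProbabilityMeasure H] :
    ∃ (Ω : Type) (_ : MeasurableSpace Ω) (P : Measure Ω) (_ : IsProbabilityMeasure P)
      (B : EReal → Ω → ℝ), (∀ t, Measurable (B t)) ∧ IsBrownianBridge H lowerRay B P := by
  obtain ⟨Ω, mΩ, P, hP, W, hW⟩ := exists_gaussian_isometry (Lp ℝ 2 H)
  have hlaw : ∀ h : Lp ℝ 2 H, P.map (W h) = gaussianReal 0 (‖h‖ ^ 2).toNNReal := by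
    intro h
    have hm : AEMeasurable (W h) P := (Lp.aestronglyMeasurable (W h)).aemeasurable
    have := Measure.isProbabilityMeasure_map hm
    refine Measure.ext_of_charFun (funext fun s => ?_)
    rw [charFun_gaussianReal, charFun_apply, integral_map hm (by fun_prop)]
    have h1 := hW (s • h)
    rw [map_smul] at h1
    have h2 : ∫ ω, Complex.exp ((s • W h : Lp ℝ 2 P) ω * Complex.I) ∂P =
        ∫ ω, Complex.exp ((inner ℝ (W h ω) s : ℝ) * Complex.I) ∂P := by
      refine integral_congr_ae ?_
      filter_upwards [Lp.coeFn_smul s (W h)] with ω hω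
      rw [hω]
      simp
    rw [← h2, h1, norm_smul, Real.coe_toNNReal _ (by positivity), mul_pow, Real.norm_eq_abs,
      sq_abs]
    push_cast
    ring_nf
  have hGauss : ∀ h : Lp ℝ 2 H, HasGaussianLaw (W h) P := fun h =>
    ⟨by rw [hlaw h]; infer_instance⟩
  have hmean : ∀ h : Lp ℝ 2 H, ∫ ω, W h ω ∂P = 0 := fun h => by
    have := integral_id_gaussianReal (μ := 0) (v := (‖h‖ ^ 2).toNNReal)
    rw [← hlaw h, integral_map (hGauss h).aemeasurable (by fun_prop)] at this
    exact this
  have hcov : ∀ g h : Lp ℝ 2 H, covariance (W g) (W h) P = inner ℝ g h := fun g h => by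
    rw [covariance_eq_sub (hGauss g).memLp_two (hGauss h).memLp_two, hmean, hmean, mul_zero,
      sub_zero, ← W.inner_map_map g h, L2.inner_def]
    refine integral_congr_ae (ae_of_all _ fun ω => ?_)
    simp [mul_comm]
  -- Centred indicators of the half-lines: their inner products in `L²(H)` are the covariances of
  -- the bridge.
  let e : EReal → Lp ℝ 2 H := fun t =>
    indicatorConstLp 2 (measurableSet_lowerRay t) (measure_ne_top H _) 1 -
      H.real (lowerRay t) • indicatorConstLp 2 MeasurableSet.univ (measure_ne_top H _) 1
  have he : ∀ s t, inner ℝ (e s) (e t) =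
      H.real (lowerRay s ∩ lowerRay t) - H.real (lowerRay s) * H.real (lowerRay t) := by
    intro s t
    simp only [e, inner_sub_left, inner_sub_right, inner_smul_left, inner_smul_right,
      L2.real_inner_indicatorConstLp_one_indicatorConstLp_one, Set.univ_inter, Set.inter_univ,
      probReal_univ, conj_trivial]
    ring
  have hB : IsBrownianBridge H lowerRay (fun t => ⇑(W (e t))) P := by
    refine ⟨⟨fun I => ?_⟩, fun t => hmean _, fun s t => by rw [hcov, he]⟩
    have hm : AEMeasurable (fun ω => I.restrict fun t => W (e t) ω) P :=
      aemeasurable_pi_lambda _ fun t => (hGauss (e t)).aemeasurable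
    -- A linear functional of finitely many coordinates is almost surely the image under `W` of one
    -- vector, hence Gaussian.
    refine ⟨isGaussian_of_isGaussian_map fun L => ?_⟩
    rw [AEMeasurable.map_map_of_aemeasurable (by fun_prop) hm]
    classical
    have hLin : (L ∘ fun ω => I.restrict fun t => W (e t) ω) =ᵐ[P]
        W (∑ t : I, L (Pi.single t 1) • e t) := by
      have e2 : ∀ᵐ ω ∂P, ∀ t : I, (L (Pi.single t 1) • W (e t) : Lp ℝ 2 P) ω =
          L (Pi.single t 1) * W (e t) ω :=
        ae_all_iff.2 fun t => Lp.coeFn_smul _ _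
      rw [map_sum]
      simp only [map_smul]
      filter_upwards [Lp.coeFn_finsetSum Finset.univ fun t : I => L (Pi.single t 1) • W (e t), e2]
        with ω h1 h2
      rw [h1, Finset.sum_apply, Function.comp_apply]
      conv_lhs => rw [← ContinuousLinearMap.coe_coe, LinearMap.pi_apply_eq_sum_univ]
      refine Finset.sum_congr rfl fun t _ => ?_
      have h3 : (fun j => if t = j then (1 : ℝ) else 0) = Pi.single t 1 := by
        ext j
        simp [Pi.single_apply, eq_comm]
      rw [h2 t, mul_comm, smul_eq_mul, h3]
      rfl
    rw [Measure.map_congr hLin]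
    exact (hGauss _).isGaussian_map
  refine ⟨Ω, mΩ, P, hP, fun t => (hGauss (e t)).aemeasurable.mk _,
    fun t => (hGauss (e t)).aemeasurable.measurable_mk, ?_⟩
  have hae : ∀ t, W (e t) =ᵐ[P] (hGauss (e t)).aemeasurable.mk _ := fun t =>
    (hGauss (e t)).aemeasurable.ae_eq_mk
  exact ⟨hB.gaussian.congr hae, fun t => by rw [← integral_congr_ae (hae t)]; exact hB.mean t,
    fun s t => by rw [← covariance_congr_ae (hae s) (hae t)]; exact hB.cov s t⟩

/-! ### Existence of càdlàg modifications -/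

theorem Cadlag.exists_of_uniform_approx {y : EReal → ℝ}
    (h : ∀ ε > 0, ∃ x : Cadlag, ∀ t, |x t - y t| ≤ ε) : ∃ z : Cadlag, ∀ t, z t = y t := by
  refine ⟨⟨y, fun t => ?_, fun t => ?_⟩, fun t => rfl⟩
  · refine Metric.tendsto_nhds.2 fun ε hε => ?_
    obtain ⟨x, hx⟩ := h (ε / 4) (by positivity)
    have := Metric.tendsto_nhds.1 (x.right_continuous t) (ε / 4) (by positivity)
    filter_upwards [this] with s hs
    have h1 := hx s
    have h2 := hx t
    rw [Real.dist_eq] at hs ⊢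
    rw [abs_le] at h1 h2
    rw [abs_lt] at hs ⊢
    constructor <;> linarith
  · rcases (𝓝[<] t).eq_or_neBot with hbot | hne
    · exact ⟨0, by rw [hbot]; exact tendsto_bot⟩
    · refine cauchy_map_iff_exists_tendsto.1 (Metric.cauchy_iff.2 ⟨hne.map y, fun ε hε => ?_⟩)
      obtain ⟨x, hx⟩ := h (ε / 8) (by positivity)
      obtain ⟨l, hl⟩ := x.left_limit t
      refine ⟨y '' {s | dist (x s) l < ε / 8},
        image_mem_map (Metric.tendsto_nhds.1 hl (ε / 8) (by positivity)), ?_⟩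
      rintro _ ⟨s, hs, rfl⟩ _ ⟨s', hs', rfl⟩
      have h1 := hx s
      have h2 := hx s'
      rw [Set.mem_ofPred_eq, Real.dist_eq, abs_lt] at hs hs'
      rw [Real.dist_eq, abs_lt]
      rw [abs_le] at h1 h2
      constructor <;> linarith

/-- Step paths sampled at quantiles of levels with errors `2⁻ʲ` are, by Borel–Cantelli, almost
surely uniformly Cauchy, and a uniform limit of càdlàg functions is càdlàg. At each fixed time the
step values also converge to `X t`, so the limit is a modification. -/
theorem exists_cadlag_modification {Ω : Type*} [MeasurableSpace Ω] {μ : Measure Ω} {H : Measure ℝ}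
    {X : EReal → Ω → ℝ} (hX : ∀ t, Measurable (X t))
    (h : ∀ δ : ℝ, 0 < δ → ∃ N : ℕ, 0 < N ∧ HasQuantileModulus H N δ X μ) :
    ∃ Y : Ω → Cadlag, (∀ t, Measurable fun ω => Y ω t) ∧ ∀ t, X t =ᵐ[μ] fun ω => Y ω t := by
  let δ : ℕ → ℝ := fun j => (1 / 2) ^ j
  have hδ : ∀ j, 0 < δ j := fun j => by positivity
  have hδs : Summable δ := summable_geometric_two
  choose N hN hmod using fun j => h (δ j) (hδ j)
  let S : ℕ → Ω → Cadlag := fun j ω =>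
    stepPath (quantile H (N j)) (N j) fun i => X (quantile H (N j) i) ω
  have hS : ∀ j ω t, S j ω t = X (lastQuantile H (N j) t) ω := fun j ω t => rfl
  have hSm : ∀ j t, Measurable fun ω => S j ω t := fun j t => hX _
  let Q : ℕ → Finset EReal := fun j => (Finset.range (N j + 1)).image (quantile H (N j))
  have hQ : ∀ j t, lastQuantile H (N j) t ∈ Q j := fun j t =>
    Finset.mem_image.2 ⟨_, Finset.mem_range.2
      (Nat.lt_succ_of_le (lastIndex_le (quantile H (N j)) (N j) t)), rfl⟩
  let A : ℕ → Set Ω := fun j =>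
    {ω | ∃ t ∈ Q j ∪ Q (j + 1), δ j ≤ |X t ω - X (lastQuantile H (N j) t) ω|} ∪
    {ω | ∃ t ∈ Q j ∪ Q (j + 1), δ (j + 1) ≤ |X t ω - X (lastQuantile H (N (j + 1)) t) ω|}
  have hA : ∀ᵐ ω ∂μ, ∀ᶠ j in atTop, ω ∉ A j := by
    refine ae_eventually_notMem (ne_top_of_le_ne_top
      (hδs.add ((summable_nat_add_iff 1).2 hδs)).tsum_ofReal_ne_top (ENNReal.tsum_le_tsum fun j => ?_))
    rw [ENNReal.ofReal_add (hδ j).le (hδ (j + 1)).le]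
    exact (measure_union_le _ _).trans (add_le_add (hmod j _) (hmod (j + 1) _))
  have hstep : ∀ j ω, ω ∉ A j → ∀ t, dist (S j ω t) (S (j + 1) ω t) ≤ δ j := by
    intro j ω hω t
    simp only [A, Set.mem_union, Set.mem_ofPred_eq, not_or, not_exists, not_and, not_le] at hω
    rw [hS, hS, Real.dist_eq]
    -- The later of the two sampling points belongs to a finite quantile set, and its last quantile
    -- at the other level is the earlier point. Comparing two levels at all `t` thus uses only
    -- finitely many times.
    rcases le_total (lastQuantile H (N j) t) (lastQuantile H (N (j + 1)) t) with hle | hle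
    · have := hω.1 _ (Finset.mem_union_right _ (hQ (j + 1) t))
      rw [lastQuantile_eq_of_le (hN j) hle (lastQuantile_le H (hN _) t), abs_sub_comm] at this
      exact this.le
    · have := hω.2 _ (Finset.mem_union_left _ (hQ j t))
      rw [lastQuantile_eq_of_le (hN _) hle (lastQuantile_le H (hN _) t)] at this
      refine this.le.trans ?_
      exact pow_le_pow_of_le_one (by norm_num) (by norm_num) j.le_succ
  have hlim : ∀ᵐ ω ∂μ, ∃ z : Cadlag, ∀ t, Tendsto (fun j => S j ω t) atTop (𝓝 (z t)) := by
    filter_upwards [hA] with ω hω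
    obtain ⟨J, hJ⟩ := eventually_atTop.1 hω
    have hgeo : ∀ t k, dist (S (J + k) ω t) (S (J + (k + 1)) ω t) ≤ δ J * (1 / 2) ^ k :=
      fun t k => by
        rw [← pow_add]
        exact hstep (J + k) ω (hJ _ (Nat.le_add_right J k)) t
    have hex : ∀ t, ∃ l, Tendsto (fun k => S (J + k) ω t) atTop (𝓝 l) := fun t =>
      cauchySeq_tendsto_of_complete
        (cauchySeq_of_le_geometric (1 / 2) (δ J) (by norm_num) (hgeo t))
    choose y hy using hex
    have hdist : ∀ t k, dist (S (J + k) ω t) (y t) ≤ δ J * (1 / 2) ^ k / (1 - 1 / 2) := fun t k =>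
      dist_le_of_le_geometric_of_tendsto (1 / 2) (δ J) (by norm_num) (hgeo t) (hy t) k
    obtain ⟨z, hz⟩ := Cadlag.exists_of_uniform_approx (y := y) fun ε hε => by
      have : Tendsto (fun k : ℕ => δ J * (1 / 2) ^ k / (1 - 1 / 2)) atTop (𝓝 0) := by
        simpa using ((tendsto_pow_atTop_nhds_zero_of_lt_one (r := (1 / 2 : ℝ)) (by norm_num)
          (by norm_num)).const_mul (δ J)).div_const (1 - 1 / 2)
      obtain ⟨k, hk⟩ := (this.eventually_le_const hε).exists
      exact ⟨S (J + k) ω, fun t => (hdist t k).trans hk⟩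
    refine ⟨z, fun t => ?_⟩
    rw [hz t]
    refine (tendsto_add_atTop_iff_nat J).1 ((hy t).congr fun k => ?_)
    rw [add_comm]
  have hmodif : ∀ t, ∀ᵐ ω ∂μ, Tendsto (fun j => S j ω t) atTop (𝓝 (X t ω)) := by
    intro t
    have : ∀ᵐ ω ∂μ, ∀ᶠ j in atTop,
        ω ∉ {ω | ∃ s ∈ ({t} : Finset EReal), δ j ≤ |X s ω - X (lastQuantile H (N j) s) ω|} :=
      ae_eventually_notMem (ne_top_of_le_ne_top hδs.tsum_ofReal_ne_top
        (ENNReal.tsum_le_tsum fun j => hmod j _))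
    filter_upwards [this] with ω hω
    refine tendsto_iff_dist_tendsto_zero.2 (squeeze_zero' (Eventually.of_forall fun _ => dist_nonneg)
      ?_ hδs.tendsto_atTop_zero)
    filter_upwards [hω] with j hj
    simp only [Finset.mem_singleton, exists_eq_left, not_le] at hj
    rw [hS, dist_comm]
    exact hj.le
  -- The set of non-convergence may fail to be measurable. A measurable null superset replaces it,
  -- and the paths are set to zero there.
  let Z : Set Ω := toMeasurable μ
    {ω | ¬∃ z : Cadlag, ∀ t, Tendsto (fun j => S j ω t) atTop (𝓝 (z t))}
  have hZm : MeasurableSet Z := measurableSet_toMeasurable _ _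
  have hZ0 : ∀ᵐ ω ∂μ, ω ∉ Z := by
    rw [ae_iff]
    simp only [not_not, Set.ofPred_mem_eq]
    rw [measure_toMeasurable]
    exact hlim
  have hZ : ∀ ω, ∃ z : Cadlag, ∀ t,
      Tendsto (fun j => Zᶜ.indicator (fun ω => S j ω t) ω) atTop (𝓝 (z t)) := by
    intro ω
    by_cases hω : ω ∈ Z
    · refine ⟨stepPath (fun _ => ⊥) 0 fun _ => 0, fun t => ?_⟩
      simp only [Set.indicator_of_notMem (Set.notMem_compl_iff.2 hω)]
      exact tendsto_const_nhds
    · simp only [Set.indicator_of_mem (Set.mem_compl hω)]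
      by_contra hcon
      exact hω (subset_toMeasurable _ _ hcon)
  choose Y hY using hZ
  refine ⟨Y, fun t => ?_, fun t => ?_⟩
  · exact measurable_of_tendsto_metrizable (fun j => (hSm j t).indicator hZm.compl)
      (tendsto_pi_nhds.2 fun ω => hY ω t)
  · filter_upwards [hZ0, hmodif t] with ω h1 h2
    refine tendsto_nhds_unique h2 ?_
    simpa only [Set.indicator_of_mem (Set.mem_compl h1)] using hY ω t

/-- The law on the path space of the càdlàg modification of the Gaussian process. The processes in
`hP` supply its quantile modulus. -/
theorem exists_measure_cadlag_isBrownianBridge {H : Measure ℝ} [IsProbabilityMeasure H]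
    {Ω : Set.Ioi (0 : ℝ) → Type*} [∀ a, MeasurableSpace (Ω a)] {μ : ∀ a, Measure (Ω a)}
    [∀ a, IsProbabilityMeasure (μ a)] {P : ∀ a, Kernel (Ω a) ℝ} [∀ a, IsMarkovKernel (P a)]
    (hP : ∀ a : Set.Ioi (0 : ℝ), IsNIGProcess (a : ℝ) H (P a) (μ a)) :
    ∃ ν : Measure Cadlag, IsProbabilityMeasure ν ∧
      IsBrownianBridge H lowerRay (fun t x => x t) ν := by
  obtain ⟨Ω', _, P', _, B, hBm, hB⟩ := exists_isBrownianBridge H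
  obtain ⟨Y, hYm, hY⟩ := exists_cadlag_modification (μ := P') (H := H) hBm fun δ hδ => by
    obtain ⟨N, hN, h1, h2⟩ := exists_blockBound_le hδ
    exact ⟨N, hN, hB.hasQuantileModulus hP hN hδ h1 h2⟩
  have hm : Measurable Y := Cadlag.measurable_of_apply hYm
  refine ⟨P'.map Y, Measure.isProbabilityMeasure_map hm.aemeasurable, ⟨fun I => ⟨?_⟩⟩, fun t => ?_,
    fun s t => ?_⟩
  · have hr : Measurable fun x : Cadlag => I.restrict fun t => x t :=
      measurable_pi_lambda _ fun t => Cadlag.measurable_apply t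
    rw [Measure.map_map hr hm]
    exact ((hB.gaussian.congr hY).hasGaussianLaw I).isGaussian_map
  · rw [integral_map hm.aemeasurable (Cadlag.measurable_apply t).aestronglyMeasurable,
      ← integral_congr_ae (hY t)]
    exact hB.mean t
  · rw [covariance_map (Cadlag.measurable_apply s).aestronglyMeasurable
      (Cadlag.measurable_apply t).aestronglyMeasurable hm.aemeasurable]
    refine Eq.trans ?_ (hB.cov s t)
    exact (covariance_congr_ae (hY s) (hY t)).symm

/-! ### Convergence in distribution -/

/-- Off an event of probability at most `δ`, the path and its quantile sample are within `δ`
uniformly, hence in the Skorokhod distance, and the Lipschitz bound applies. On that event `f`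
varies by at most `C`. -/
theorem abs_integral_sub_sample_le {Ω : Type*} [MeasurableSpace Ω] {μ : Measure Ω}
    [IsProbabilityMeasure μ] {H : Measure ℝ} {N : ℕ} (hN : 0 < N) {δ : ℝ} (hδ : 0 ≤ δ)
    {X : Ω → Cadlag} (hX : AEMeasurable X μ) (h : HasQuantileModulus H N δ (fun t ω => X ω t) μ)
    {f : Cadlag → ℝ} {C : ℝ} {L : NNReal} (hC : ∀ x y, dist (f x) (f y) ≤ C)
    (hL : LipschitzWith L f) :
    |∫ ω, f (X ω) ∂μ - ∫ ω, f ((X ω).sample (quantile H N) N) ∂μ| ≤ (L + C) * δ := by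
  let E : Set Ω := toMeasurable μ {ω | ∃ t, δ < |X ω t - X ω (lastQuantile H N t)|}
  have hE : μ.real E ≤ δ := by
    rw [measureReal_def, measure_toMeasurable]
    exact ENNReal.toReal_le_of_le_ofReal hδ (Cadlag.measure_exists_lt_le hN hδ h)
  have hEm : MeasurableSet E := measurableSet_toMeasurable _ _
  have hC0 : 0 ≤ C := dist_nonneg.trans (hC (stepPath (fun _ => ⊥) 0 fun _ => 0)
    (stepPath (fun _ => ⊥) 0 fun _ => 0))
  have hπ : Measurable fun x : Cadlag => x.sample (quantile H N) N :=
    Cadlag.measurable_sample (X := id) Cadlag.measurable_apply _ _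
  have hint : ∀ {Y : Ω → Cadlag}, AEMeasurable Y μ → Integrable (fun ω => f (Y ω)) μ := by
    intro Y hY
    let x₀ := stepPath (fun _ => ⊥) 0 fun _ => 0
    refine Integrable.of_bound (hL.continuous.measurable.comp_aemeasurable hY).aestronglyMeasurable
      (C + |f x₀|) (ae_of_all _ fun ω => ?_)
    have := hC (Y ω) x₀
    rw [Real.dist_eq] at this
    rw [Real.norm_eq_abs]
    linarith [abs_sub_abs_le_abs_sub (f (Y ω)) (f x₀)]
  have hint' : Integrable (fun ω => f ((X ω).sample (quantile H N) N)) μ :=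
    hint (hπ.comp_aemeasurable hX)
  rw [← integral_sub (hint hX) hint', ← Real.norm_eq_abs]
  refine (norm_integral_le_integral_norm _).trans ?_
  refine (integral_mono ((hint hX).sub hint').norm
    (g := fun ω => L * δ + E.indicator (fun _ => C) ω)
    ((integrable_const _).add ((integrable_const C).indicator hEm)) fun ω => ?_).trans ?_
  · by_cases hω : ω ∈ E
    · simp only [Set.indicator_of_mem hω]
      have := hC (X ω) ((X ω).sample (quantile H N) N)
      rw [dist_eq_norm] at this
      have hLδ : 0 ≤ L * δ := by positivity
      rw [Pi.sub_apply]
      linarith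
    · simp only [Set.indicator_of_notMem hω, add_zero]
      have h1 : ∀ t, |X ω t - X ω (lastQuantile H N t)| ≤ δ := by
        by_contra! hcon
        exact hω (subset_toMeasurable _ _ hcon)
      have h2 : edist (X ω) ((X ω).sample (quantile H N) N) ≤ ENNReal.ofReal δ :=
        Cadlag.edist_le_of_forall fun t => by
          rw [edist_dist]
          exact ENNReal.ofReal_le_ofReal (h1 t)
      have h3 := (hL (X ω) ((X ω).sample (quantile H N) N)).trans (mul_le_mul_right h2 _)
      rw [edist_dist, ← ENNReal.ofReal_coe_nnreal, ← ENNReal.ofReal_mul L.coe_nonneg,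
        ENNReal.ofReal_le_ofReal_iff (by positivity), dist_eq_norm] at h3
      exact h3
  · rw [integral_add (integrable_const _) ((integrable_const C).indicator hEm), integral_const,
      integral_indicator_const _ hEm, probReal_univ, one_smul, smul_eq_mul]
    nlinarith

/-- Bounded Lipschitz test functions suffice. Sampling at the same quantiles costs at most `ε / 4`
for the bridge and, uniformly in `a > 4 * N`, for the scaled path; the sampled integrals converge by
the finite-dimensional limit. -/
theorem tendstoInDistribution_scaledPath {H : Measure ℝ} [IsProbabilityMeasure H]
    {Ω : Set.Ioi (0 : ℝ) → Type*} [∀ a, MeasurableSpace (Ω a)] {μ : ∀ a, Measure (Ω a)}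
    [∀ a, IsProbabilityMeasure (μ a)] {P : ∀ a, Kernel (Ω a) ℝ} [∀ a, IsMarkovKernel (P a)]
    (hP : ∀ a : Set.Ioi (0 : ℝ), IsNIGProcess (a : ℝ) H (P a) (μ a))
    {Ω' : Type*} [MeasurableSpace Ω'] {μ' : Measure Ω'} [IsProbabilityMeasure μ']
    {B : Ω' → Cadlag} (hBm : AEMeasurable B μ')
    (hB : IsBrownianBridge H lowerRay (fun t ω => B ω t) μ') :
    TendstoInDistribution (fun (a : Set.Ioi (0 : ℝ)) ω => scaledPath (a : ℝ) H (P a ω))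
      atTop B μ μ' := by
  have hXm : ∀ a : Set.Ioi (0 : ℝ), Measurable fun ω => scaledPath (a : ℝ) H (P a ω) := fun a =>
    Cadlag.measurable_of_apply (measurable_scaledPath_apply a H (P a))
  have := isCountablyGenerated_atTop_Ioi
  refine ⟨fun a => (hXm a).aemeasurable, hBm, ?_⟩
  refine tendsto_iff_forall_lipschitz_integral_tendsto.2 ?_
  rintro f ⟨C, hC⟩ ⟨L, hL⟩
  simp only [ProbabilityMeasure.coe_mk]
  rw [integral_map hBm hL.continuous.measurable.aestronglyMeasurable]
  simp_rw [integral_map (hXm _).aemeasurable hL.continuous.measurable.aestronglyMeasurable]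
  have hC0 : 0 ≤ C := dist_nonneg.trans (hC (stepPath (fun _ => ⊥) 0 fun _ => 0)
    (stepPath (fun _ => ⊥) 0 fun _ => 0))
  refine Metric.tendsto_nhds.2 fun ε hε => ?_
  obtain ⟨δ, hδ, hδε⟩ : ∃ δ : ℝ, 0 < δ ∧ (L + C) * δ ≤ ε / 4 := by
    refine ⟨ε / 4 / (L + C + 1), by positivity, ?_⟩
    rw [mul_div_assoc', div_le_iff₀ (by positivity)]
    nlinarith
  obtain ⟨N, hN, hb, hη⟩ := exists_blockBound_le hδ
  -- The sampling points are fixed, so building a step path from its values is Lipschitz and `g` is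
  -- continuous.
  let g : BoundedContinuousFunction (Fin (N + 1) → ℝ) ℝ :=
    BoundedContinuousFunction.mkOfBound
      ⟨fun y => f (stepPath (quantile H N) N y),
        hL.continuous.comp (lipschitzWith_stepPath (quantile H N) N).continuous⟩ C
      fun y z => hC _ _
  have hfdd := tendsto_integral_fdd hP hB (fun i : Fin (N + 1) => quantile H N i) g
  have h1 := abs_integral_sub_sample_le hN hδ.le hBm (hB.hasQuantileModulus hP hN hδ hb hη) hC hL
  filter_upwards [Metric.tendsto_nhds.1 hfdd (ε / 4) (by positivity),
    eventually_gt_atTop (⟨4 * N, by simpa using hN⟩ : Set.Ioi (0 : ℝ))] with a ha1 ha2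
  have h2 := abs_integral_sub_sample_le hN hδ.le (hXm a).aemeasurable
    ((hP a).hasQuantileModulus hN (Subtype.coe_lt_coe.2 ha2) hδ hb hη) hC hL
  rw [Real.dist_eq] at ha1 ⊢
  change |∫ ω, f ((scaledPath a H (P a ω)).sample (quantile H N) N) ∂μ a -
    ∫ ω, f ((B ω).sample (quantile H N) N) ∂μ'| < ε / 4 at ha1
  rw [abs_lt] at ha1 ⊢
  rw [abs_le] at h1 h2
  constructor <;> linarith

end NIG

end

theorem theorem1
    (H : MeasureTheory.Measure ℝ) [MeasureTheory.IsProbabilityMeasure H]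
    (Ω : Set.Ioi (0 : ℝ) → Type*) [∀ a, MeasurableSpace (Ω a)]
    (μ : ∀ a, MeasureTheory.Measure (Ω a)) [∀ a, MeasureTheory.IsProbabilityMeasure (μ a)]
    (P : ∀ a, ProbabilityTheory.Kernel (Ω a) ℝ) [∀ a, ProbabilityTheory.IsMarkovKernel (P a)]
    (hP : ∀ a : Set.Ioi (0 : ℝ), NIG.IsNIGProcess (a : ℝ) H (P a) (μ a)) :
    (∃ ν : MeasureTheory.Measure NIG.Cadlag, MeasureTheory.IsProbabilityMeasure ν ∧
      NIG.IsBrownianBridge H NIG.lowerRay (fun t x => x t) ν) ∧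
    ∀ (Ω' : Type*) [MeasurableSpace Ω'] (μ' : MeasureTheory.Measure Ω')
      [MeasureTheory.IsProbabilityMeasure μ'] (B : Ω' → NIG.Cadlag),
      AEMeasurable B μ' →
      NIG.IsBrownianBridge H NIG.lowerRay (fun t ω => B ω t) μ' →
      MeasureTheory.TendstoInDistribution
        (fun (a : Set.Ioi (0 : ℝ)) ω => NIG.scaledPath (a : ℝ) H (P a ω)) Filter.atTop B μ μ' := by
  exact ⟨NIG.exists_measure_cadlag_isBrownianBridge hP, fun Ω' _ μ' _ B hBm hB =>
    NIG.tendstoInDistribution_scaledPath hP hBm hB⟩
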